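/- **Setup.** Fix $d\in\mathbb{N}$ and $L\ge 1$. For each $n$ there is a probability space (its law may vary with $n$; the index $n$ is suppressed) carrying, for nodes $i\in[n]=\{1,\dots,n\}$, covariates $x_i\in\mathcal{X}\subseteq\mathbb{R}^d$, a random binary adjacency matrix $(d_{ij})$, potential outcomes $y_i(1),y_i(0)\in\mathbb{R}$ and a treatment $t_i\in\{0,1\}$; put $y_i=t_iy_i(1)+(1-t_i)y_i(0)$. Let $\mathcal{N}(i)=\{j:d_{ij}=1\}$; for vectors $(h_j)$ let $\overline h_{\mathcal{N}(i)}=|\mathcal{N}(i)|^{-1}\sum_{j\in\mathcal{N}(i)}h_j$, or $0$ if $\mathcal{N}(i)=\emptyset$. Let $D(i)$ be the increasing tuple of elements of $\mathcal{N}(i)$, $D_0(i)=(i)$, $D_l(i)$ the concatenation of $D(j)$ over $j\in D_{l-1}(i)$, $\xi_{i,0}=x_i$, $\xi_{i,l}=(\xi_{i,l-1},((x_k)_{k\in D(j)})_{j\in D_{l-1}(i)})$, $\xi_i=\xi_{i,L}$ and $\upsilon_i=(y_i,t_i,\xi_i)$. *Network heterogeneity.* For measurable $f=(f^{(1)},\dots,f^{(L)})$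 with hidden dimensions fixed in $n$ and scalar output, $h_{*i}^{(0)}=x_i$, $h_{*i}^{(l)}(f)=f^{(l)}(h_{*i}^{(l-1)}(f),\overline h_{*\mathcal{N}(i)}^{(l-1)}(f))$, $z_{*i}(f)=h_{*i}^{(L)}(f)$. Outcomes are real with loss $\ell_y(y,z)=\frac12(y-z)^2$ and $h_\mu(z)=z$, or take values in $\{0,1\}$ with $\ell_y=\ell_p$ and $h_\mu=h_p$, where $\ell_p(y,z)=-yz+\log(1+e^z)$ and $h_p(z)=e^z/(1+e^z)$. Let $f_*^t\in\arg\min_f\mathbb{E}[\ell_y(y_i(t),z_{*i}(f))]$ for $t\in\{0,1\}$ and $f_*^p\in\arg\min_f\mathbb{E}[\ell_p(t_i,z_{*i}(f))]$. Put $\mu_t(\xi_i)=\mathbb{E}[y_i(t)\mid h_{*i}^{(L-1)}(f_*^t),\overline h_{*\mathcal{N}(i)}^{(L-1)}(f_*^t)]$, $p_1(\xi_i)=\Pr(t_i=1\mid h_{*i}^{(L-1)}(f_*^p),\overline h_{*\mathcal{N}(i)}^{(L-1)}(f_*^p))$, $p_0=1-p_1$ and $u_i(t)=y_i(t)-\mu_t(\xi_i)$.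 *GNN estimators.* For parameters $\theta$ (matrices $A^{(l)},A_{\mathcal N}^{(l)}$ and vectors $b^{(l)}$, $l\in[L]$, a vector $a$ and a scalar $b$) put $h_i^{(0)}=x_i$, $h_i^{(l)}=\sigma(A^{(l)}h_i^{(l-1)}+A_{\mathcal N}^{(l)}\overline h_{\mathcal{N}(i)}^{(l-1)}+b^{(l)})$ with a fixed activation function $\sigma$ applied entrywise, and $z_i(\theta)=a\cdot h_i^{(L)}+b$. Let $\Theta_{\bar z}$ be the set of all $\theta$, of layer widths that may depend on $n$ and on the model that is fitted, with $|z_i(\theta)|\le\bar z$ for every node of every finite network with covariates in $\mathcal{X}$; $\bar z$ is fixed. Let $\hat\theta_t\in\arg\min_{\theta\in\Theta_{\bar z}}\sum_{i:t_i=t}\ell_y(y_i,z_i(\theta))$ and $\hat\theta_p\in\arg\min_{\theta\in\Theta_{\bar z}}\sum_{i}\ell_p(t_i,z_i(\theta))$ be chosen so that the fitted values $z_i(\hat\theta_t)$ and $z_i(\hat\theta_p)$ are measurable functions of $(y_j,t_j,\xi_j)_{j\in[n]}$ and of $(t_j,\xi_j)_{j\in[n]}$, respectively. Put $\hat\mu_t(\xi_i)=h_\mu(z_i(\hat\theta_t))$,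 $\hat p_1(\xi_i)=h_p(z_i(\hat\theta_p))$, $\hat p_0=1-\hat p_1$. *Estimator.* Let $s$ be a known measurable policy with values in $\{0,1\}$, $s_1=s$, $s_0=1-s$, $\pi(s)=\mathbb{E}[s_1(\xi_i)y_i(1)+s_0(\xi_i)y_i(0)]$, $\varphi_t(\upsilon_i)=\frac{\mathbb{I}\{t_i=t\}}{p_t(\xi_i)}(y_i-\mu_t(\xi_i))+\mu_t(\xi_i)$, $\zeta_i=s_1(\xi_i)\varphi_1(\upsilon_i)+s_0(\xi_i)\varphi_0(\upsilon_i)$, let $\hat\varphi_t,\hat\zeta_i$ be the same with $\hat p_t,\hat\mu_t$ in place of $p_t,\mu_t$, and let $\Sigma_n=\mathrm{Var}(n^{-1/2}\sum_i\zeta_i)$ and $\hat\pi(s)=\frac1n\sum_i\hat\zeta_i$. **Assumption II.** Constants do not depend on $n$, and conditions in which $t$ occurs freely hold for both $t\in\{0,1\}$. 1. $(y_i(1),y_i(0),t_i,\xi_i)$, $i\in[n]$, are identically distributed. 2. $\max_i|z_{*i}(f_*^t)|<c_z<\infty$ a.s. 3. (a) $\frac1n\sum_i(\hat p_t(\xi_i)-p_t(\xi_i))^2=o_p(1)$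 and $\frac1n\sum_i(\hat\mu_t(\xi_i)-\mu_t(\xi_i))^2=o_p(1)$; (b) the product of the square roots of these two averages is $o_p(n^{-1/2})$; (c) $\frac1n\sum_i s_t(\xi_i)(\hat\mu_t(\xi_i)-\mu_t(\xi_i))\bigl(1-\frac{\mathbb{I}\{t_i=t\}}{p_t(\xi_i)}\bigr)=o_p(n^{-1/2})$. 4. $p_{\min}\le p_1(\xi_i)\le1-p_{\min}$ and $p_{\min}\le\hat p_1(\xi_i)\le1-p_{\min}$ a.s. for all $i$, with $0<p_{\min}<\frac12$. 5. $\mathbb{E}[y_i(t)\mid\xi_i,t_i]=\mathbb{E}[y_i(t)\mid\xi_i]$ a.s. for all $i$. 6. $\mu_t(\xi_i)=\mathbb{E}[y_i(t)\mid\xi_i]$ and $p_1(\xi_i)=\Pr(t_i=1\mid\xi_i)$ a.s. for all $i$. 7. $\mathbb{E}[u_i(t)u_j(t)\mid(\xi_k,t_k)_{k\in[n]}]=0$ a.s. for all $i\ne j$ and all $n$. 8. $\mathbb{E}[y_i(t)^2]<\infty$ and $\max_i\mathbb{E}[|y_i(t)|^2\mid(\xi_k,t_k)_{k\in[n]}]\le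 c_y<\infty$ a.s. for all $n$. 9. $\liminf_n\Sigma_n>c_\sigma>0$. 10. For each $n$ there is a dependency graph of $(\upsilon_i)_{i\in[n]}$, i.e. a graph on $[n]$ such that $(\upsilon_i)_{i\in A}$ and $(\upsilon_i)_{i\in B}$ are independent whenever $A,B\subseteq[n]$ are disjoint with no edge between them, such that, with $\omega_n$ its maximal degree ($\omega_n=1$ if there are no edges), $\frac{\omega_n\sum_i\mathbb{E}[\zeta_i^2\mathbb{I}\{|\zeta_i|>a_n\}]}{n\Sigma_n}\to0$ and $\frac{n^{1/m}\omega_n^{(m-1)/m}a_n}{\sqrt{n\Sigma_n}}\to0$ for some real sequence $(a_n)$ and some integer $m\ge1$. **Assumption III.** 1. For each $n$, $[n]$ is partitioned (non-randomly) into $\bar c=\bar c_n$ nonempty clusters of sizes $n_c$, $c\in[\bar c]$; the families of $\zeta_i$ in different clusters are independent, and $\bar c\to\infty$. 2. $\max_cn_c=O(n/\bar c)$. 3. $\max_i\mathbb{E}|y_i(t)|^{2+\delta}\le c_y<\infty$ for $t\in\{0,1\}$ and all $n$, with fixed $\delta,c_y>0$. 4. $\liminf_n\frac{\Sigma_n}{n/\bar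 c}>c_\sigma>0$. **Corollary 1.** Under Assumption II, as $n\to\infty$, $$\Sigma_n^{-1/2}\sqrt n(\hat\pi(s)-\pi(s))\overset{d}{\to}N(0,1).$$ Let $\hat\Sigma_n=\frac1{\bar c}\sum_{c\in[\bar c]}\bigl(n_c^2\frac{\bar c}{n}\bigr)\bigl(\bar{\hat\zeta}_c-\bar{\hat\zeta}\bigr)^2$, where $\bar{\hat\zeta}=\frac1n\sum_i\hat\zeta_i$ and $\bar{\hat\zeta}_c$ is the mean of the $\hat\zeta_i$ over the $n_c$ nodes of cluster $c$. Under Assumptions II and III, as $n\to\infty$, $$\hat\Sigma_n^{-1/2}\sqrt n(\hat\pi(s)-\pi(s))\overset{d}{\to}N(0,1).$$ -/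

import Mathlib

open MeasureTheory ProbabilityTheory Filter Topology

noncomputable section

namespace NetCausal

/-! ### Local network information -/

/-- Finite tuples of arbitrary length with entries in `α`. -/
abbrev Tuple (α : Type*) := Σ m : ℕ, (Fin m → α)

/-- The tuple `(g k)_{k ∈ l}` indexed by a list `l`. -/
def tupleOver {α β : Type*} (l : List α) (g : α → β) : Tuple β :=
  ⟨l.length, fun k => g (l.get k)⟩

/-- Values of the `l`-hop local network information: a covariate vector for `l = 0`; each further
hop appends a tuple of tuples of covariate vectors. -/
def LocalInfo (d : ℕ) : ℕ → Type
  | 0 => Fin d → ℝ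
  | l + 1 => LocalInfo d l × Tuple (Tuple (Fin d → ℝ))

/-- The natural product / disjoint-union sigma-algebra on `LocalInfo`. -/
@[reducible] def LocalInfo.measurableSpace (d : ℕ) : (l : ℕ) → MeasurableSpace (LocalInfo d l)
  | 0 => inferInstanceAs (MeasurableSpace (Fin d → ℝ))
  | l + 1 => @Prod.instMeasurableSpace _ _ (LocalInfo.measurableSpace d l)
      (inferInstanceAs (MeasurableSpace (Tuple (Tuple (Fin d → ℝ)))))

instance (d l : ℕ) : MeasurableSpace (LocalInfo d l) := LocalInfo.measurableSpace d l

/-- The neighbours `{j : d_ij = 1}` of node `i`, as a list in increasing order. -/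
def nbrList {n : ℕ} (D : Fin n → Fin n → Bool) (i : Fin n) : List (Fin n) :=
  (List.finRange n).filter (fun j => D i j)

/-- The tuple of end points of walks of length `l` from `i` (with repetitions). -/
def hopList {n : ℕ} (D : Fin n → Fin n → Bool) (i : Fin n) : ℕ → List (Fin n)
  | 0 => [i]
  | l + 1 => (hopList D i l).flatMap (nbrList D)

/-- The `l`-hop network information of node `i`: start with `x i`, and at each further hop append
the covariates of the neighbours of every node in the previous hop. -/
def localInfo {d n : ℕ} (x : Fin n → Fin d → ℝ) (D : Fin n → Fin n → Bool) (i : Fin n) :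
    (l : ℕ) → LocalInfo d l
  | 0 => x i
  | l + 1 => (localInfo x D i l,
      tupleOver (hopList D i l) (fun j => tupleOver (nbrList D j) x))

/-! ### Layered network models -/

/-- The mean of `h j` over the neighbours `j` of `i`; it is `0` if there is no neighbour. -/
def nbrMean {n m : ℕ} (D : Fin n → Fin n → Bool) (i : Fin n) (h : Fin n → Fin m → ℝ) :
    Fin m → ℝ :=
  ((Finset.univ.filter (fun j => D i j)).card : ℝ)⁻¹ •
    ∑ j ∈ Finset.univ.filter (fun j => D i j), h j

/-- Dimension of the `l`-th embedding: `d` covariates for `l = 0`; layer `l + 1` has width `w l`. -/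
def layerDim (d : ℕ) (w : ℕ → ℕ) : ℕ → ℕ
  | 0 => d
  | l + 1 => w l

/-- Embeddings of all nodes: layer `l + 1` applies `f l` to a node's embedding in layer `l` and the
mean embedding of its neighbours in layer `l`. -/
def embed {d n : ℕ} (x : Fin n → Fin d → ℝ) (D : Fin n → Fin n → Bool) (w : ℕ → ℕ)
    (f : (l : ℕ) → (Fin (layerDim d w l) → ℝ) → (Fin (layerDim d w l) → ℝ) → (Fin (w l) → ℝ)) :
    (l : ℕ) → Fin n → (Fin (layerDim d w l) → ℝ)
  | 0, i => x i
  | l + 1, i => f l (embed x D w f l i) (nbrMean D i (embed x D w f l))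

/-- The (measurable, otherwise unrestricted) functions composing a network heterogeneity with
`K + 1` layers: `K` hidden layers of widths `w 0, …, w (K - 1)` and a scalar output layer. Only
the hidden layers `l < K` are used. -/
structure HetFun (d K : ℕ) (w : ℕ → ℕ) where
  hidden : (l : ℕ) → (Fin (layerDim d w l) → ℝ) → (Fin (layerDim d w l) → ℝ) → (Fin (w l) → ℝ)
  out : (Fin (layerDim d w K) → ℝ) → (Fin (layerDim d w K) → ℝ) → ℝ
  measurable_hidden : ∀ l, Measurable
    (fun p : (Fin (layerDim d w l) → ℝ) × (Fin (layerDim d w l) → ℝ) => hidden l p.1 p.2)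
  measurable_out : Measurable
    (fun p : (Fin (layerDim d w K) → ℝ) × (Fin (layerDim d w K) → ℝ) => out p.1 p.2)

/-- The penultimate-layer embedding of node `i` together with the mean penultimate-layer embedding
of its neighbours. -/
def HetFun.penult {d K n : ℕ} {w : ℕ → ℕ} (f : HetFun d K w) (x : Fin n → Fin d → ℝ)
    (D : Fin n → Fin n → Bool) (i : Fin n) :
    (Fin (layerDim d w K) → ℝ) × (Fin (layerDim d w K) → ℝ) :=
  (embed x D w f.hidden K i, nbrMean D i (embed x D w f.hidden K))

/-- The final-layer output `z_{*i}(f)`. -/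
def HetFun.z {d K n : ℕ} {w : ℕ → ℕ} (f : HetFun d K w) (x : Fin n → Fin d → ℝ)
    (D : Fin n → Fin n → Bool) (i : Fin n) : ℝ :=
  f.out (f.penult x D i).1 (f.penult x D i).2

/-- Parameters of a graph neural network with `L` layers of widths `w 0, …, w (L - 1)` followed by
an affine scalar output. Only the layers `l < L` are used. -/
structure GNNParam (d L : ℕ) (w : ℕ → ℕ) where
  A : (l : ℕ) → Matrix (Fin (w l)) (Fin (layerDim d w l)) ℝ
  AN : (l : ℕ) → Matrix (Fin (w l)) (Fin (layerDim d w l)) ℝ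
  bias : (l : ℕ) → Fin (w l) → ℝ
  a : Fin (layerDim d w L) → ℝ
  b : ℝ

/-- The network output `z_i(θ)` with activation function `act`. -/
def GNNParam.z {d L n : ℕ} {w : ℕ → ℕ} (θ : GNNParam d L w) (act : ℝ → ℝ)
    (x : Fin n → Fin d → ℝ) (D : Fin n → Fin n → Bool) (i : Fin n) : ℝ :=
  θ.a ⬝ᵥ embed x D w
    (fun l u v r => act (((θ.A l).mulVec u + (θ.AN l).mulVec v + θ.bias l) r)) L i + θ.b

/-- Parameters whose output is bounded by `zbar` over all finite networks with covariates in
`𝒳`. -/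
def boundedParams (d L : ℕ) (w : ℕ → ℕ) (act : ℝ → ℝ) (𝒳 : Set (Fin d → ℝ)) (zbar : ℝ) :
    Set (GNNParam d L w) :=
  {θ | ∀ (m : ℕ) (x : Fin m → Fin d → ℝ) (D : Fin m → Fin m → Bool),
    (∀ j, x j ∈ 𝒳) → ∀ i, |θ.z act x D i| ≤ zbar}

/-! ### Losses and links -/

/-- Real-valued or binary outcome variables. -/
inductive OutcomeKind
  | real
  | binary

def logistic (z : ℝ) : ℝ := Real.exp z / (1 + Real.exp z)

def logisticLoss (y z : ℝ) : ℝ := -y * z + Real.log (1 + Real.exp z)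

/-- Least squares loss for real outcomes, logistic loss for binary ones. -/
def OutcomeKind.loss : OutcomeKind → ℝ → ℝ → ℝ
  | .real => fun y z => 1 / 2 * (y - z) ^ 2
  | .binary => logisticLoss

/-- The link function for the conditional mean of the outcome. -/
def OutcomeKind.link : OutcomeKind → ℝ → ℝ
  | .real => fun z => z
  | .binary => logistic

/-- The indicator of `a = b`, as a real number. -/
def ind (a b : Bool) : ℝ := if a = b then 1 else 0

/-! ### Data, nuisance functions and the estimator for one sample size -/

/-- All objects for a sample of `n` nodes: covariates, (random, possibly directed) adjacency
matrix, potential outcomes `pot t i`, treatments, the functions `fOut t`, `fProp` of the network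
heterogeneities, and the estimated network parameters `θOut t`, `θProp` (of widths `vOut t` and
`vProp`). The number of layers is `K + 1`. -/
structure Study (Ω : Type*) [MeasurableSpace Ω] (d K n : ℕ) (wOut : Bool → ℕ → ℕ)
    (wProp : ℕ → ℕ) where
  x : Ω → Fin n → Fin d → ℝ
  adj : Ω → Fin n → Fin n → Bool
  pot : Bool → Fin n → Ω → ℝ
  treat : Fin n → Ω → Bool
  measurable_x : Measurable x
  measurable_adj : Measurable adj
  measurable_pot : ∀ t i, Measurable (pot t i)
  measurable_treat : ∀ i, Measurable (treat i)
  fOut : (t : Bool) → HetFun d K (wOut t)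
  fProp : HetFun d K wProp
  vOut : Bool → ℕ → ℕ
  vProp : ℕ → ℕ
  θOut : (t : Bool) → Ω → GNNParam d (K + 1) (vOut t)
  θProp : Ω → GNNParam d (K + 1) vProp

namespace Study

variable {Ω : Type*} [MeasurableSpace Ω] {d K n : ℕ} {wOut : Bool → ℕ → ℕ} {wProp : ℕ → ℕ}

/-- The observed outcome `y_i = t_i y_i(1) + (1 - t_i) y_i(0)`. -/
def y (S : Study Ω d K n wOut wProp) (i : Fin n) (ω : Ω) : ℝ :=
  ind (S.treat i ω) true * S.pot true i ω + (1 - ind (S.treat i ω) true) * S.pot false i ω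

/-- The local network information `ξ_i` up to distance `L = K + 1`. -/
def ξ (S : Study Ω d K n wOut wProp) (i : Fin n) (ω : Ω) : LocalInfo d (K + 1) :=
  localInfo (S.x ω) (S.adj ω) i (K + 1)

/-- `υ_i = (y_i, t_i, ξ_i)`. -/
def υ (S : Study Ω d K n wOut wProp) (i : Fin n) (ω : Ω) : ℝ × Bool × LocalInfo d (K + 1) :=
  (S.y i ω, S.treat i ω, S.ξ i ω)

/-- The network heterogeneity `z_{*i}(f_*^t)`. -/
def zOut (S : Study Ω d K n wOut wProp) (t : Bool) (i : Fin n) (ω : Ω) : ℝ :=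
  (S.fOut t).z (S.x ω) (S.adj ω) i

/-- The sigma-algebra of the penultimate-layer embeddings in `z_{*i}(f_*^t)`. -/
abbrev embSigma (S : Study Ω d K n wOut wProp) (t : Bool) (i : Fin n) : MeasurableSpace Ω :=
  MeasurableSpace.comap (fun ω => (S.fOut t).penult (S.x ω) (S.adj ω) i) inferInstance

/-- The sigma-algebra of the penultimate-layer embeddings in `z_{*i}(f_*^p)`. -/
abbrev embSigmaProp (S : Study Ω d K n wOut wProp) (i : Fin n) : MeasurableSpace Ω :=
  MeasurableSpace.comap (fun ω => S.fProp.penult (S.x ω) (S.adj ω) i) inferInstance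

/-- `σ(ξ_i)`. -/
abbrev infoSigma (S : Study Ω d K n wOut wProp) (i : Fin n) : MeasurableSpace Ω :=
  MeasurableSpace.comap (S.ξ i) inferInstance

/-- `σ(ξ_i, t_i)`. -/
abbrev infoTreatSigma (S : Study Ω d K n wOut wProp) (i : Fin n) : MeasurableSpace Ω :=
  MeasurableSpace.comap (fun ω => (S.ξ i ω, S.treat i ω)) inferInstance

/-- `σ({ξ_i, t_i}_{i ∈ [n]})`. -/
abbrev designSigma (S : Study Ω d K n wOut wProp) : MeasurableSpace Ω :=
  MeasurableSpace.comap (fun ω (i : Fin n) => (S.ξ i ω, S.treat i ω)) inferInstance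

/-- `σ({y_i, t_i, ξ_i}_{i ∈ [n]})`. -/
abbrev dataSigma (S : Study Ω d K n wOut wProp) : MeasurableSpace Ω :=
  MeasurableSpace.comap (fun ω (i : Fin n) => S.υ i ω) inferInstance

/-- `μ_t(ξ_i)`: conditional expectation of `y_i(t)` given the penultimate-layer embeddings. -/
def μ (S : Study Ω d K n wOut wProp) (P : Measure Ω) (t : Bool) (i : Fin n) : Ω → ℝ :=
  condExp (S.embSigma t i) P (S.pot t i)

/-- `p_t(ξ_i)`: `p_1` is the conditional probability of `t_i = 1` given the penultimate-layer
embeddings, and `p_0 = 1 - p_1`. -/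
def p (S : Study Ω d K n wOut wProp) (P : Measure Ω) (t : Bool) (i : Fin n) (ω : Ω) : ℝ :=
  if t then condExp (S.embSigmaProp i) P (fun ω' => ind (S.treat i ω') true) ω
  else 1 - condExp (S.embSigmaProp i) P (fun ω' => ind (S.treat i ω') true) ω

/-- The fitted outcome regression. -/
def μHat (S : Study Ω d K n wOut wProp) (kind : OutcomeKind) (act : ℝ → ℝ) (t : Bool) (i : Fin n)
    (ω : Ω) : ℝ :=
  kind.link ((S.θOut t ω).z act (S.x ω) (S.adj ω) i)

/-- The fitted propensity score. -/
def pHat (S : Study Ω d K n wOut wProp) (act : ℝ → ℝ) (t : Bool) (i : Fin n) (ω : Ω) : ℝ :=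
  if t then logistic ((S.θProp ω).z act (S.x ω) (S.adj ω) i)
  else 1 - logistic ((S.θProp ω).z act (S.x ω) (S.adj ω) i)

/-- The policy weight: `s_1(ξ_i) = s(ξ_i)` and `s_0(ξ_i) = 1 - s(ξ_i)`. -/
def sw (S : Study Ω d K n wOut wProp) (s : LocalInfo d (K + 1) → Bool) (t : Bool) (i : Fin n)
    (ω : Ω) : ℝ :=
  ind (s (S.ξ i ω)) t

/-- `φ_t(υ_i)`. -/
def φ (S : Study Ω d K n wOut wProp) (P : Measure Ω) (t : Bool) (i : Fin n) (ω : Ω) : ℝ :=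
  ind (S.treat i ω) t / S.p P t i ω * (S.y i ω - S.μ P t i ω) + S.μ P t i ω

/-- The estimate of `φ_t(υ_i)`. -/
def φHat (S : Study Ω d K n wOut wProp) (kind : OutcomeKind) (act : ℝ → ℝ) (t : Bool) (i : Fin n)
    (ω : Ω) : ℝ :=
  ind (S.treat i ω) t / S.pHat act t i ω * (S.y i ω - S.μHat kind act t i ω)
    + S.μHat kind act t i ω

/-- `ζ_i`. -/
def ζ (S : Study Ω d K n wOut wProp) (P : Measure Ω) (s : LocalInfo d (K + 1) → Bool) (i : Fin n)
    (ω : Ω) : ℝ :=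
  S.sw s true i ω * S.φ P true i ω + S.sw s false i ω * S.φ P false i ω

/-- The estimate of `ζ_i`. -/
def ζHat (S : Study Ω d K n wOut wProp) (kind : OutcomeKind) (act : ℝ → ℝ)
    (s : LocalInfo d (K + 1) → Bool) (i : Fin n) (ω : Ω) : ℝ :=
  S.sw s true i ω * S.φHat kind act true i ω + S.sw s false i ω * S.φHat kind act false i ω

/-- The residual `u_i(t) = y_i(t) - μ_t(ξ_i)`. -/
def u (S : Study Ω d K n wOut wProp) (P : Measure Ω) (t : Bool) (i : Fin n) (ω : Ω) : ℝ :=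
  S.pot t i ω - S.μ P t i ω

/-- `Σ_n`, the variance of `n^{-1/2} ∑ ζ_i`. -/
def sigmaN (S : Study Ω d K n wOut wProp) (P : Measure Ω) (s : LocalInfo d (K + 1) → Bool) : ℝ :=
  variance (fun ω => (√(n : ℝ))⁻¹ * ∑ i, S.ζ P s i ω) P

/-- The average outcome of the policy `s`, computed at node `i`. -/
def policyValue (S : Study Ω d K n wOut wProp) (P : Measure Ω) (s : LocalInfo d (K + 1) → Bool)
    (i : Fin n) : ℝ :=
  ∫ ω, S.sw s true i ω * S.pot true i ω + S.sw s false i ω * S.pot false i ω ∂P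

/-- The doubly robust estimator. -/
def piHat (S : Study Ω d K n wOut wProp) (kind : OutcomeKind) (act : ℝ → ℝ)
    (s : LocalInfo d (K + 1) → Bool) (ω : Ω) : ℝ :=
  (n : ℝ)⁻¹ * ∑ i, S.ζHat kind act s i ω

/-- The size of cluster `c` under the cluster assignment `cl`. -/
def clusterSize {cbar : ℕ} (cl : Fin n → Fin cbar) (c : Fin cbar) : ℕ :=
  (Finset.univ.filter (fun i => cl i = c)).card

/-- The mean of the estimated `ζ_i` over cluster `c`. -/
def clusterMeanHat (S : Study Ω d K n wOut wProp) (kind : OutcomeKind) (act : ℝ → ℝ)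
    (s : LocalInfo d (K + 1) → Bool) {cbar : ℕ} (cl : Fin n → Fin cbar) (c : Fin cbar) (ω : Ω) :
    ℝ :=
  (clusterSize cl c : ℝ)⁻¹ * ∑ i ∈ Finset.univ.filter (fun i => cl i = c), S.ζHat kind act s i ω

/-- The feasible cluster variance estimator. -/
def sigmaHat (S : Study Ω d K n wOut wProp) (kind : OutcomeKind) (act : ℝ → ℝ)
    (s : LocalInfo d (K + 1) → Bool) {cbar : ℕ} (cl : Fin n → Fin cbar) (ω : Ω) : ℝ :=
  (cbar : ℝ)⁻¹ * ∑ c, ((clusterSize cl c : ℝ) ^ 2 * ((cbar : ℝ) / n)) *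
    (S.clusterMeanHat kind act s cl c ω - (n : ℝ)⁻¹ * ∑ i, S.ζHat kind act s i ω) ^ 2

/-- The definitions of the population functions and of the first-stage estimators as minimizers.
Covariates take values in `𝒳`; binary outcomes are `0` or `1`. The fitted values are computed
(measurably) from the observations that enter the respective minimization: `(t_j, ξ_j)_j` for the
propensity score and `(y_j, t_j, ξ_j)_j` for the outcome regressions. -/
structure Setup (S : Study Ω d K n wOut wProp) (P : Measure Ω) (kind : OutcomeKind)
    (act : ℝ → ℝ) (𝒳 : Set (Fin d → ℝ)) (zbar : ℝ) : Prop where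
  covariates : ∀ᵐ ω ∂P, ∀ i, S.x ω i ∈ 𝒳
  binary_outcome : kind = .binary → ∀ t i, ∀ᵐ ω ∂P, S.pot t i ω = 0 ∨ S.pot t i ω = 1
  fOut_argmin : ∀ (t : Bool) (i : Fin n) (g : HetFun d K (wOut t)),
    ∫⁻ ω, ENNReal.ofReal (kind.loss (S.pot t i ω) ((S.fOut t).z (S.x ω) (S.adj ω) i)) ∂P ≤
      ∫⁻ ω, ENNReal.ofReal (kind.loss (S.pot t i ω) (g.z (S.x ω) (S.adj ω) i)) ∂P
  fProp_argmin : ∀ (i : Fin n) (g : HetFun d K wProp),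
    ∫⁻ ω, ENNReal.ofReal
        (logisticLoss (ind (S.treat i ω) true) (S.fProp.z (S.x ω) (S.adj ω) i)) ∂P ≤
      ∫⁻ ω, ENNReal.ofReal (logisticLoss (ind (S.treat i ω) true) (g.z (S.x ω) (S.adj ω) i)) ∂P
  θOut_argmin : ∀ t : Bool, ∀ᵐ ω ∂P,
    S.θOut t ω ∈ boundedParams d (K + 1) (S.vOut t) act 𝒳 zbar ∧
      ∀ θ ∈ boundedParams d (K + 1) (S.vOut t) act 𝒳 zbar,
        ∑ i ∈ Finset.univ.filter (fun i => S.treat i ω = t),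
            kind.loss (S.y i ω) ((S.θOut t ω).z act (S.x ω) (S.adj ω) i) ≤
          ∑ i ∈ Finset.univ.filter (fun i => S.treat i ω = t),
            kind.loss (S.y i ω) (θ.z act (S.x ω) (S.adj ω) i)
  θProp_argmin : ∀ᵐ ω ∂P,
    S.θProp ω ∈ boundedParams d (K + 1) S.vProp act 𝒳 zbar ∧
      ∀ θ ∈ boundedParams d (K + 1) S.vProp act 𝒳 zbar,
        ∑ i, logisticLoss (ind (S.treat i ω) true) ((S.θProp ω).z act (S.x ω) (S.adj ω) i) ≤
          ∑ i, logisticLoss (ind (S.treat i ω) true) (θ.z act (S.x ω) (S.adj ω) i)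
  measurable_fitOut : ∀ (t : Bool) (i : Fin n),
    Measurable[S.dataSigma] (fun ω => (S.θOut t ω).z act (S.x ω) (S.adj ω) i)
  measurable_fitProp : ∀ i : Fin n,
    Measurable[S.designSigma] (fun ω => (S.θProp ω).z act (S.x ω) (S.adj ω) i)

end Study

/-! ### Dependency graphs and stochastic order symbols -/

/-- `G` is a dependency graph of the family `X`: subfamilies indexed by disjoint sets of vertices
with no edge between them are independent. -/
def IsDependencyGraph {Ω ι β : Type*} [MeasurableSpace Ω] [MeasurableSpace β]
    (X : ι → Ω → β) (G : SimpleGraph ι) (P : Measure Ω) : Prop :=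
  ∀ A B : Set ι, Disjoint A B → (∀ a ∈ A, ∀ b ∈ B, ¬ G.Adj a b) →
    IndepFun (fun ω (a : A) => X a ω) (fun ω (b : B) => X b ω) P

/-- The maximal degree of `G`, set to `1` if there are no edges. -/
def maxDeg {n : ℕ} (G : SimpleGraph (Fin n)) : ℕ :=
  max 1 (Finset.univ.sup fun i => (G.neighborSet i).ncard)

/-- `X_n = o_p(1)`. -/
def IsOpOne {Ω : ℕ → Type*} [∀ n, MeasurableSpace (Ω n)] (P : ∀ n, Measure (Ω n))
    (X : ∀ n, Ω n → ℝ) : Prop :=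
  ∀ ε : ℝ, 0 < ε → Tendsto (fun n => P n {ω | ε ≤ |X n ω|}) atTop (𝓝 0)

/-! ### The two sets of assumptions -/

/-- The conditions for asymptotic normality, on a triangular array of samples. -/
structure AssumptionII {Ω : ℕ → Type*} [∀ n, MeasurableSpace (Ω n)] (P : ∀ n, Measure (Ω n))
    {d K : ℕ} {wOut : Bool → ℕ → ℕ} {wProp : ℕ → ℕ} (S : ∀ n, Study (Ω n) d K n wOut wProp)
    (kind : OutcomeKind) (act : ℝ → ℝ) (s : LocalInfo d (K + 1) → Bool) : Prop where
  identDistrib : ∀ n (i j : Fin n), IdentDistrib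
    (fun ω => ((S n).pot true i ω, (S n).pot false i ω, (S n).treat i ω, (S n).ξ i ω))
    (fun ω => ((S n).pot true j ω, (S n).pot false j ω, (S n).treat j ω, (S n).ξ j ω)) (P n) (P n)
  bounded_het : ∃ cz : ℝ, ∀ n t, ∀ᵐ ω ∂P n, ∀ i, |(S n).zOut t i ω| < cz
  consistent_p : ∀ t, IsOpOne P fun n ω =>
    (n : ℝ)⁻¹ * ∑ i, ((S n).pHat act t i ω - (S n).p (P n) t i ω) ^ 2
  consistent_μ : ∀ t, IsOpOne P fun n ω =>
    (n : ℝ)⁻¹ * ∑ i, ((S n).μHat kind act t i ω - (S n).μ (P n) t i ω) ^ 2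
  product_rate : ∀ t, IsOpOne P fun n ω => √(n : ℝ) *
    (√((n : ℝ)⁻¹ * ∑ i, ((S n).μHat kind act t i ω - (S n).μ (P n) t i ω) ^ 2) *
      √((n : ℝ)⁻¹ * ∑ i, ((S n).pHat act t i ω - (S n).p (P n) t i ω) ^ 2))
  orthogonality : ∀ t, IsOpOne P fun n ω => √(n : ℝ) *
    ((n : ℝ)⁻¹ * ∑ i, (S n).sw s t i ω * ((S n).μHat kind act t i ω - (S n).μ (P n) t i ω) *
      (1 - ind ((S n).treat i ω) t / (S n).p (P n) t i ω))
  overlap : ∃ pmin : ℝ, 0 < pmin ∧ pmin < 1 / 2 ∧ ∀ n (i : Fin n), ∀ᵐ ω ∂P n,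
    (pmin ≤ (S n).p (P n) true i ω ∧ (S n).p (P n) true i ω ≤ 1 - pmin) ∧
    (pmin ≤ (S n).pHat act true i ω ∧ (S n).pHat act true i ω ≤ 1 - pmin)
  unconfounded : ∀ n (i : Fin n) t,
    condExp ((S n).infoTreatSigma i) (P n) ((S n).pot t i) =ᵐ[P n]
      condExp ((S n).infoSigma i) (P n) ((S n).pot t i)
  sufficient_out : ∀ n (i : Fin n) t,
    condExp ((S n).embSigma t i) (P n) ((S n).pot t i) =ᵐ[P n]
      condExp ((S n).infoSigma i) (P n) ((S n).pot t i)
  sufficient_prop : ∀ n (i : Fin n),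
    condExp ((S n).embSigmaProp i) (P n) (fun ω => ind ((S n).treat i ω) true) =ᵐ[P n]
      condExp ((S n).infoSigma i) (P n) (fun ω => ind ((S n).treat i ω) true)
  uncorrelated : ∀ n (i j : Fin n), i ≠ j → ∀ t,
    condExp (S n).designSigma (P n) (fun ω => (S n).u (P n) t i ω * (S n).u (P n) t j ω)
      =ᵐ[P n] 0
  square_integrable : ∀ n t i, MemLp ((S n).pot t i) 2 (P n)
  second_moment : ∃ cy : ℝ, 0 < cy ∧ ∀ n t, ∀ᵐ ω ∂P n, ∀ i,
    condExp (S n).designSigma (P n) (fun ω' => |(S n).pot t i ω'| ^ 2) ω ≤ cy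
  nondegenerate : ∃ cσ : ℝ, 0 < cσ ∧
    ENNReal.ofReal cσ < liminf (fun n => ENNReal.ofReal ((S n).sigmaN (P n) s)) atTop
  dependency : ∃ G : ∀ n, SimpleGraph (Fin n),
    (∀ n, IsDependencyGraph (S n).υ (G n) (P n)) ∧
    ∃ (a : ℕ → ℝ) (m : ℕ), 1 ≤ m ∧
      Tendsto (fun n => (maxDeg (G n) : ℝ) *
          (∑ i, ∫ ω, {ω' | a n < |(S n).ζ (P n) s i ω'|}.indicator
            (fun ω' => (S n).ζ (P n) s i ω' ^ 2) ω ∂P n) / (n * (S n).sigmaN (P n) s))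
        atTop (𝓝 0) ∧
      Tendsto (fun n : ℕ => (n : ℝ) ^ ((1 : ℝ) / m) * (maxDeg (G n) : ℝ) ^ (((m : ℝ) - 1) / m) *
          a n / √(n * (S n).sigmaN (P n) s))
        atTop (𝓝 0)

/-- The additional conditions for clustered data: `cl n` assigns each node to one of the `cbar n`
(nonempty) clusters. -/
structure AssumptionIII {Ω : ℕ → Type*} [∀ n, MeasurableSpace (Ω n)] (P : ∀ n, Measure (Ω n))
    {d K : ℕ} {wOut : Bool → ℕ → ℕ} {wProp : ℕ → ℕ} (S : ∀ n, Study (Ω n) d K n wOut wProp)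
    (s : LocalInfo d (K + 1) → Bool) (cbar : ℕ → ℕ) (cl : ∀ n, Fin n → Fin (cbar n)) : Prop where
  nonempty_clusters : ∀ n, Function.Surjective (cl n)
  independent_clusters : ∀ n, iIndepFun
    (fun (c : Fin (cbar n)) ω (i : {i : Fin n // cl n i = c}) => (S n).ζ (P n) s i ω) (P n)
  many_clusters : Tendsto cbar atTop atTop
  balanced_sizes : ∃ C : ℝ, ∀ᶠ n in atTop, ∀ c,
    (Study.clusterSize (cl n) c : ℝ) ≤ C * ((n : ℝ) / cbar n)
  higher_moment : ∃ δ cy : ℝ, 0 < δ ∧ 0 < cy ∧ ∀ n t (i : Fin n),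
    ∫⁻ ω, ENNReal.ofReal (|(S n).pot t i ω| ^ (2 + δ)) ∂P n ≤ ENNReal.ofReal cy
  nondegenerate : ∃ cσ : ℝ, 0 < cσ ∧ ENNReal.ofReal cσ <
    liminf (fun n : ℕ => ENNReal.ofReal (((n : ℝ) / cbar n)⁻¹ * (S n).sigmaN (P n) s)) atTop

end NetCausal

end

open NetCausal

/-! The estimator is first replaced by the mean of the influence functions. For each treatment,
`sw_mul_φHat_sub` splits the error of the estimated score into the term that
`AssumptionII.orthogonality` makes negligible, a weight error times a residual `u`, and the same
weight error times the regression error. The last product is controlled by Cauchy–Schwarz and the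
product rate. In the second, the weight error is a function of the design `(ξ, t)` alone, because
the propensity fit is, and the residuals are uncorrelated given the design; so the second moment of
the sum is of order `∑ E (pHat - p)²`, which is `o(n)` because the propensities are bounded. This
gives `isOpOne_piHat_sub`, and unconfoundedness gives the mean of the influence functions
(`integral_ζ`).

The central limit theorem under a dependency graph is proved by complex analysis. For variables
bounded by `A` and degree at most `M`, expand one factor `exp (z X_j) = 1 + (exp (z X_j) - 1)` at a
time. An induction (`cluster_bound`) shows that adding a variable changes the moment generating
function by a factor close to `1` as long as `|z|` is at most of order `1 / (M A)`. The function
therefore has no zero on a disc of that radius, and its logarithm there is at most `n / M`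
(`exists_log_complexMGF`). By Cauchy's estimates and the rate condition of order `m`, these
logarithms are asymptotically polynomials of bounded degree. Since `|E exp (z W)| ≤ E exp (Re z ·
W)`, they satisfy `Re q(z) ≤ Re q(Re z)`, which forces degree at most two, as in Marcinkiewicz's
theorem (`tendsto_coeff_zero_of_re_le`). The mean and the variance fix the limit `z² / 2`.
Truncation at `a n` reduces square integrable arrays to bounded ones
(`tendsto_charFun_of_isDependencyGraph`).

For the feasible variance, normalized cluster sums are independent with bounded moments of order `2
+ δ`, so a law of large numbers applies to their squares. The estimation error in the cluster sums
is small in mean square. The estimator is thus ratio-consistent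
(`isOpOne_sigmaHat_div_sigmaN_sub_one`), and Slutsky's lemma in the form
`tendstoInDistribution_of_ratio` yields both limits. -/

noncomputable section

namespace NetCausal

/-! ### A cluster bound for partition functions with a dependency graph -/

/-- Number of vertices of `A` adjacent to a vertex of `B`. -/
def adjCount {ι : Type*} (G : SimpleGraph ι) (B A : Finset ι) : ℕ :=
  Set.ncard {j | j ∈ A ∧ ∃ b ∈ B, G.Adj b j}

lemma adjCount_le_add {ι : Type*} [DecidableEq ι] (G : SimpleGraph ι) (B A : Finset ι) (j : ι)
    {M : ℕ} (hM : (G.neighborSet j).ncard ≤ M) (hfin : (G.neighborSet j).Finite) :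
    adjCount G (insert j B) A ≤ adjCount G B A + M := by
  have hsub : {k | k ∈ A ∧ ∃ b ∈ insert j B, G.Adj b k} ⊆
      {k | k ∈ A ∧ ∃ b ∈ B, G.Adj b k} ∪ G.neighborSet j := by
    rintro k ⟨hk, b, hb, hbk⟩
    rcases Finset.mem_insert.1 hb with rfl | hb
    · exact Or.inr hbk
    · exact Or.inl ⟨hk, b, hb, hbk⟩
  have hf : ({k | k ∈ A ∧ ∃ b ∈ B, G.Adj b k} ∪ G.neighborSet j).Finite :=
    (A.finite_toSet.subset fun k hk => hk.1).union hfin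
  calc _ ≤ _ := Set.ncard_le_ncard hsub hf
    _ ≤ _ := Set.ncard_union_le _ _
    _ ≤ _ := by unfold adjCount; omega

lemma adjCount_erase {ι : Type*} [DecidableEq ι] (G : SimpleGraph ι) (B A : Finset ι) {j b : ι}
    (hj : j ∈ A) (hb : b ∈ B) (hbj : G.Adj b j) :
    adjCount G B (A.erase j) + 1 = adjCount G B A := by
  have hmem : j ∈ {k | k ∈ A ∧ ∃ b ∈ B, G.Adj b k} := ⟨hj, b, hb, hbj⟩
  have hf : {k | k ∈ A ∧ ∃ b ∈ B, G.Adj b k}.Finite := A.finite_toSet.subset fun k hk => hk.1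
  have := Set.ncard_sdiff_singleton_add_one hmem hf
  rw [adjCount, adjCount, ← this]
  congr 2
  ext k
  simp only [Set.mem_ofPred_eq, Finset.mem_erase, Set.mem_sdiff, Set.mem_singleton_iff]
  tauto

/-- Bounds the price of enlarging the set `B` of the induction by one vertex, whose up to `M`
neighbours may each cost a factor `1 + 1 / M`. -/
lemma one_add_inv_pow_le {M : ℕ} (hM : 1 ≤ M) : (1 + 1 / (M : ℝ)) ^ M ≤ 3 := by
  have hM' : (0 : ℝ) < M := by exact_mod_cast hM
  calc (1 + 1 / (M : ℝ)) ^ M ≤ Real.exp (1 / M) ^ M := by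
        gcongr
        rw [add_comm]; exact Real.add_one_le_exp _
    _ = Real.exp 1 := by
        rw [← Real.exp_nat_mul]; congr 1; field_simp
    _ ≤ 3 := by linarith [Real.exp_one_lt_d9]

/-- Control of the ratios of a partition function `f ∅ A` whose insertions factorize over pairs of
sets without edges between them. -/
theorem cluster_bound {ι : Type*} [DecidableEq ι] (G : SimpleGraph ι) {M : ℕ}
    (hM : 1 ≤ M) (hfin : ∀ i, (G.neighborSet i).Finite) (hdeg : ∀ i, (G.neighborSet i).ncard ≤ M)
    {δ : ℝ} (hδ0 : 0 ≤ δ) (hδ : δ ≤ 1 / (10 * M)) (f : Finset ι → Finset ι → ℂ)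
    (hrec : ∀ B A j, j ∉ A → j ∉ B → f B (insert j A) = f B A + f (insert j B) A)
    (hind : ∀ B A, Disjoint B A → (∀ b ∈ B, ∀ a ∈ A, ¬ G.Adj b a) →
      ‖f B A‖ ≤ δ ^ B.card * ‖f ∅ A‖) (A : Finset ι) :
    (∀ j ∈ A, ‖f ∅ A - f ∅ (A.erase j)‖ ≤ 3 * δ * ‖f ∅ (A.erase j)‖) ∧
    ∀ B, Disjoint B A →
      ‖f B A‖ ≤ δ ^ B.card * (1 + 1 / (M : ℝ)) ^ adjCount G B A * ‖f ∅ A‖ := by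
  have hM' : (1 : ℝ) ≤ M := by exact_mod_cast hM
  have hδM : δ * M ≤ 1 / 10 := by
    calc δ * M ≤ 1 / (10 * M) * M := by gcongr
      _ = 1 / 10 := by field_simp
  set α : ℝ := 1 + 1 / (M : ℝ) with hα
  have hα1 : 1 ≤ α := by rw [hα]; linarith [show (0 : ℝ) ≤ 1 / M by positivity]
  have hα3 : α ^ M ≤ 3 := one_add_inv_pow_le hM
  induction A using Finset.strongInduction with
  | H A ih =>
    -- The change is `f {j} (A.erase j)`. The induction hypothesis bounds it by `δ α ^ M`, with at
    -- most `M` neighbours of `j`, and `α ^ M ≤ 3`.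
    have h1 : ∀ j ∈ A, ‖f ∅ A - f ∅ (A.erase j)‖ ≤ 3 * δ * ‖f ∅ (A.erase j)‖ := by
      intro j hj
      have e := hrec ∅ (A.erase j) j (by simp) (by simp)
      rw [Finset.insert_erase hj] at e
      rw [e, add_sub_cancel_left]
      have := (ih _ (Finset.erase_ssubset hj)).2 (insert j ∅) (by simp)
      refine this.trans ?_
      have hc : adjCount G (insert j ∅) (A.erase j) ≤ M := by
        have := adjCount_le_add G ∅ (A.erase j) j (hdeg j) (hfin j)
        have h0 : adjCount G ∅ (A.erase j) = 0 := by simp [adjCount]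
        omega
      have : α ^ adjCount G (insert j ∅) (A.erase j) ≤ 3 :=
        (pow_le_pow_right₀ hα1 hc).trans hα3
      have hcard : (insert j (∅ : Finset ι)).card = 1 := by simp
      rw [hcard, pow_one, mul_comm 3 δ]
      gcongr
    refine ⟨h1, fun B hBA => ?_⟩
    by_cases hno : ∀ b ∈ B, ∀ a ∈ A, ¬ G.Adj b a
    · refine (hind B A hBA hno).trans ?_
      gcongr
      exact le_mul_of_one_le_right (by positivity) (one_le_pow₀ hα1)
    · push Not at hno
      obtain ⟨b, hb, j, hj, hbj⟩ := hno
      have hjB : j ∉ B := fun h => (Finset.disjoint_left.1 hBA h hj)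
      -- Remove an endpoint `j` of an edge between `A` and `B`. In the first term the count of
      -- adjacent vertices drops by one; in the second, `j` joins `B`, which gains a factor `δ` and
      -- raises the count by at most `M`.
      have e := hrec B (A.erase j) j (by simp) hjB
      rw [Finset.insert_erase hj] at e
      have hd : Disjoint B (A.erase j) := hBA.mono_right (Finset.erase_subset _ _)
      have hd' : Disjoint (insert j B) (A.erase j) := by
        rw [Finset.disjoint_insert_left]; exact ⟨by simp, hd⟩
      have i1 := (ih _ (Finset.erase_ssubset hj)).2 B hd
      have i2 := (ih _ (Finset.erase_ssubset hj)).2 (insert j B) hd'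
      set k := adjCount G B (A.erase j) with hk
      have hk1 : adjCount G B A = k + 1 := (adjCount_erase G B A hj hb hbj).symm
      have hk2 : adjCount G (insert j B) (A.erase j) ≤ k + M :=
        adjCount_le_add G B _ j (hdeg j) (hfin j)
      set Z := ‖f ∅ (A.erase j)‖ with hZ
      have hZ0 : 0 ≤ Z := norm_nonneg _
      have hZA : (1 - 3 * δ) * Z ≤ ‖f ∅ A‖ := by
        have h := h1 j hj
        have h2 : Z ≤ ‖f ∅ A‖ + ‖f ∅ A - f ∅ (A.erase j)‖ := by
          have := norm_sub_le (f ∅ A) (f ∅ A - f ∅ (A.erase j))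
          simpa using this
        linarith
      rw [Finset.card_insert_of_notMem hjB] at i2
      have i2' : ‖f (insert j B) (A.erase j)‖ ≤ δ ^ B.card * α ^ k * (3 * δ) * Z := by
        refine i2.trans (mul_le_mul_of_nonneg_right ?_ hZ0)
        calc δ ^ (B.card + 1) * α ^ adjCount G (insert j B) (A.erase j)
            ≤ δ ^ (B.card + 1) * α ^ (k + M) := by gcongr
          _ = δ ^ B.card * α ^ k * (δ * α ^ M) := by ring
          _ ≤ δ ^ B.card * α ^ k * (δ * 3) := by gcongr
          _ = _ := by ring
      rw [hk1, e]
      -- The factor `α` saved by the drop of the count pays for both terms and for the passage from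
      -- `f ∅ (A.erase j)` back to `f ∅ A`. The difference of the two sides is `(1 - 3 δ - 6 δ M) /
      -- M`, which is positive when `δ M ≤ 1 / 10`.
      have hkey : 1 + 3 * δ ≤ α * (1 - 3 * δ) := by
        have : α * M = M + 1 := by rw [hα]; field_simp
        nlinarith [show (0:ℝ) < 1 / M by positivity]
      calc ‖f B (A.erase j) + f (insert j B) (A.erase j)‖
          ≤ δ ^ B.card * α ^ k * Z + δ ^ B.card * α ^ k * (3 * δ) * Z :=
            (norm_add_le _ _).trans (add_le_add i1 i2')
        _ = δ ^ B.card * α ^ k * ((1 + 3 * δ) * Z) := by ring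
        _ ≤ δ ^ B.card * α ^ k * ((α * (1 - 3 * δ)) * Z) := by gcongr
        _ = δ ^ B.card * α ^ (k + 1) * ((1 - 3 * δ) * Z) := by ring
        _ ≤ _ := by gcongr

/-! ### The logarithm of the moment generating function of a sum -/

section LogMGF

variable {Ω ι : Type*} [MeasurableSpace Ω] {P : Measure Ω}
  {X : ι → Ω → ℝ} {A : ℝ}

lemma prod_norm_le_pow {κ : Type*} (s : Finset κ) (g : κ → ℂ) {c : ℝ}
    (h : ∀ i ∈ s, ‖g i‖ ≤ c) : ∏ i ∈ s, ‖g i‖ ≤ c ^ s.card := by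
  refine (Finset.prod_le_prod (fun i _ => norm_nonneg _) h).trans ?_
  rw [Finset.prod_const]

/-- `E[∏_{i ∈ B} (exp (z X_i) - 1) ∏_{i ∈ C} exp (z X_i)]`. -/
def partFun (P : Measure Ω) (X : ι → Ω → ℝ) (z : ℂ) (B C : Finset ι) : ℂ :=
  ∫ ω, (∏ i ∈ B, (Complex.exp (z * X i ω) - 1)) * ∏ i ∈ C, Complex.exp (z * X i ω) ∂P

lemma partFun_empty_eq_complexMGF (z : ℂ) (C : Finset ι) :
    partFun P X z ∅ C = complexMGF (fun ω => ∑ i ∈ C, X i ω) P z := by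
  simp only [partFun, complexMGF, Finset.prod_empty, one_mul]
  congr 1
  ext ω
  rw [← Complex.exp_sum]
  push_cast
  rw [Finset.mul_sum]

lemma norm_exp_mul_sub_one_le {z : ℂ} {x : ℝ} (hx : |x| ≤ A) (hz : ‖z‖ * A ≤ 1) :
    ‖Complex.exp (z * x) - 1‖ ≤ 2 * (‖z‖ * A) := by
  have h : ‖z * x‖ ≤ ‖z‖ * A := by
    rw [norm_mul, Complex.norm_real, Real.norm_eq_abs]; gcongr
  exact (Complex.norm_exp_sub_one_le (h.trans hz)).trans (by gcongr)

variable [IsProbabilityMeasure P]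

lemma integrable_partFun (hX : ∀ i, Measurable (X i)) (hb : ∀ i ω, |X i ω| ≤ A) {z : ℂ}
    (hz : ‖z‖ * A ≤ 1) (B C : Finset ι) :
    Integrable (fun ω => (∏ i ∈ B, (Complex.exp (z * X i ω) - 1)) *
      ∏ i ∈ C, Complex.exp (z * X i ω)) P := by
  refine Integrable.of_bound (C := (2 : ℝ) ^ B.card * 3 ^ C.card) ?_ (ae_of_all _ fun ω => ?_)
  · have : ∀ i, Measurable (X i) := hX
    fun_prop
  · rw [norm_mul, norm_prod, norm_prod]
    gcongr
    · refine prod_norm_le_pow _ _ fun i _ => ?_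
      exact (norm_exp_mul_sub_one_le (hb i ω) hz).trans (by linarith)
    · refine prod_norm_le_pow _ _ fun i _ => ?_
      have h := norm_exp_mul_sub_one_le (hb i ω) hz
      have := norm_add_le (Complex.exp (z * X i ω) - 1) 1
      simp only [sub_add_cancel, norm_one] at this
      linarith

/-- Writes the factor `exp (z X_j)` as `1 + (exp (z X_j) - 1)`; this is the recursion required by
`cluster_bound`. -/
lemma partFun_insert [DecidableEq ι] (hX : ∀ i, Measurable (X i)) (hb : ∀ i ω, |X i ω| ≤ A) {z : ℂ}
    (hz : ‖z‖ * A ≤ 1) (B C : Finset ι) (j : ι) (hjC : j ∉ C) (hjB : j ∉ B) :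
    partFun P X z B (insert j C) = partFun P X z B C + partFun P X z (insert j B) C := by
  rw [partFun, partFun, partFun, ← integral_add (integrable_partFun hX hb hz _ _)
    (integrable_partFun hX hb hz _ _)]
  congr 1
  ext ω
  rw [Finset.prod_insert hjC, Finset.prod_insert hjB]
  ring

/-- Without edges the two products are independent, so the expectation factorizes, and each factor
indexed by `B` is at most `2 ‖z‖ A`. -/
lemma norm_partFun_le_of_indep (hX : ∀ i, Measurable (X i)) (hb : ∀ i ω, |X i ω| ≤ A) {z : ℂ}
    (hz : ‖z‖ * A ≤ 1) {G : SimpleGraph ι} (hG : IsDependencyGraph X G P) (B C : Finset ι)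
    (hBC : Disjoint B C) (hno : ∀ b ∈ B, ∀ a ∈ C, ¬ G.Adj b a) :
    ‖partFun P X z B C‖ ≤ (2 * (‖z‖ * A)) ^ B.card * ‖partFun P X z ∅ C‖ := by
  have h := hG (B : Set ι) (C : Set ι) (by exact_mod_cast hBC) (by simpa using hno)
  have h2 := h.comp (φ := fun v : ↥(B : Set ι) → ℝ =>
      ∏ i : ↥(B : Set ι), (Complex.exp (z * v i) - 1))
    (ψ := fun v : ↥(C : Set ι) → ℝ => ∏ i : ↥(C : Set ι), Complex.exp (z * v i))
    (by fun_prop) (by fun_prop)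
  have e1 : ((fun v : ↥(B : Set ι) → ℝ => ∏ i : ↥(B : Set ι), (Complex.exp (z * v i) - 1)) ∘
      fun ω (a : (B : Set ι)) => X a ω) = fun ω => ∏ i ∈ B, (Complex.exp (z * X i ω) - 1) := by
    ext ω
    exact Finset.prod_coe_sort B fun i => (Complex.exp (z * X i ω) - 1)
  have e2 : ((fun v : ↥(C : Set ι) → ℝ => ∏ i : ↥(C : Set ι), Complex.exp (z * v i)) ∘
      fun ω (a : (C : Set ι)) => X a ω) = fun ω => ∏ i ∈ C, Complex.exp (z * X i ω) := by
    ext ω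
    exact Finset.prod_coe_sort C fun i => Complex.exp (z * X i ω)
  rw [e1, e2] at h2
  rw [partFun, h2.integral_fun_mul_eq_mul_integral
    (by have := hX; exact Measurable.aestronglyMeasurable (by fun_prop))
    (by have := hX; exact Measurable.aestronglyMeasurable (by fun_prop)), norm_mul]
  simp only [partFun, Finset.prod_empty, one_mul]
  gcongr
  refine (norm_integral_le_of_norm_le_const (C := (2 * (‖z‖ * A)) ^ B.card)
    (ae_of_all _ fun ω => ?_)).trans (by simp)
  rw [norm_prod]
  exact prod_norm_le_pow _ _ fun i _ => norm_exp_mul_sub_one_le (hb i ω) hz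

lemma interior_integrableExpSet_of_bounded {W : Ω → ℝ} (hW : AEMeasurable W P) {C : ℝ}
    (hC : ∀ ω, |W ω| ≤ C) : interior (integrableExpSet W P) = Set.univ := by
  have : integrableExpSet W P = Set.univ := by
    refine Set.eq_univ_of_forall fun t => ?_
    refine Integrable.of_bound (C := Real.exp (|t| * C)) (by fun_prop) (ae_of_all _ fun ω => ?_)
    rw [Real.norm_eq_abs, Real.abs_exp]
    refine Real.exp_le_exp.2 ?_
    calc t * W ω ≤ |t * W ω| := le_abs_self _
      _ ≤ |t| * C := by rw [abs_mul]; gcongr; exact hC ω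
  rw [this, interior_univ]

/-- For bounded variables with a dependency graph of degree at most `M`, the logarithm of the
moment generating function of the sum extends analytically to a disc of radius `1 / (20 M A)`,
with a bound of order `N / M`. -/
theorem exists_log_complexMGF [Fintype ι] {M : ℕ} (hM : 1 ≤ M) (hA : 0 < A)
    (hX : ∀ i, Measurable (X i)) (hb : ∀ i ω, |X i ω| ≤ A) {G : SimpleGraph ι}
    (hdeg : ∀ i, (G.neighborSet i).ncard ≤ M) (hG : IsDependencyGraph X G P) :
    ∃ ψ : ℂ → ℂ, DifferentiableOn ℂ ψ (Metric.ball 0 (1 / (20 * M * A))) ∧ ψ 0 = 0 ∧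
      ∀ z ∈ Metric.ball (0 : ℂ) (1 / (20 * M * A)), ‖ψ z‖ ≤ Fintype.card ι / M ∧
        complexMGF (fun ω => ∑ i, X i ω) P z = Complex.exp (ψ z) := by
  classical
  have hM' : (1 : ℝ) ≤ M := by exact_mod_cast hM
  have hsmall : ∀ z ∈ Metric.ball (0 : ℂ) (1 / (20 * M * A)),
      ‖z‖ * A ≤ 1 ∧ 2 * (‖z‖ * A) ≤ 1 / (10 * M) := by
    intro z hz
    rw [mem_ball_zero_iff] at hz
    have h1 : ‖z‖ * A ≤ 1 / (20 * M) := by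
      calc ‖z‖ * A ≤ 1 / (20 * M * A) * A := by gcongr
        _ = 1 / (20 * M) := by field_simp
    have h2 : (1 : ℝ) / (20 * M) ≤ 1 := by
      rw [div_le_one (by positivity)]; linarith
    refine ⟨h1.trans h2, ?_⟩
    calc 2 * (‖z‖ * A) ≤ 2 * (1 / (20 * M)) := by gcongr
      _ = 1 / (10 * M) := by field_simp; norm_num
  have hdiff : ∀ C : Finset ι, Differentiable ℂ (fun z => partFun P X z ∅ C) := by
    intro C
    have hm : Measurable (fun ω => ∑ i ∈ C, X i ω) := by have := hX; fun_prop
    have hbd : ∀ ω, |∑ i ∈ C, X i ω| ≤ C.card * A := fun ω => by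
      refine (Finset.abs_sum_le_sum_abs _ _).trans ?_
      refine (Finset.sum_le_sum fun i _ => hb i ω).trans ?_
      simp
    have h := differentiableOn_complexMGF (X := fun ω => ∑ i ∈ C, X i ω) (μ := P)
    rw [interior_integrableExpSet_of_bounded hm.aemeasurable hbd] at h
    simp only [Set.mem_univ, Set.ofPred_true, differentiableOn_univ] at h
    simpa only [partFun_empty_eq_complexMGF] using h
  have hzero : ∀ C : Finset ι, partFun P X 0 ∅ C = 1 := by
    intro C; simp [partFun]
  have hone : ∀ z, partFun P X z ∅ (∅ : Finset ι) = 1 := by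
    intro C; simp [partFun]
  have hratio : ∀ z ∈ Metric.ball (0 : ℂ) (1 / (20 * M * A)), ∀ (C : Finset ι) (j : ι), j ∉ C →
      ‖partFun P X z ∅ (insert j C) - partFun P X z ∅ C‖ ≤
        3 / (10 * M) * ‖partFun P X z ∅ C‖ := by
    intro z hz C j hj
    have h := (cluster_bound G hM (fun i => Set.toFinite _) hdeg (by positivity) (hsmall z hz).2
      (partFun P X z) (partFun_insert hX hb (hsmall z hz).1)
      (norm_partFun_le_of_indep hX hb (hsmall z hz).1 hG) (insert j C)).1 j (by simp)
    rw [Finset.erase_insert hj] at h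
    refine h.trans ?_
    gcongr
    calc 3 * (2 * (‖z‖ * A)) ≤ 3 * (1 / (10 * M)) := by gcongr; exact (hsmall z hz).2
      _ = _ := by ring
  have hq : (3 : ℝ) / (10 * M) ≤ 1 / 2 := by
    rw [div_le_div_iff₀ (by positivity) (by norm_num)]; linarith
  -- The variables are added one at a time. The logarithm gains `log (1 + w)`, where `w` is the
  -- relative change of the partition function; as `|w| ≤ 1 / 2`, the principal branch is analytic.
  have main : ∀ C : Finset ι, ∃ ψ : ℂ → ℂ,
      DifferentiableOn ℂ ψ (Metric.ball 0 (1 / (20 * M * A))) ∧ ψ 0 = 0 ∧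
      ∀ z ∈ Metric.ball (0 : ℂ) (1 / (20 * M * A)), ‖ψ z‖ ≤ C.card / M ∧
        partFun P X z ∅ C = Complex.exp (ψ z) := by
    intro C
    induction C using Finset.induction_on with
    | empty =>
      exact ⟨fun _ => 0, differentiableOn_const _, rfl, fun z _ => by simp [hone]⟩
    | insert j C hj ih =>
      obtain ⟨ψ, hψd, hψ0, hψ⟩ := ih
      have hne : ∀ z ∈ Metric.ball (0 : ℂ) (1 / (20 * M * A)), partFun P X z ∅ C ≠ 0 :=
        fun z hz => by rw [(hψ z hz).2]; exact Complex.exp_ne_zero _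
      set w : ℂ → ℂ := fun z =>
        (partFun P X z ∅ (insert j C) - partFun P X z ∅ C) / partFun P X z ∅ C with hw
      have hwb : ∀ z ∈ Metric.ball (0 : ℂ) (1 / (20 * M * A)), ‖w z‖ ≤ 3 / (10 * M) := by
        intro z hz
        rw [hw, norm_div, div_le_iff₀ (norm_pos_iff.2 (hne z hz))]
        exact hratio z hz C j hj
      refine ⟨fun z => ψ z + Complex.log (1 + w z), ?_, ?_, fun z hz => ⟨?_, ?_⟩⟩
      · refine hψd.add (DifferentiableOn.clog ?_ fun z hz => ?_)
        · refine (differentiableOn_const _).add (DifferentiableOn.div ?_ (hdiff _).differentiableOn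
            hne)
          exact ((hdiff _).sub (hdiff _)).differentiableOn
        · refine Complex.mem_slitPlane_of_norm_lt_one ?_
          exact ((hwb z hz).trans hq).trans_lt (by norm_num)
      · simp [hψ0, hw, hzero]
      · rw [Finset.card_insert_of_notMem hj]
        push_cast
        rw [add_div]
        refine (norm_add_le _ _).trans (add_le_add (hψ z hz).1 ?_)
        refine (Complex.norm_log_one_add_half_le_self ((hwb z hz).trans hq)).trans ?_
        -- On `|w| ≤ 1 / 2` one has `|log (1 + w)| ≤ (3 / 2) |w|`, so each variable contributes at
        -- most `1 / M`.
        calc 3 / 2 * ‖w z‖ ≤ 3 / 2 * (3 / (10 * M)) := by gcongr; exact hwb z hz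
          _ = 9 / 20 * (1 / M) := by field_simp; norm_num
          _ ≤ 1 * (1 / M) := by gcongr; norm_num
          _ = 1 / M := one_mul _
      · have h1w : 1 + w z ≠ 0 := by
          intro h0
          have : ‖w z‖ = 1 := by rw [show w z = -1 by linear_combination h0]; simp
          linarith [(hwb z hz).trans hq]
        rw [Complex.exp_add, Complex.exp_log h1w, ← (hψ z hz).2, hw]
        have := hne z hz
        field_simp
        ring
  obtain ⟨ψ, h1, h2, h3⟩ := main Finset.univ
  refine ⟨ψ, h1, h2, fun z hz => ⟨(h3 z hz).1, ?_⟩⟩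
  rw [← (h3 z hz).2, partFun_empty_eq_complexMGF]

end LogMGF

end NetCausal
end

noncomputable section

namespace NetCausal

/-! ### Polynomials dominated by their values at the real part -/

lemma coeff_top_nonpos_of_eval_nonpos (p : Polynomial ℝ) (hp : ∀ x : ℝ, 0 < x → p.eval x ≤ 0)
    {D : ℕ} (hD : p.natDegree ≤ D) (hD1 : 1 ≤ D) : p.coeff D ≤ 0 := by
  by_contra hc
  push Not at hc
  have hdeg : p.natDegree = D := le_antisymm hD (Polynomial.le_natDegree_of_ne_zero hc.ne')
  have hl : 0 ≤ p.leadingCoeff := by rw [Polynomial.leadingCoeff, hdeg]; exact hc.le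
  have ht := Polynomial.tendsto_atTop_of_leadingCoeff_nonneg p
    (Polynomial.natDegree_pos_iff_degree_pos.1 (by omega)) hl
  obtain ⟨x, hx1, hx2⟩ := ((ht.eventually_gt_atTop 0).and (eventually_gt_atTop 0)).exists
  exact absurd (hp x hx2) (not_le.2 hx1)

/-- A polynomial `q` with `Re q(z) ≤ Re q(Re z)` has degree at most two. -/
theorem coeff_eq_zero_of_re_le (c : ℕ → ℂ) (m : ℕ)
    (h : ∀ z : ℂ, (∑ r ∈ Finset.range m, c r * z ^ r).re ≤
      (∑ r ∈ Finset.range m, c r * (z.re : ℂ) ^ r).re) :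
    ∀ r, 3 ≤ r → r < m → c r = 0 := by
  by_contra hcon
  push Not at hcon
  obtain ⟨r0, hr0, hr0m, hcr0⟩ := hcon
  classical
  set s := (Finset.range m).filter (fun r => 3 ≤ r ∧ c r ≠ 0) with hs
  have hne : s.Nonempty := ⟨r0, by simp [hs, hr0, hr0m, hcr0]⟩
  set D := s.max' hne with hDdef
  have hDs : D ∈ s := s.max'_mem hne
  have hD : D < m ∧ 3 ≤ D ∧ c D ≠ 0 := by simpa [hs] using hDs
  have hbig : ∀ r ∈ Finset.range m, D < r → c r = 0 := by
    intro r hr hDr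
    by_contra hcr
    have : r ≤ D := s.le_max' r (by simp only [hs, Finset.mem_filter]; exact ⟨hr, by omega, hcr⟩)
    omega
  have hD0 : (0 : ℝ) < D := by exact_mod_cast (by omega : 0 < D)
  -- The direction that turns the leading term into `‖c D‖ x ^ D`. Along this ray the difference of
  -- the two real parts is the real polynomial `p`, whose leading coefficient will be positive.
  set θ : ℝ := (2 * Real.pi - (c D).arg) / D with hθ
  set p : Polynomial ℝ := ∑ r ∈ Finset.range m, Polynomial.monomial r
    ((c r * Complex.exp (θ * Complex.I) ^ r).re - (c r * (Real.cos θ : ℂ) ^ r).re) with hp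
  have hpe : ∀ x : ℝ, p.eval x ≤ 0 := by
    intro x
    have hz := h (x * Complex.exp (θ * Complex.I))
    have hre : ((x : ℂ) * Complex.exp (θ * Complex.I)).re = x * Real.cos θ := by
      rw [Complex.re_ofReal_mul, Complex.exp_ofReal_mul_I_re]
    rw [hre] at hz
    have : p.eval x = (∑ r ∈ Finset.range m, c r * ((x : ℂ) * Complex.exp (θ * Complex.I)) ^ r).re -
        (∑ r ∈ Finset.range m, c r * ((x * Real.cos θ : ℝ) : ℂ) ^ r).re := by
      rw [hp, Polynomial.eval_finsetSum, Complex.re_sum, Complex.re_sum, ← Finset.sum_sub_distrib]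
      refine Finset.sum_congr rfl fun r _ => ?_
      rw [Polynomial.eval_monomial]
      have e1 : c r * ((x : ℂ) * Complex.exp (θ * Complex.I)) ^ r =
          ((x ^ r : ℝ) : ℂ) * (c r * Complex.exp (θ * Complex.I) ^ r) := by
        push_cast; rw [mul_pow]; ring
      have e2 : c r * ((x * Real.cos θ : ℝ) : ℂ) ^ r =
          ((x ^ r : ℝ) : ℂ) * (c r * (Real.cos θ : ℂ) ^ r) := by
        push_cast; rw [mul_pow]; ring
      rw [e1, e2, Complex.re_ofReal_mul, Complex.re_ofReal_mul]
      ring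
    linarith
  have hdeg : p.natDegree ≤ D := by
    refine Polynomial.natDegree_sum_le_of_forall_le _ _ fun r hr => ?_
    by_cases hrD : r ≤ D
    · exact (Polynomial.natDegree_monomial_le _).trans hrD
    · rw [hbig r hr (by omega)]; simp
  have hcoef := coeff_top_nonpos_of_eval_nonpos p (fun x _ => hpe x) hdeg (by omega)
  have hcoef' : p.coeff D =
      (c D * Complex.exp (θ * Complex.I) ^ D).re - (c D * (Real.cos θ : ℂ) ^ D).re := by
    rw [hp, Polynomial.finsetSum_coeff]
    simp only [Polynomial.coeff_monomial]
    rw [Finset.sum_ite_eq' , if_pos (Finset.mem_range.2 hD.1)]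
  have hrot : c D * Complex.exp (θ * Complex.I) ^ D = (‖c D‖ : ℂ) := by
    rw [← Complex.exp_nat_mul]
    have : (D : ℂ) * (θ * Complex.I) = 2 * Real.pi * Complex.I - (c D).arg * Complex.I := by
      rw [hθ]; push_cast
      have : (D : ℂ) ≠ 0 := by exact_mod_cast hD0.ne'
      field_simp
    rw [this, Complex.exp_sub, Complex.exp_two_pi_mul_I]
    nth_rewrite 1 [← Complex.norm_mul_exp_arg_mul_I (c D)]
    have := Complex.exp_ne_zero ((c D).arg * Complex.I)
    field_simp
  have hpi := Complex.arg_le_pi (c D)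
  have hpi' := Complex.neg_pi_lt_arg (c D)
  have hθ0 : 0 < θ := by rw [hθ]; apply div_pos _ hD0; linarith [Real.pi_pos]
  -- Here degree at least three enters: the numerator of `θ` lies in `[π, 3 π)`, so the ray is not
  -- on the real axis and `|cos θ| < 1`.
  have hθπ : θ < Real.pi := by
    rw [hθ, div_lt_iff₀ hD0]
    have : (3 : ℝ) ≤ D := by exact_mod_cast hD.2.1
    nlinarith [Real.pi_pos]
  have hcos : |Real.cos θ| < 1 := by
    rw [← sq_lt_one_iff_abs_lt_one]
    have := Real.sin_pos_of_pos_of_lt_pi hθ0 hθπ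
    nlinarith [Real.sin_sq_add_cos_sq θ]
  have hcosD : |Real.cos θ| ^ D < 1 := pow_lt_one₀ (abs_nonneg _) hcos (by omega)
  have hre2 : (c D * (Real.cos θ : ℂ) ^ D).re ≤ ‖c D‖ * |Real.cos θ| ^ D := by
    refine (Complex.re_le_norm _).trans ?_
    rw [norm_mul, norm_pow, Complex.norm_real, Real.norm_eq_abs]
  have hpos : 0 < ‖c D‖ := norm_pos_iff.2 hD.2.2
  rw [hcoef', hrot, Complex.ofReal_re] at hcoef
  nlinarith

/-- The factor `ρ` is the larger of `1` and the maximum of `‖c r‖ ^ (1 / r)`. After rescaling `z` by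
it, all coefficients of order at least three are at most `1`, and one of them has modulus exactly
`1` unless no rescaling took place. -/
lemma exists_scale (c : ℕ → ℂ) (m : ℕ) :
    ∃ ρ : ℝ, 1 ≤ ρ ∧ (∀ r, 3 ≤ r → r < m → ‖c r‖ ≤ ρ ^ r) ∧
      (ρ = 1 ∨ ∃ r, 3 ≤ r ∧ r < m ∧ ‖c r‖ = ρ ^ r) := by
  classical
  set g : ℕ → ℝ := fun r => ‖c r‖ ^ ((1 : ℝ) / r) with hg
  have hgr : ∀ r, 3 ≤ r → g r ^ r = ‖c r‖ := by
    intro r hr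
    simp only [hg, one_div]
    exact Real.rpow_inv_natCast_pow (norm_nonneg _) (by omega)
  set s := Finset.Ico 3 m
  by_cases h : ∀ r ∈ s, g r ≤ 1
  · refine ⟨1, le_rfl, fun r h3 hm => ?_, Or.inl rfl⟩
    rw [← hgr r h3]
    gcongr
    exact h r (Finset.mem_Ico.2 ⟨h3, hm⟩)
  · push Not at h
    obtain ⟨r1, hr1, hr1'⟩ := h
    obtain ⟨r2, hr2, hmax⟩ := Finset.exists_max_image s g ⟨r1, hr1⟩
    have h2 := Finset.mem_Ico.1 hr2
    refine ⟨g r2, hr1'.le.trans (hmax r1 hr1), fun r h3 hm => ?_,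
      Or.inr ⟨r2, h2.1, h2.2, (hgr r2 h2.1).symm⟩⟩
    rw [← hgr r h3]
    gcongr
    exact hmax r (Finset.mem_Ico.2 ⟨h3, hm⟩)

/-- Sequences of polynomials of bounded degree that satisfy `Re q(z) ≤ Re q(Re z)` asymptotically
have asymptotically vanishing coefficients of order three and higher. -/
theorem tendsto_coeff_zero_of_re_le (c : ℕ → ℕ → ℂ) (m : ℕ) (h0 : ∀ᶠ n in atTop, c n 0 = 0)
    (h1 : ∀ᶠ n in atTop, c n 1 = 0) {b : ℝ} (h2 : ∀ᶠ n in atTop, ‖c n 2‖ ≤ b)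
    (h : ∀ B ε : ℝ, 0 < ε → ∀ᶠ n in atTop, ∀ z : ℂ, ‖z‖ ≤ B →
      (∑ r ∈ Finset.range m, c n r * z ^ r).re ≤
        (∑ r ∈ Finset.range m, c n r * (z.re : ℂ) ^ r).re + ε) :
    ∀ r, 3 ≤ r → r < m → Tendsto (fun n => c n r) atTop (𝓝 0) := by
  intro r0 hr0 hr0m
  by_contra hcon
  rw [Metric.tendsto_atTop] at hcon
  push Not at hcon
  obtain ⟨ε, hε, hfreq⟩ := hcon
  simp only [dist_zero_right] at hfreq
  have hfr : ∃ᶠ n in atTop, ε ≤ ‖c n r0‖ ∧ c n 0 = 0 ∧ c n 1 = 0 ∧ ‖c n 2‖ ≤ b := by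
    refine Frequently.and_eventually (frequently_atTop.2 hfreq) (h0.and (h1.and h2))
  obtain ⟨φ, hφ, hφε⟩ := extraction_of_frequently_atTop hfr
  -- The coefficients are not assumed bounded; the rescaling restores compactness without letting
  -- the high orders vanish.
  choose ρ hρ1 hρ2 hρ3 using fun k => exists_scale (c (φ k)) m
  have hρ0 : ∀ k, 0 < ρ k := fun k => zero_lt_one.trans_le (hρ1 k)
  set B : ℝ := max b 1
  let v : ℕ → Fin m → ℂ := fun k r => c (φ k) r / (ρ k : ℂ) ^ (r : ℕ)
  have hvb : ∀ k, v k ∈ Metric.closedBall (0 : Fin m → ℂ) B := by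
    intro k
    rw [mem_closedBall_zero_iff, pi_norm_le_iff_of_nonneg (by positivity)]
    intro r
    have hle : ∀ x, ‖c (φ k) r‖ ≤ x → x ≤ B * ρ k ^ (r : ℕ) → ‖v k r‖ ≤ B := by
      intro x hx hx2
      simp only [v, norm_div, norm_pow, Complex.norm_real, Real.norm_eq_abs, abs_of_pos (hρ0 k)]
      rw [div_le_iff₀ (pow_pos (hρ0 k) _)]
      exact hx.trans hx2
    have hB1 : 1 ≤ B := le_max_right _ _
    have hp : 1 ≤ ρ k ^ (r : ℕ) := one_le_pow₀ (hρ1 k)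
    obtain ⟨_, e0, e1, e2⟩ := hφε k
    rcases lt_or_ge (r : ℕ) 3 with h3 | h3
    · have : (r : ℕ) = 0 ∨ (r : ℕ) = 1 ∨ (r : ℕ) = 2 := by omega
      rcases this with h | h | h
      · exact hle 0 (by rw [h, e0, norm_zero]) (by positivity)
      · exact hle 0 (by rw [h, e1, norm_zero]) (by positivity)
      · refine hle B (by rw [h]; exact e2.trans (le_max_left _ _)) ?_
        nlinarith
    · refine hle (ρ k ^ (r : ℕ)) (hρ2 k r h3 r.2) ?_
      nlinarith
  obtain ⟨w, _, χ, hχ, hlim⟩ := tendsto_subseq_of_bounded Metric.isBounded_closedBall hvb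
  have hlim' : ∀ r : Fin m, Tendsto (fun k => v (χ k) r) atTop (𝓝 (w r)) := fun r =>
    (tendsto_pi_nhds.1 hlim) r
  let c' : ℕ → ℂ := fun r => if hr : r < m then w ⟨r, hr⟩ else 0
  have hc' : ∀ r, 3 ≤ r → r < m → c' r = 0 := by
    -- In the limit the error `ε` disappears, so the rescaled limit polynomial satisfies the exact
    -- inequality and has degree at most two.
    refine coeff_eq_zero_of_re_le c' m fun z => ?_
    have hsum : ∀ y : ℂ, Tendsto (fun k => (∑ r ∈ Finset.range m, c (φ (χ k)) r *
        (y / ρ (χ k)) ^ r).re) atTop (𝓝 (∑ r ∈ Finset.range m, c' r * y ^ r).re) := by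
      intro y
      refine (Complex.continuous_re.tendsto _).comp ?_
      refine tendsto_finsetSum _ fun r hr => ?_
      have hrm := Finset.mem_range.1 hr
      have := (hlim' ⟨r, hrm⟩).mul_const (y ^ r)
      simp only [c', dif_pos hrm]
      refine this.congr fun k => ?_
      simp only [v]
      rw [div_pow]
      ring
    have hz := hsum z
    have hzr := hsum (z.re : ℂ)
    refine le_of_forall_pos_le_add fun η hη => ?_
    refine le_of_tendsto_of_tendsto hz (hzr.add_const η) ?_
    have hev := (hφ.comp hχ).tendsto_atTop.eventually (h ‖z‖ η hη)
    filter_upwards [hev] with k hk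
    -- Since `ρ ≥ 1`, the rescaled point stays in the ball of radius `‖z‖`, where the asymptotic
    -- inequality is uniform.
    have hkz := hk (z / ρ (χ k)) (by
      rw [norm_div, Complex.norm_real, Real.norm_eq_abs, abs_of_pos (hρ0 _)]
      exact div_le_self (norm_nonneg _) (hρ1 _))
    have hre : (z / (ρ (χ k) : ℂ)).re = z.re / ρ (χ k) := Complex.div_ofReal_re _ _
    rw [hre] at hkz
    simpa using hkz
  have hsmall : ∀ᶠ k in atTop, ∀ r : Fin m, 3 ≤ (r : ℕ) → ‖v (χ k) r‖ < min ε 1 := by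
    rw [eventually_all]
    intro r
    by_cases h3 : 3 ≤ (r : ℕ)
    · have : w r = 0 := by simpa [c'] using hc' r h3 r.2
      have ht := (hlim' r).norm
      rw [this, norm_zero] at ht
      filter_upwards [ht.eventually_lt_const (lt_min hε one_pos)] with k hk _ using hk
    · exact Eventually.of_forall fun k hk => absurd hk h3
  obtain ⟨k, hk⟩ := hsmall.exists
  have hv : ∀ r : Fin m, ‖v (χ k) r‖ = ‖c (φ (χ k)) r‖ / ρ (χ k) ^ (r : ℕ) := by
    intro r
    simp only [v, norm_div, norm_pow, Complex.norm_real, Real.norm_eq_abs, abs_of_pos (hρ0 _)]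
  -- Either way a normalized coefficient of order at least three stays away from zero: the one of
  -- order `r0` by `ε` if `ρ = 1`, and otherwise the one of modulus `1`.
  rcases hρ3 (χ k) with hone | ⟨r, hr3, hrm, heq⟩
  · have h1 := hk ⟨r0, hr0m⟩ hr0
    rw [hv] at h1
    simp only [hone, one_pow, div_one] at h1
    exact absurd (h1.trans_le (min_le_left _ _)) (not_lt.2 (hφε (χ k)).1)
  · have h1 := hk ⟨r, hrm⟩ hr3
    rw [hv] at h1
    simp only [heq] at h1
    rw [div_self (pow_pos (hρ0 _) _).ne'] at h1
    exact absurd (h1.trans_le (min_le_right _ _)) (lt_irrefl _)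

end NetCausal
end

noncomputable section

namespace NetCausal

/-! ### Gaussian limits of analytic log moment generating functions -/

/-- Cauchy's estimates on the circle of radius `R / 2` bound the coefficients; for `‖z‖ ≤ R / 4` the
tail is dominated by a geometric series of ratio `1 / 2`. -/
lemma taylor_remainder_le {ψ : ℂ → ℂ} {R T : ℝ} (hR : 0 < R)
    (hd : DifferentiableOn ℂ ψ (Metric.ball 0 R)) (hT : ∀ z ∈ Metric.ball (0 : ℂ) R, ‖ψ z‖ ≤ T)
    (m : ℕ) {z : ℂ} (hz : ‖z‖ ≤ R / 4) :
    ‖ψ z - ∑ r ∈ Finset.range m, ((r.factorial : ℂ)⁻¹ * iteratedDeriv r ψ 0) * z ^ r‖ ≤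
      2 * (2 * ‖z‖) ^ m * (T / R ^ m) := by
  have hT0 : 0 ≤ T := (norm_nonneg _).trans (hT 0 (by simpa using hR))
  have hzb : z ∈ Metric.ball (0 : ℂ) R := by rw [mem_ball_zero_iff]; linarith
  have hsub : Metric.closedBall (0 : ℂ) (R / 2) ⊆ Metric.ball 0 R :=
    Metric.closedBall_subset_ball (by linarith)
  have hdc : DiffContOnCl ℂ ψ (Metric.ball 0 (R / 2)) := by
    refine DifferentiableOn.diffContOnCl (hd.mono ?_)
    rw [closure_ball _ (by positivity)]
    exact hsub
  have hcoef : ∀ r : ℕ, ‖(r.factorial : ℂ)⁻¹ * iteratedDeriv r ψ 0‖ ≤ T / (R / 2) ^ r := by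
    intro r
    have := Complex.norm_iteratedDeriv_le_of_forall_mem_sphere_norm_le r (by positivity) hdc
      (fun y hy => hT y (hsub (Metric.sphere_subset_closedBall hy)))
    rw [norm_mul, norm_inv, Complex.norm_natCast]
    have hf : (0 : ℝ) < r.factorial := by exact_mod_cast r.factorial_pos
    rw [inv_mul_le_iff₀ hf]
    refine this.trans (le_of_eq ?_)
    ring
  have hs := Complex.hasSum_taylorSeries_on_ball hd hzb
  have hs' : HasSum (fun r : ℕ => ((r.factorial : ℂ)⁻¹ * iteratedDeriv r ψ 0) * z ^ r) (ψ z) := by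
    refine hs.congr_fun fun r => ?_
    simp only [sub_zero, smul_eq_mul]
    ring
  have hs2 := (hasSum_nat_add_iff' m).2 hs'
  have hg : HasSum (fun i : ℕ => (2 * ‖z‖) ^ m * (T / R ^ m) * (1 / 2) ^ i)
      ((2 * ‖z‖) ^ m * (T / R ^ m) * 2) := hasSum_geometric_two.mul_left _
  refine (hs2.norm_le_of_bounded hg fun i => ?_).trans (le_of_eq (by ring))
  rw [norm_mul, norm_pow]
  calc _ ≤ T / (R / 2) ^ (i + m) * ‖z‖ ^ (i + m) := by gcongr; exact hcoef _
    _ = (2 * ‖z‖) ^ m * (T / R ^ m) * (2 * ‖z‖ / R) ^ i := by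
      rw [pow_add, pow_add, div_pow, div_pow, mul_pow, div_pow, mul_pow]
      field_simp
    _ ≤ _ := by
      have : 2 * ‖z‖ / R ≤ 1 / 2 := by
        rw [div_le_div_iff₀ hR (by norm_num)]
        linarith
      gcongr

/-- Analytic functions `ψ n` on discs of radius `R n → ∞`, of size at most `T n = o(R n ^ m)`,
that satisfy `Re ψ(z) ≤ Re ψ(Re z)` and are normalized at `0`, converge to `z ^ 2 / 2`. -/
theorem tendsto_sq_div_two_of_re_le {ψ : ℕ → ℂ → ℂ} {R T : ℕ → ℝ} {v : ℕ → ℂ} {m : ℕ}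
    (hR : Tendsto R atTop atTop) (hT : Tendsto (fun n => T n / R n ^ m) atTop (𝓝 0))
    (hd : ∀ᶠ n in atTop, DifferentiableOn ℂ (ψ n) (Metric.ball 0 (R n)))
    (hb : ∀ᶠ n in atTop, ∀ z ∈ Metric.ball (0 : ℂ) (R n), ‖ψ n z‖ ≤ T n)
    (hre : ∀ᶠ n in atTop, ∀ z ∈ Metric.ball (0 : ℂ) (R n), (ψ n z).re ≤ (ψ n z.re).re)
    (h0 : ∀ᶠ n in atTop, ψ n 0 = 0) (h1 : ∀ᶠ n in atTop, iteratedDeriv 1 (ψ n) 0 = 0)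
    (h2 : ∀ᶠ n in atTop, iteratedDeriv 2 (ψ n) 0 = v n) (hv : Tendsto v atTop (𝓝 1)) (z : ℂ) :
    Tendsto (fun n => ψ n z) atTop (𝓝 (z ^ 2 / 2)) := by
  -- Three further orders keep the quadratic coefficient inside the Taylor polynomial for every `m`;
  -- as `R → ∞`, the remainder bound only improves.
  set M := m + 3 with hM
  have hTM : Tendsto (fun n => T n / R n ^ M) atTop (𝓝 0) := by
    have : Tendsto (fun n => T n / R n ^ m * (R n ^ 3)⁻¹) atTop (𝓝 (0 * 0)) :=
      hT.mul (tendsto_inv_atTop_zero.comp ((tendsto_pow_atTop (by norm_num)).comp hR))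
    rw [mul_zero] at this
    refine this.congr fun n => ?_
    rw [hM, pow_add, div_mul_eq_div_div, div_eq_mul_inv (T n / R n ^ m)]
  set c : ℕ → ℕ → ℂ := fun n r => (r.factorial : ℂ)⁻¹ * iteratedDeriv r (ψ n) 0 with hc
  have hrem : ∀ B ε : ℝ, 0 < ε → ∀ᶠ n in atTop, ∀ z : ℂ, ‖z‖ ≤ B →
      ‖ψ n z - ∑ r ∈ Finset.range M, c n r * z ^ r‖ ≤ ε ∧ z ∈ Metric.ball (0 : ℂ) (R n) := by
    intro B ε hε
    have ht : Tendsto (fun n => 2 * (2 * B) ^ M * (T n / R n ^ M)) atTop (𝓝 0) := by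
      simpa using hTM.const_mul (2 * (2 * B) ^ M)
    filter_upwards [hd, hb, ht.eventually_lt_const hε, hR.eventually_gt_atTop (4 * B),
      hR.eventually_gt_atTop 0] with n hdn hbn htn hRn hR0 z hz
    have hT0 : 0 ≤ T n := (norm_nonneg _).trans (hbn 0 (by simpa using hR0))
    refine ⟨(taylor_remainder_le hR0 hdn hbn M (by linarith)).trans (le_trans ?_ htn.le), ?_⟩
    · gcongr
    · rw [mem_ball_zero_iff]
      have := norm_nonneg z
      linarith
  have hc2 : Tendsto (fun n => c n 2) atTop (𝓝 (1 / 2)) := by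
    have : Tendsto (fun n => ((2 : ℕ).factorial : ℂ)⁻¹ * v n) atTop (𝓝 (1 / 2)) := by
      simpa using hv.const_mul ((2 : ℕ).factorial : ℂ)⁻¹
    refine this.congr' ?_
    filter_upwards [h2] with n hn
    rw [hc, ← hn]
  have hc0 : ∀ᶠ n in atTop, c n 0 = 0 := by
    filter_upwards [h0] with n hn
    simp [hc, hn]
  have hc1 : ∀ᶠ n in atTop, c n 1 = 0 := by
    filter_upwards [h1] with n hn
    simp only [hc, hn, mul_zero]
  have hc2b : ∀ᶠ n in atTop, ‖c n 2‖ ≤ 1 := by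
    have := hc2.norm.eventually_lt_const (u := 1) (by norm_num)
    exact this.mono fun n hn => hn.le
  have hcr := tendsto_coeff_zero_of_re_le c M hc0 hc1 hc2b (by
    intro B ε hε
    filter_upwards [hrem B (ε / 2) (by positivity), hre] with n hn hren z hz
    obtain ⟨hz1, hz2⟩ := hn z hz
    have hzr : ‖(z.re : ℂ)‖ ≤ B := by
      rw [Complex.norm_real, Real.norm_eq_abs]
      exact (Complex.abs_re_le_norm z).trans hz
    obtain ⟨hr1, _⟩ := hn z.re hzr
    have a1 := (Complex.abs_re_le_norm _).trans hz1
    have a2 := (Complex.abs_re_le_norm _).trans hr1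
    rw [Complex.sub_re, abs_le] at a1 a2
    have := hren z hz2
    linarith [a1.1, a2.2])
  have hpoly : Tendsto (fun n => ∑ r ∈ Finset.range M, c n r * z ^ r) atTop (𝓝 (z ^ 2 / 2)) := by
    have : z ^ 2 / 2 = ∑ r ∈ Finset.range M, (if r = 2 then (1 / 2 : ℂ) else 0) * z ^ r := by
      simp only [ite_mul, zero_mul]
      rw [Finset.sum_ite_eq', if_pos (Finset.mem_range.2 (by omega))]
      ring
    rw [this]
    refine tendsto_finsetSum _ fun r hr => Tendsto.mul_const _ ?_
    split_ifs with h
    · rw [h]; exact hc2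
    · have hrM := Finset.mem_range.1 hr
      rcases lt_or_ge r 3 with h3 | h3
      · have : r = 0 ∨ r = 1 := by omega
        rcases this with rfl | rfl
        · exact tendsto_const_nhds.congr' (hc0.mono fun n hn => hn.symm)
        · exact tendsto_const_nhds.congr' (hc1.mono fun n hn => hn.symm)
      · exact hcr r h3 hrM
  have hdiff : Tendsto (fun n => ψ n z - ∑ r ∈ Finset.range M, c n r * z ^ r) atTop (𝓝 0) := by
    rw [Metric.tendsto_nhds]
    intro ε hε
    filter_upwards [hrem ‖z‖ (ε / 2) (by positivity)] with n hn
    rw [dist_zero_right]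
    exact (hn z le_rfl).1.trans_lt (by linarith)
  simpa using hdiff.add hpoly

/-! ### Central limit theorem for bounded arrays with dependency graphs -/

/-- Differentiating `exp ∘ ψ` twice at `0`, where `ψ` vanishes, identifies the first two cumulants
with the mean and the second moment. -/
lemma iteratedDeriv_log_complexMGF {Ω : Type*} [MeasurableSpace Ω] {P : Measure Ω}
    [IsProbabilityMeasure P] {W : Ω → ℝ} (hW : AEMeasurable W P) {C : ℝ} (hC : ∀ ω, |W ω| ≤ C)
    (hmean : ∫ ω, W ω ∂P = 0) {ψ : ℂ → ℂ} {R : ℝ} (hR : 0 < R)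
    (hd : DifferentiableOn ℂ ψ (Metric.ball 0 R)) (hψ0 : ψ 0 = 0)
    (hψ : ∀ z ∈ Metric.ball (0 : ℂ) R, complexMGF W P z = Complex.exp (ψ z)) :
    iteratedDeriv 1 ψ 0 = 0 ∧ iteratedDeriv 2 ψ 0 = ((∫ ω, W ω ^ 2 ∂P : ℝ) : ℂ) := by
  have hint := interior_integrableExpSet_of_bounded hW hC
  have hmem : ∀ z : ℂ, z.re ∈ interior (integrableExpSet W P) := fun z => by rw [hint]; trivial
  have hZ1 : iteratedDeriv 1 (complexMGF W P) 0 = 0 := by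
    rw [iteratedDeriv_complexMGF (hmem 0)]
    simp only [pow_one, zero_mul, Complex.exp_zero, mul_one]
    rw [integral_complex_ofReal, hmean, Complex.ofReal_zero]
  have hZ2 : iteratedDeriv 2 (complexMGF W P) 0 = ((∫ ω, W ω ^ 2 ∂P : ℝ) : ℂ) := by
    rw [iteratedDeriv_complexMGF (hmem 0)]
    simp only [zero_mul, Complex.exp_zero, mul_one]
    rw [← integral_complex_ofReal]
    simp
  have hball : Metric.ball (0 : ℂ) R ∈ 𝓝 0 := Metric.ball_mem_nhds _ hR
  have hda : ∀ z ∈ Metric.ball (0 : ℂ) R, HasDerivAt ψ (deriv ψ z) z := fun z hz =>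
    ((hd z hz).differentiableAt (Metric.isOpen_ball.mem_nhds hz)).hasDerivAt
  have hd1 : ∀ z ∈ Metric.ball (0 : ℂ) R,
      deriv (complexMGF W P) z = Complex.exp (ψ z) * deriv ψ z := by
    intro z hz
    have e : complexMGF W P =ᶠ[𝓝 z] fun y => Complex.exp (ψ y) := by
      filter_upwards [Metric.isOpen_ball.mem_nhds hz] with y hy using hψ y hy
    rw [e.deriv_eq]
    exact (hda z hz).cexp.deriv
  have h0 : (0 : ℂ) ∈ Metric.ball (0 : ℂ) R := by simpa using hR
  have hψ1 : deriv ψ 0 = 0 := by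
    have := hd1 0 h0
    rw [← iteratedDeriv_one, hZ1, hψ0] at this
    simpa using this.symm
  have hdd : HasDerivAt (deriv ψ) (deriv (deriv ψ) 0) 0 :=
    (((hd.deriv Metric.isOpen_ball) 0 h0).differentiableAt hball).hasDerivAt
  refine ⟨by rw [iteratedDeriv_one]; exact hψ1, ?_⟩
  have e2 : deriv (complexMGF W P) =ᶠ[𝓝 0] fun y => Complex.exp (ψ y) * deriv ψ y := by
    filter_upwards [hball] with y hy using hd1 y hy
  have h3 := e2.deriv_eq.trans ((hda 0 h0).cexp.mul hdd).deriv
  rw [hψ0, hψ1] at h3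
  rw [← hZ2, iteratedDeriv_succ, iteratedDeriv_one, iteratedDeriv_succ, iteratedDeriv_one, h3]
  simp

/-- Asymptotic normality of sums of bounded centred variables with dependency graphs. -/
theorem tendsto_charFun_of_bounded {Ω : ℕ → Type*} [∀ n, MeasurableSpace (Ω n)]
    (P : ∀ n, Measure (Ω n)) [∀ n, IsProbabilityMeasure (P n)]
    (X : ∀ n, Fin n → Ω n → ℝ) (hX : ∀ n i, Measurable (X n i)) (A : ℕ → ℝ) (M : ℕ → ℕ)
    (G : ∀ n, SimpleGraph (Fin n)) (hM : ∀ n, 1 ≤ M n)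
    (hdeg : ∀ n i, ((G n).neighborSet i).ncard ≤ M n)
    (hG : ∀ n, IsDependencyGraph (X n) (G n) (P n)) (hmean : ∀ n i, ∫ ω, X n i ω ∂P n = 0)
    (hA : ∀ᶠ n in atTop, 0 < A n ∧ ∀ i ω, |X n i ω| ≤ A n)
    (hMA : Tendsto (fun n => M n * A n) atTop (𝓝 0)) (m : ℕ)
    (hNM : Tendsto (fun n : ℕ => n / M n * (M n * A n) ^ m) atTop (𝓝 0))
    (hvar : Tendsto (fun n => ∫ ω, (∑ i, X n i ω) ^ 2 ∂P n) atTop (𝓝 1)) (t : ℝ) :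
    Tendsto (fun n => charFun ((P n).map (fun ω => ∑ i, X n i ω)) t) atTop
      (𝓝 (Complex.exp (-t ^ 2 / 2))) := by
  classical
  have hM0 : ∀ n, (0 : ℝ) < M n := fun n => by exact_mod_cast hM n
  set R : ℕ → ℝ := fun n => 1 / (20 * M n * A n) with hRdef
  have hR : Tendsto R atTop atTop := by
    have : Tendsto (fun n => 20 * (M n * A n)) atTop (𝓝[>] 0) := by
      refine tendsto_nhdsWithin_iff.2 ⟨by simpa using hMA.const_mul 20, ?_⟩
      filter_upwards [hA] with n hn
      have := hM0 n
      have := hn.1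
      simp only [Set.mem_Ioi]; positivity
    refine (tendsto_inv_nhdsGT_zero.comp this).congr fun n => ?_
    simp only [Function.comp, hRdef, one_div, mul_assoc]
  -- The bound `A n` holds only eventually; where it fails the claim is vacuous and `ψ` is taken to
  -- be zero, so that one sequence is defined for all `n`.
  have hex : ∀ n, ∃ ψ : ℂ → ℂ, (0 < A n ∧ ∀ i ω, |X n i ω| ≤ A n) →
      (DifferentiableOn ℂ ψ (Metric.ball 0 (R n)) ∧ ψ 0 = 0 ∧
      ∀ z ∈ Metric.ball (0 : ℂ) (R n), ‖ψ z‖ ≤ Fintype.card (Fin n) / M n ∧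
        complexMGF (fun ω => ∑ i, X n i ω) (P n) z = Complex.exp (ψ z)) := by
    intro n
    by_cases h : 0 < A n ∧ ∀ i ω, |X n i ω| ≤ A n
    · obtain ⟨ψ, hψ⟩ := exists_log_complexMGF (hM n) h.1 (hX n) h.2 (hdeg n) (hG n)
      exact ⟨ψ, fun _ => hψ⟩
    · exact ⟨0, fun h' => absurd h' h⟩
  choose ψ hψ using hex
  have hmeas : ∀ n, Measurable (fun ω => ∑ i, X n i ω) := fun n => by
    have := hX n; fun_prop
  have hbd : ∀ n, (∀ i ω, |X n i ω| ≤ A n) → ∀ ω, |∑ i, X n i ω| ≤ n * A n := by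
    intro n h ω
    refine (Finset.abs_sum_le_sum_abs _ _).trans ((Finset.sum_le_sum fun i _ => h i ω).trans ?_)
    simp
  have hsum0 : ∀ n, (∀ i ω, |X n i ω| ≤ A n) → ∫ ω, ∑ i, X n i ω ∂P n = 0 := by
    intro n h
    rw [integral_finsetSum _ fun i _ => Integrable.of_bound (C := A n)
      (hX n i).aestronglyMeasurable (ae_of_all _ (h i))]
    simp [hmean]
  have hRpos : ∀ n, 0 < A n → 0 < R n := fun n h => by
    have := hM0 n; simp only [hRdef]; positivity
  have hlim : Tendsto (fun n => ψ n (t * Complex.I)) atTop (𝓝 ((t * Complex.I) ^ 2 / 2)) := by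
    refine tendsto_sq_div_two_of_re_le (T := fun n => n / M n)
      (v := fun n => ((∫ ω, (∑ i, X n i ω) ^ 2 ∂P n : ℝ) : ℂ)) (m := m) hR ?_ ?_ ?_ ?_ ?_ ?_ ?_
      ?_ _
    -- With `T = n / M` and `R = 1 / (20 M A)`, the quotient `T / R ^ m` is `20 ^ m` times the
    -- quantity in the rate condition.
    · have := hNM.mul_const (20 ^ m)
      rw [zero_mul] at this
      refine this.congr fun n => ?_
      simp only [hRdef]
      rw [div_pow, one_pow, div_div_eq_mul_div, div_one, mul_assoc, ← mul_pow]
      congr 2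
      ring
    · filter_upwards [hA] with n hn using (hψ n hn).1
    · filter_upwards [hA] with n hn z hz
      simpa using ((hψ n hn).2.2 z hz).1
    · filter_upwards [hA] with n hn z hz
      have hz' : (z.re : ℂ) ∈ Metric.ball (0 : ℂ) (R n) := by
        rw [mem_ball_zero_iff] at hz ⊢
        rw [Complex.norm_real, Real.norm_eq_abs]
        exact (Complex.abs_re_le_norm z).trans_lt hz
      -- The ridge property `|E exp (z W)| ≤ E exp (Re z · W)`; taking logarithms gives `Re ψ(z) ≤
      -- Re ψ(Re z)`.
      have h := norm_complexMGF_le_mgf (X := fun ω => ∑ i, X n i ω) (μ := P n) (z := z)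
      have e : mgf (fun ω => ∑ i, X n i ω) (P n) z.re =
          ‖complexMGF (fun ω => ∑ i, X n i ω) (P n) (z.re : ℂ)‖ := by
        rw [complexMGF_ofReal, Complex.norm_real, Real.norm_eq_abs, abs_of_nonneg mgf_nonneg]
      rw [e, ((hψ n hn).2.2 z hz).2, ((hψ n hn).2.2 _ hz').2, Complex.norm_exp,
        Complex.norm_exp] at h
      exact Real.exp_le_exp.1 h
    · filter_upwards [hA] with n hn using (hψ n hn).2.1
    · filter_upwards [hA] with n hn
      exact (iteratedDeriv_log_complexMGF (hmeas n).aemeasurable (hbd n hn.2) (hsum0 n hn.2)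
        (hRpos n hn.1) (hψ n hn).1 (hψ n hn).2.1 fun z hz => ((hψ n hn).2.2 z hz).2).1
    · filter_upwards [hA] with n hn
      exact (iteratedDeriv_log_complexMGF (hmeas n).aemeasurable (hbd n hn.2) (hsum0 n hn.2)
        (hRpos n hn.1) (hψ n hn).1 (hψ n hn).2.1 fun z hz => ((hψ n hn).2.2 z hz).2).2
    · exact_mod_cast (Complex.continuous_ofReal.tendsto 1).comp hvar
  have hexp := (Complex.continuous_exp.tendsto _).comp hlim
  have e : ((t : ℂ) * Complex.I) ^ 2 / 2 = -t ^ 2 / 2 := by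
    rw [mul_pow, Complex.I_sq]; ring
  rw [e] at hexp
  refine hexp.congr' ?_
  filter_upwards [hA, hR.eventually_gt_atTop |t|] with n hn hRt
  have hz : (t : ℂ) * Complex.I ∈ Metric.ball (0 : ℂ) (R n) := by
    rw [mem_ball_zero_iff, norm_mul, Complex.norm_I, mul_one, Complex.norm_real, Real.norm_eq_abs]
    exact hRt
  rw [← complexMGF_mul_I (hmeas n).aemeasurable, ((hψ n hn).2.2 _ hz).2]
  rfl

end NetCausal
end

noncomputable section

namespace NetCausal

/-! ### Stochastic order symbols -/

section StochasticOrder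

variable {Ω : ℕ → Type*} [∀ n, MeasurableSpace (Ω n)] {P : ∀ n, Measure (Ω n)}
  {X Y : ∀ n, Ω n → ℝ}

/-- `X_n = O_p(1)`. -/
def IsBigOpOne {Ω : ℕ → Type*} [∀ n, MeasurableSpace (Ω n)] (P : ∀ n, Measure (Ω n))
    (X : ∀ n, Ω n → ℝ) : Prop :=
  ∀ η : ENNReal, 0 < η → ∃ C : ℝ, 0 < C ∧ ∀ᶠ n in atTop, P n {ω | C ≤ |X n ω|} ≤ η

/-- The form in which pointwise continuity arguments are transferred to stochastic order symbols:
only an almost sure implication between smallness events is needed, eventually in `n`. -/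
lemma IsOpOne.of_imp (hX : IsOpOne P X)
    (h : ∀ ε : ℝ, 0 < ε → ∃ δ : ℝ, 0 < δ ∧ ∀ᶠ n in atTop, ∀ᵐ ω ∂P n, |X n ω| < δ → |Y n ω| < ε) :
    IsOpOne P Y := by
  intro ε hε
  obtain ⟨δ, hδ, hev⟩ := h ε hε
  refine tendsto_of_tendsto_of_tendsto_of_le_of_le' tendsto_const_nhds (hX δ hδ)
    (Eventually.of_forall fun n => zero_le) ?_
  filter_upwards [hev] with n hn
  refine measure_mono_ae ?_
  filter_upwards [hn] with ω hω h1
  change ε ≤ |Y n ω| at h1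
  change δ ≤ |X n ω|
  by_contra h2
  exact absurd (hω (not_le.1 h2)) (not_lt.2 h1)

lemma IsOpOne.of_abs_le_mul (hX : IsOpOne P X) (C : ℝ)
    (h : ∀ᶠ n in atTop, ∀ᵐ ω ∂P n, |Y n ω| ≤ C * |X n ω|) : IsOpOne P Y := by
  refine hX.of_imp fun ε hε => ⟨ε / (|C| + 1), by positivity, ?_⟩
  filter_upwards [h] with n hn
  filter_upwards [hn] with ω hω h1
  rw [lt_div_iff₀ (by positivity)] at h1
  have := le_abs_self C
  nlinarith [abs_nonneg (X n ω)]

lemma IsOpOne.add (hX : IsOpOne P X) (hY : IsOpOne P Y) :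
    IsOpOne P (fun n ω => X n ω + Y n ω) := by
  intro ε hε
  have h := (hX (ε / 2) (by positivity)).add (hY (ε / 2) (by positivity))
  rw [add_zero] at h
  refine tendsto_of_tendsto_of_tendsto_of_le_of_le tendsto_const_nhds h
    (fun n => zero_le) fun n => (measure_mono ?_).trans (measure_union_le _ _)
  intro ω hω
  change ε ≤ |X n ω + Y n ω| at hω
  change ε / 2 ≤ |X n ω| ∨ ε / 2 ≤ |Y n ω|
  by_contra hcon
  push Not at hcon
  linarith [abs_add_le (X n ω) (Y n ω)]

lemma IsOpOne.sub (hX : IsOpOne P X) (hY : IsOpOne P Y) :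
    IsOpOne P (fun n ω => X n ω - Y n ω) := by
  have hY' : IsOpOne P (fun n ω => -Y n ω) :=
    hY.of_abs_le_mul 1 (Eventually.of_forall fun n => ae_of_all _ fun ω => by simp)
  simpa only [sub_eq_add_neg] using hX.add hY'

lemma measure_le_ofReal_integral_div {Ω : Type*} [MeasurableSpace Ω] {P : Measure Ω}
    {f : Ω → ℝ} (hf : Integrable f P) {ε : ℝ} (hε : 0 < ε) :
    P {ω | ε ≤ |f ω|} ≤ ENNReal.ofReal ((∫ ω, |f ω| ∂P) / ε) := by
  have h := meas_ge_le_lintegral_div (μ := P) (f := fun ω => ENNReal.ofReal |f ω|)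
    hf.abs.aemeasurable.ennreal_ofReal (ε := ENNReal.ofReal ε) (by simpa using hε) (by simp)
  rw [← ofReal_integral_eq_lintegral_ofReal hf.abs (ae_of_all _ fun ω => abs_nonneg _),
    ← ENNReal.ofReal_div_of_pos hε] at h
  refine le_trans (measure_mono fun ω hω => ?_) h
  exact ENNReal.ofReal_le_ofReal hω

lemma isOpOne_of_integral_abs_le {b : ℕ → ℝ} (hint : ∀ᶠ n in atTop, Integrable (X n) (P n))
    (hle : ∀ᶠ n in atTop, ∫ ω, |X n ω| ∂P n ≤ b n) (hb : Tendsto b atTop (𝓝 0)) :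
    IsOpOne P X := by
  intro ε hε
  have ht : Tendsto (fun n => ENNReal.ofReal (b n / ε)) atTop (𝓝 0) := by
    have := ENNReal.tendsto_ofReal (hb.div_const ε)
    simpa using this
  refine tendsto_of_tendsto_of_tendsto_of_le_of_le' tendsto_const_nhds ht
    (Eventually.of_forall fun n => zero_le) ?_
  filter_upwards [hint, hle] with n h1 h2
  refine (measure_le_ofReal_integral_div h1 hε).trans (ENNReal.ofReal_le_ofReal ?_)
  gcongr

lemma isBigOpOne_of_integral_abs_le {B : ℝ} (hint : ∀ᶠ n in atTop, Integrable (X n) (P n))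
    (hle : ∀ᶠ n in atTop, ∫ ω, |X n ω| ∂P n ≤ B) : IsBigOpOne P X := by
  intro η hη
  have ht : Tendsto (fun C : ℝ => ENNReal.ofReal (B / C)) atTop (𝓝 0) := by
    have := ENNReal.tendsto_ofReal (tendsto_const_nhds.div_atTop (f := fun _ : ℝ => B) tendsto_id)
    simpa using this
  obtain ⟨C, hC1, hC2⟩ :=
    (((ENNReal.tendsto_nhds_zero.1 ht) η hη).and (eventually_gt_atTop (0 : ℝ))).exists
  refine ⟨C, hC2, ?_⟩
  filter_upwards [hint, hle] with n h1 h2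
  refine (measure_le_ofReal_integral_div h1 hC2).trans (le_trans (ENNReal.ofReal_le_ofReal ?_) hC1)
  gcongr

lemma IsOpOne.isBigOpOne (hX : IsOpOne P X) : IsBigOpOne P X := fun η hη =>
  ⟨1, one_pos, (ENNReal.tendsto_nhds_zero.1 (hX 1 one_pos)) η hη⟩

lemma IsBigOpOne.add (hX : IsBigOpOne P X) (hY : IsBigOpOne P Y) :
    IsBigOpOne P (fun n ω => X n ω + Y n ω) := by
  intro η hη
  have hη2 : 0 < η / 2 := ENNReal.half_pos hη.ne'
  obtain ⟨C, hC, h1⟩ := hX _ hη2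
  obtain ⟨D, hD, h2⟩ := hY _ hη2
  refine ⟨C + D, by positivity, ?_⟩
  filter_upwards [h1, h2] with n h1 h2
  refine le_trans ((measure_mono ?_).trans (measure_union_le {ω | C ≤ |X n ω|} {ω | D ≤ |Y n ω|}))
    ((add_le_add h1 h2).trans (ENNReal.add_halves η).le)
  intro ω hω
  change C + D ≤ |X n ω + Y n ω| at hω
  change C ≤ |X n ω| ∨ D ≤ |Y n ω|
  by_contra hcon
  push Not at hcon
  linarith [abs_add_le (X n ω) (Y n ω)]

lemma IsOpOne.mul_isBigOpOne (hX : IsOpOne P X) (hY : IsBigOpOne P Y) :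
    IsOpOne P (fun n ω => X n ω * Y n ω) := by
  intro ε hε
  rw [ENNReal.tendsto_nhds_zero]
  intro η hη
  have hη2 : 0 < η / 2 := ENNReal.half_pos hη.ne'
  obtain ⟨C, hC, h1⟩ := hY _ hη2
  filter_upwards [h1, (ENNReal.tendsto_nhds_zero.1 (hX (ε / C) (by positivity))) _ hη2]
    with n h1 h2
  refine le_trans ((measure_mono ?_).trans
    (measure_union_le {ω | ε / C ≤ |X n ω|} {ω | C ≤ |Y n ω|}))
    ((add_le_add h2 h1).trans (ENNReal.add_halves η).le)
  intro ω hω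
  change ε ≤ |X n ω * Y n ω| at hω
  change ε / C ≤ |X n ω| ∨ C ≤ |Y n ω|
  by_contra hcon
  push Not at hcon
  obtain ⟨ha, hb⟩ := hcon
  rw [lt_div_iff₀ hC] at ha
  rw [abs_mul] at hω
  nlinarith [abs_nonneg (X n ω), abs_nonneg (Y n ω)]

lemma IsOpOne.sqrt (hX : IsOpOne P X) : IsOpOne P (fun n ω => √(X n ω)) := by
  refine hX.of_imp fun ε hε => ⟨ε ^ 2, by positivity, Eventually.of_forall fun n =>
    ae_of_all _ fun ω hω => ?_⟩
  rw [abs_of_nonneg (Real.sqrt_nonneg _), Real.sqrt_lt' hε]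
  exact (le_abs_self _).trans_lt hω

/-- Bounded convergence: off the event `ε ≤ |X|` the integrand is below `ε`, and on it at most `C`.
It turns consistency of the propensity score into convergence of its mean squared error. -/
lemma IsOpOne.tendsto_integral_abs [∀ n, IsProbabilityMeasure (P n)] (hX : IsOpOne P X) {C : ℝ}
    (hm : ∀ n, AEMeasurable (X n) (P n)) (hC : ∀ n, ∀ᵐ ω ∂P n, |X n ω| ≤ C) :
    Tendsto (fun n => ∫ ω, |X n ω| ∂P n) atTop (𝓝 0) := by
  have hle : ∀ ε : ℝ, 0 < ε → ∀ n, ∫ ω, |X n ω| ∂P n ≤ ε + C * (P n).real {ω | ε ≤ |X n ω|} := by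
    intro ε hε n
    have hms : NullMeasurableSet {ω | ε ≤ |X n ω|} (P n) :=
      nullMeasurableSet_le aemeasurable_const (by have := hm n; fun_prop)
    have hi : Integrable ({ω | ε ≤ |X n ω|}.indicator fun _ => C) (P n) :=
      (integrable_const C).indicator₀ hms
    calc ∫ ω, |X n ω| ∂P n ≤ ∫ ω, (ε + {ω | ε ≤ |X n ω|}.indicator (fun _ => C) ω) ∂P n := by
          refine integral_mono_ae ?_ ((integrable_const ε).add hi) ?_
          · refine Integrable.of_bound (C := C) ?_ ?_
            · have := hm n; exact (by fun_prop : AEMeasurable _ _).aestronglyMeasurable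
            · filter_upwards [hC n] with ω hω
              simpa using hω
          · filter_upwards [hC n] with ω hω
            by_cases h : ε ≤ |X n ω|
            · simp only [Set.indicator_of_mem (show ω ∈ {ω | ε ≤ |X n ω|} from h)]
              linarith
            · simp only [Set.indicator_of_notMem (show ω ∉ {ω | ε ≤ |X n ω|} from h)]
              linarith
      _ = ε + C * (P n).real {ω | ε ≤ |X n ω|} := by
          rw [integral_add (integrable_const ε) hi, integral_indicator₀ hms, setIntegral_const]
          simp [mul_comm]
  refine tendsto_order.2 ⟨fun a ha => Eventually.of_forall fun n =>
    ha.trans_le (integral_nonneg fun ω => abs_nonneg _), fun a ha => ?_⟩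
  have ht : Tendsto (fun n => a / 2 + C * (P n).real {ω | a / 2 ≤ |X n ω|}) atTop
      (𝓝 (a / 2 + C * 0)) := by
    refine tendsto_const_nhds.add (Tendsto.const_mul _ ?_)
    have := (ENNReal.tendsto_toReal ENNReal.zero_ne_top).comp (hX (a / 2) (by positivity))
    exact this
  filter_upwards [ht.eventually_lt_const (u := a) (by linarith)] with n hn
  exact (hle (a / 2) (by positivity) n).trans_lt hn

end StochasticOrder

/-! ### Slutsky's lemma for characteristic functions -/

lemma norm_exp_sub_exp_le (a b : ℝ) :
    ‖Complex.exp (a * Complex.I) - Complex.exp (b * Complex.I)‖ ≤ |a - b| := by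
  have e : Complex.exp (a * Complex.I) - Complex.exp (b * Complex.I) =
      Complex.exp (b * Complex.I) * (Complex.exp (Complex.I * ((a - b : ℝ) : ℂ)) - 1) := by
    rw [mul_sub, ← Complex.exp_add]
    push_cast
    ring_nf
  rw [e, norm_mul, Complex.norm_exp_ofReal_mul_I, one_mul]
  exact Real.norm_exp_I_mul_ofReal_sub_one_le

/-- The exponential `exp (i t x)` is `|t|`-Lipschitz in `x` and of modulus one; the first fact is
used where the variables are within `ε`, the second elsewhere. -/
lemma norm_charFun_map_sub_le {Ω : Type*} [MeasurableSpace Ω] {P : Measure Ω}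
    [IsProbabilityMeasure P] {X Y : Ω → ℝ} (hX : AEMeasurable X P) (hY : AEMeasurable Y P)
    (t : ℝ) {ε : ℝ} (hε : 0 ≤ ε) :
    ‖charFun (P.map Y) t - charFun (P.map X) t‖ ≤
      |t| * ε + 2 * P.real {ω | ε ≤ |Y ω - X ω|} := by
  rw [charFun_apply_real, charFun_apply_real, integral_map hY (by fun_prop),
    integral_map hX (by fun_prop)]
  have hint : ∀ {W : Ω → ℝ}, AEMeasurable W P →
      Integrable (fun ω => Complex.exp (t * W ω * Complex.I)) P := by
    intro W hW
    refine Integrable.of_bound (C := 1) (by fun_prop) (ae_of_all _ fun ω => ?_)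
    rw [← Complex.ofReal_mul, Complex.norm_exp_ofReal_mul_I]
  have hms : NullMeasurableSet {ω | ε ≤ |Y ω - X ω|} P :=
    nullMeasurableSet_le aemeasurable_const (by fun_prop)
  have hi : Integrable ({ω | ε ≤ |Y ω - X ω|}.indicator fun _ => (2 : ℝ)) P :=
    (integrable_const _).indicator₀ hms
  rw [← integral_sub (hint hY) (hint hX)]
  refine (norm_integral_le_of_norm_le
    ((integrable_const (|t| * ε)).add hi) (ae_of_all _ fun ω => ?_)).trans (le_of_eq ?_)
  · rw [Pi.add_apply, ← Complex.ofReal_mul, ← Complex.ofReal_mul]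
    by_cases h : ε ≤ |Y ω - X ω|
    · simp only [Set.indicator_of_mem (show ω ∈ {ω | ε ≤ |Y ω - X ω|} from h)]
      have h1 := norm_sub_le (Complex.exp ((t * Y ω : ℝ) * Complex.I))
        (Complex.exp ((t * X ω : ℝ) * Complex.I))
      rw [Complex.norm_exp_ofReal_mul_I, Complex.norm_exp_ofReal_mul_I] at h1
      have : 0 ≤ |t| * ε := by positivity
      linarith
    · simp only [Set.indicator_of_notMem (show ω ∉ {ω | ε ≤ |Y ω - X ω|} from h)]
      refine (norm_exp_sub_exp_le _ _).trans ?_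
      rw [← mul_sub, abs_mul, add_zero]
      gcongr
      exact (not_le.1 h).le
  · simp only [Pi.add_apply]
    rw [integral_add (integrable_const _) hi, integral_indicator₀ hms, setIntegral_const]
    simp [mul_comm]

lemma tendsto_charFun_of_isOpOne_sub {Ω : ℕ → Type*} [∀ n, MeasurableSpace (Ω n)]
    {P : ∀ n, Measure (Ω n)} [∀ n, IsProbabilityMeasure (P n)] {X Y : ∀ n, Ω n → ℝ}
    (hX : ∀ n, AEMeasurable (X n) (P n)) (hY : ∀ n, AEMeasurable (Y n) (P n))
    (hXY : IsOpOne P (fun n ω => Y n ω - X n ω)) {t : ℝ} {c : ℂ}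
    (h : Tendsto (fun n => charFun ((P n).map (X n)) t) atTop (𝓝 c)) :
    Tendsto (fun n => charFun ((P n).map (Y n)) t) atTop (𝓝 c) := by
  have hd : Tendsto (fun n => charFun ((P n).map (Y n)) t - charFun ((P n).map (X n)) t) atTop
      (𝓝 0) := by
    rw [tendsto_zero_iff_norm_tendsto_zero]
    refine tendsto_order.2 ⟨fun a ha => Eventually.of_forall fun n =>
      ha.trans_le (norm_nonneg _), fun a ha => ?_⟩
    set ε := a / (2 * (|t| + 1))
    have hε : 0 < ε := by positivity
    have h1 : |t| * ε < a := by
      have : ε * (2 * (|t| + 1)) = a := by simp only [ε]; field_simp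
      nlinarith [abs_nonneg t]
    have ht : Tendsto (fun n => |t| * ε + 2 * (P n).real {ω | ε ≤ |Y n ω - X n ω|}) atTop
        (𝓝 (|t| * ε + 2 * 0)) :=
      tendsto_const_nhds.add (Tendsto.const_mul _
        ((ENNReal.tendsto_toReal ENNReal.zero_ne_top).comp (hXY ε hε)))
    filter_upwards [ht.eventually_lt_const (u := a) (by linarith)] with n hn
    exact (norm_charFun_map_sub_le (hX n) (hY n) t hε.le).trans_lt hn
  simpa using hd.add h

/-- Convergence in distribution to the standard normal law from characteristic functions. -/
lemma tendstoInDistribution_gaussian_of_charFun {Ω : ℕ → Type*} [∀ n, MeasurableSpace (Ω n)]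
    {P : ∀ n, Measure (Ω n)} [∀ n, IsProbabilityMeasure (P n)] {X : ∀ n, Ω n → ℝ}
    (hX : ∀ n, AEMeasurable (X n) (P n))
    (h : ∀ t : ℝ, Tendsto (fun n => charFun ((P n).map (X n)) t) atTop
      (𝓝 (Complex.exp (-t ^ 2 / 2)))) :
    TendstoInDistribution X atTop id P (gaussianReal 0 1) where
  forall_aemeasurable := hX
  aemeasurable_limit := aemeasurable_id
  tendsto := by
    refine ProbabilityMeasure.tendsto_iff_tendsto_charFun.2 fun t => ?_
    have e : charFun ((gaussianReal 0 1).map id) t = Complex.exp (-t ^ 2 / 2) := by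
      rw [Measure.map_id, charFun_gaussianReal]
      congr 1
      push_cast
      ring
    simp only [ProbabilityMeasure.coe_mk]
    rw [e]
    exact h t

end NetCausal
end

noncomputable section

namespace NetCausal

/-! ### Variance bounds -/

section Variance

variable {Ω : Type*} [MeasurableSpace Ω] {P : Measure Ω}

lemma IsDependencyGraph.comp {ι β γ : Type*} [MeasurableSpace β] [MeasurableSpace γ]
    {X : ι → Ω → β} {G : SimpleGraph ι} (h : IsDependencyGraph X G P) {g : ι → β → γ}
    (hg : ∀ i, Measurable (g i)) : IsDependencyGraph (fun i ω => g i (X i ω)) G P := by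
  intro A B hAB hno
  have hA : Measurable fun (v : ↥A → β) (a : ↥A) => g a (v a) :=
    measurable_pi_lambda _ fun a => (hg a).comp (measurable_pi_apply a)
  have hB : Measurable fun (v : ↥B → β) (b : ↥B) => g b (v b) :=
    measurable_pi_lambda _ fun a => (hg a).comp (measurable_pi_apply a)
  exact (h A B hAB hno).comp hA hB

lemma IsDependencyGraph.indepFun {ι β : Type*} [MeasurableSpace β]
    {X : ι → Ω → β} {G : SimpleGraph ι} (h : IsDependencyGraph X G P) {i j : ι} (hij : i ≠ j)
    (hadj : ¬ G.Adj i j) : IndepFun (X i) (X j) P := by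
  have := h {i} {j} (by simpa using hij) (by simpa using hadj)
  exact this.comp (φ := fun v : ↥({i} : Set ι) → β => v ⟨i, rfl⟩)
    (ψ := fun v : ↥({j} : Set ι) → β => v ⟨j, rfl⟩) (measurable_pi_apply _) (measurable_pi_apply _)

variable [IsProbabilityMeasure P]

/-- The variance of `X - r Y` is a nonnegative quadratic in `r`, so its discriminant is not
positive. -/
lemma covariance_sq_le {X Y : Ω → ℝ} (hX : MemLp X 2 P) (hY : MemLp Y 2 P) :
    cov[X, Y; P] ^ 2 ≤ Var[X; P] * Var[Y; P] := by
  have h : ∀ r : ℝ, 0 ≤ Var[Y; P] * (r * r) + (-2 * cov[X, Y; P]) * r + Var[X; P] := by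
    intro r
    have h1 := variance_nonneg (X - r • Y) P
    rw [variance_sub hX (hY.const_smul r), variance_smul, covariance_smul_right] at h1
    linarith
  have := discrim_le_zero h
  rw [discrim] at this
  nlinarith

lemma covariance_le_half_add {X Y : Ω → ℝ} (hX : MemLp X 2 P) (hY : MemLp Y 2 P) :
    cov[X, Y; P] ≤ (Var[X; P] + Var[Y; P]) / 2 := by
  have h1 := variance_nonneg (X - Y) P
  rw [variance_sub hX hY] at h1
  linarith

/-- Covariances vanish off the graph and its diagonal; the others are at most the mean of the two
variances. Each index occurs in at most `1 + M ≤ 2 M` such pairs. -/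
lemma variance_sum_le_of_isDependencyGraph {ι : Type*} [Fintype ι] {Y : ι → Ω → ℝ}
    (hY : ∀ i, MemLp (Y i) 2 P) {G : SimpleGraph ι} (hG : IsDependencyGraph Y G P) {M : ℕ}
    (hM : 1 ≤ M) (hdeg : ∀ i, (G.neighborSet i).ncard ≤ M) :
    Var[fun ω => ∑ i, Y i ω; P] ≤ 2 * M * ∑ i, ∫ ω, Y i ω ^ 2 ∂P := by
  classical
  rw [variance_fun_sum hY]
  have hcov : ∀ i j, cov[Y i, Y j; P] ≤
      if i = j ∨ G.Adj i j then (Var[Y i; P] + Var[Y j; P]) / 2 else 0 := by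
    intro i j
    split_ifs with h
    · exact covariance_le_half_add (hY i) (hY j)
    · push Not at h
      exact ((hG.indepFun h.1 h.2).covariance_eq_zero (hY i) (hY j)).le
  have hcount : ∀ i, ((Finset.univ.filter fun j => i = j ∨ G.Adj i j).card : ℝ) ≤ 2 * M := by
    intro i
    have h1 : (Finset.univ.filter fun j => i = j ∨ G.Adj i j).card ≤ 1 + M := by
      have hsub : (Finset.univ.filter fun j => i = j ∨ G.Adj i j) ⊆
          {i} ∪ Finset.univ.filter fun j => G.Adj i j := by
        intro j hj
        simp only [Finset.mem_filter, Finset.mem_univ, true_and, Finset.mem_union,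
          Finset.mem_singleton] at hj ⊢
        exact hj.imp Eq.symm id
      refine (Finset.card_le_card hsub).trans ((Finset.card_union_le _ _).trans ?_)
      rw [Finset.card_singleton]
      gcongr
      refine le_trans (le_of_eq ?_) (hdeg i)
      rw [← Set.ncard_coe_finset]
      congr 1
      ext j; simp
    have : (1 + M : ℕ) ≤ 2 * M := by omega
    exact_mod_cast h1.trans this
  have hvar : ∀ i, Var[Y i; P] ≤ ∫ ω, Y i ω ^ 2 ∂P := fun i =>
    variance_le_expectation_sq (hY i).aestronglyMeasurable
  calc ∑ i, ∑ j, cov[Y i, Y j; P]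
      ≤ ∑ i, ∑ j, if i = j ∨ G.Adj i j then (Var[Y i; P] + Var[Y j; P]) / 2 else 0 :=
        Finset.sum_le_sum fun i _ => Finset.sum_le_sum fun j _ => hcov i j
    _ = ∑ i, ∑ j, (if i = j ∨ G.Adj i j then Var[Y i; P] / 2 else 0) +
        ∑ i, ∑ j, (if i = j ∨ G.Adj i j then Var[Y j; P] / 2 else 0) := by
        rw [← Finset.sum_add_distrib]
        refine Finset.sum_congr rfl fun i _ => ?_
        rw [← Finset.sum_add_distrib]
        refine Finset.sum_congr rfl fun j _ => ?_
        split_ifs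
        · ring
        · simp
    _ = 2 * ∑ i, ∑ j, (if i = j ∨ G.Adj i j then Var[Y i; P] / 2 else 0) := by
        rw [two_mul]
        congr 1
        rw [Finset.sum_comm]
        refine Finset.sum_congr rfl fun i _ => Finset.sum_congr rfl fun j _ => ?_
        simp only [eq_comm (a := j), G.adj_comm j i]
    _ = ∑ i, ((Finset.univ.filter fun j => i = j ∨ G.Adj i j).card : ℝ) * Var[Y i; P] := by
        rw [Finset.mul_sum]
        refine Finset.sum_congr rfl fun i _ => ?_
        rw [← Finset.sum_filter, Finset.sum_const, nsmul_eq_mul]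
        ring
    _ ≤ ∑ i, 2 * M * ∫ ω, Y i ω ^ 2 ∂P := by
        refine Finset.sum_le_sum fun i _ => ?_
        exact mul_le_mul (hcount i) (hvar i) (variance_nonneg _ _) (by positivity)
    _ = _ := by rw [Finset.mul_sum]

end Variance

lemma ncard_neighborSet_le_maxDeg {n : ℕ} (G : SimpleGraph (Fin n)) (i : Fin n) :
    (G.neighborSet i).ncard ≤ maxDeg G :=
  (Finset.le_sup (f := fun i => (G.neighborSet i).ncard) (Finset.mem_univ i)).trans
    (le_max_right _ _)

/-- The condition on `n` is due to the convention that an edgeless graph has maximal degree `1`. -/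
lemma maxDeg_le {n : ℕ} (hn : 1 ≤ n) (G : SimpleGraph (Fin n)) : maxDeg G ≤ n := by
  refine max_le hn (Finset.sup_le fun i _ => ?_)
  simpa using Set.ncard_le_card (G.neighborSet i)

/-! ### Central limit theorem for square integrable arrays with dependency graphs -/

/-- The value `z`, replaced by `0` if it exceeds the level `a`. -/
def truncAt (a z : ℝ) : ℝ := if |z| ≤ a then z else 0

lemma measurable_truncAt (a : ℝ) : Measurable (truncAt a) :=
  Measurable.ite (measurableSet_le (by fun_prop) (by fun_prop)) measurable_id measurable_const

lemma abs_truncAt_le {a : ℝ} (ha : 0 ≤ a) (z : ℝ) : |truncAt a z| ≤ a := by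
  unfold truncAt
  split_ifs with h
  · exact h
  · simpa using ha

lemma abs_truncAt_le_abs (a z : ℝ) : |truncAt a z| ≤ |z| := by
  unfold truncAt
  split_ifs with h
  · exact le_rfl
  · simp

lemma truncAt_of_nonpos {a : ℝ} (ha : a ≤ 0) (z : ℝ) : truncAt a z = 0 := by
  unfold truncAt
  split_ifs with h
  · exact abs_nonpos_iff.1 (h.trans ha)
  · rfl

lemma sub_truncAt_sq {Ω : Type*} (a : ℝ) (Z : Ω → ℝ) (ω : Ω) :
    (Z ω - truncAt a (Z ω)) ^ 2 =
      {ω' | a < |Z ω'|}.indicator (fun ω' => Z ω' ^ 2) ω := by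
  unfold truncAt
  by_cases h : |Z ω| ≤ a
  · rw [if_pos h, Set.indicator_of_notMem (by simpa using h)]; ring
  · rw [if_neg h, Set.indicator_of_mem (by simpa using h)]; ring

/-- Central limit theorem for triangular arrays with dependency graphs, under a truncation
condition of arbitrary order `m`. -/
theorem tendsto_charFun_of_isDependencyGraph {Ω : ℕ → Type*} [∀ n, MeasurableSpace (Ω n)]
    (P : ∀ n, Measure (Ω n)) [∀ n, IsProbabilityMeasure (P n)]
    (Z : ∀ n, Fin n → Ω n → ℝ) (hZ : ∀ n i, Measurable (Z n i)) (hZ2 : ∀ n i, MemLp (Z n i) 2 (P n))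
    (G : ∀ n, SimpleGraph (Fin n)) (hG : ∀ n, IsDependencyGraph (Z n) (G n) (P n))
    (V : ℕ → ℝ) (hV : ∀ n, V n = Var[fun ω => ∑ i, Z n i ω; P n])
    (hVpos : ∀ᶠ n in atTop, 0 < V n) (a : ℕ → ℝ) (m : ℕ) (hm : 1 ≤ m)
    (htail : Tendsto (fun n => (maxDeg (G n) : ℝ) *
      (∑ i, ∫ ω, {ω' | a n < |Z n i ω'|}.indicator (fun ω' => Z n i ω' ^ 2) ω ∂P n) / V n)
      atTop (𝓝 0))
    (hrate : Tendsto (fun n : ℕ => (n : ℝ) ^ ((1 : ℝ) / m) *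
      (maxDeg (G n) : ℝ) ^ (((m : ℝ) - 1) / m) * a n / √(V n)) atTop (𝓝 0)) (t : ℝ) :
    Tendsto (fun n => charFun ((P n).map (fun ω =>
      (√(V n))⁻¹ * (∑ i, Z n i ω - ∫ ω', ∑ i, Z n i ω' ∂P n))) t) atTop
      (𝓝 (Complex.exp (-t ^ 2 / 2))) := by
  classical
  set M : ℕ → ℕ := fun n => maxDeg (G n) with hMdef
  have hM1 : ∀ n, 1 ≤ M n := fun n => le_max_left _ _
  have hM0 : ∀ n, (0 : ℝ) < M n := fun n => by exact_mod_cast hM1 n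
  set X : ∀ n, Fin n → Ω n → ℝ := fun n i ω => truncAt (a n) (Z n i ω) with hX
  set Y : ∀ n, Fin n → Ω n → ℝ := fun n i ω => Z n i ω - truncAt (a n) (Z n i ω) with hY
  have hXm : ∀ n i, Measurable (X n i) := fun n i => (measurable_truncAt _).comp (hZ n i)
  have hX2 : ∀ n i, MemLp (X n i) 2 (P n) := fun n i =>
    (hZ2 n i).mono (hXm n i).aestronglyMeasurable (ae_of_all _ fun ω => abs_truncAt_le_abs _ _)
  have hY2 : ∀ n i, MemLp (Y n i) 2 (P n) := fun n i => (hZ2 n i).sub (hX2 n i)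
  have hSZ2 : ∀ n, MemLp (fun ω => ∑ i, Z n i ω) 2 (P n) := fun n =>
    memLp_finsetSum _ fun i _ => hZ2 n i
  have hSX2 : ∀ n, MemLp (fun ω => ∑ i, X n i ω) 2 (P n) := fun n =>
    memLp_finsetSum _ fun i _ => hX2 n i
  have hSY2 : ∀ n, MemLp (fun ω => ∑ i, Y n i ω) 2 (P n) := fun n =>
    memLp_finsetSum _ fun i _ => hY2 n i
  set VY : ℕ → ℝ := fun n => Var[fun ω => ∑ i, Y n i ω; P n] with hVY
  -- The parts cut off by the truncation inherit the dependency graph, so the variance of their sum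
  -- is governed by the tail condition.
  have hVYle : ∀ n, VY n ≤ 2 * (M n * ∑ i, ∫ ω,
      {ω' | a n < |Z n i ω'|}.indicator (fun ω' => Z n i ω' ^ 2) ω ∂P n) := by
    intro n
    have h := variance_sum_le_of_isDependencyGraph (hY2 n)
      ((hG n).comp (g := fun _ z => z - truncAt (a n) z)
        fun _ => measurable_id.sub (measurable_truncAt _)) (hM1 n)
      (ncard_neighborSet_le_maxDeg (G n))
    simp only [hY, sub_truncAt_sq] at h
    rw [mul_assoc] at h
    exact h
  have hw : Tendsto (fun n => VY n / V n) atTop (𝓝 0) := by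
    have h2 := htail.const_mul 2
    rw [mul_zero] at h2
    refine tendsto_of_tendsto_of_tendsto_of_le_of_le' tendsto_const_nhds h2 ?_ ?_
    · filter_upwards [hVpos] with n hn using div_nonneg (variance_nonneg _ _) hn.le
    · filter_upwards [hVpos] with n hn
      rw [← mul_div_assoc]
      gcongr
      exact hVYle n
  set VX : ℕ → ℝ := fun n => Var[fun ω => ∑ i, X n i ω; P n] with hVX
  have hXY : ∀ n, (fun ω => ∑ i, X n i ω) = fun ω => (∑ i, Z n i ω) - ∑ i, Y n i ω := by
    intro n
    ext ω
    rw [← Finset.sum_sub_distrib]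
    simp [hX, hY]
  -- The covariance between the full sum and the removed part is at most `√(VY V)`, which is `o(V)`;
  -- truncation therefore leaves the variance asymptotically unchanged.
  have hVXV : Tendsto (fun n => VX n / V n) atTop (𝓝 1) := by
    have hc : Tendsto (fun n => cov[fun ω => ∑ i, Z n i ω, fun ω => ∑ i, Y n i ω; P n] / V n) atTop
        (𝓝 0) := by
      have hs : Tendsto (fun n => √(VY n / V n)) atTop (𝓝 0) := by
        have h := (Real.continuous_sqrt.tendsto 0).comp hw
        rw [Real.sqrt_zero] at h
        exact h
      refine squeeze_zero_norm' ?_ hs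
      filter_upwards [hVpos] with n hn
      rw [Real.norm_eq_abs]
      refine Real.abs_le_sqrt ?_
      rw [div_pow, div_le_div_iff₀ (by positivity) hn]
      have := covariance_sq_le (hSZ2 n) (hSY2 n)
      rw [← hV n] at this
      nlinarith
    have h := (tendsto_const_nhds (x := (1 : ℝ))).sub (hc.const_mul 2) |>.add hw
    simp only [mul_zero, sub_zero, add_zero] at h
    refine h.congr' ?_
    filter_upwards [hVpos] with n hn
    simp only [hVX]
    rw [hXY n, variance_fun_sub (hSZ2 n) (hSY2 n), ← hV n]
    field_simp
    simp only [hVY]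
  -- The truncation levels are arbitrary reals; at a nonpositive level the truncated sum is zero,
  -- which contradicts `VX / V → 1`.
  have hapos : ∀ᶠ n in atTop, 0 < a n := by
    filter_upwards [hVXV.eventually_const_lt (u := 0) one_pos] with n hn
    by_contra hneg
    have : (fun ω => ∑ i, X n i ω) = fun _ => 0 := by
      ext ω
      simp [hX, truncAt_of_nonpos (not_lt.1 hneg)]
    simp only [hVX, this] at hn
    rw [show (fun _ : Ω n => (0 : ℝ)) = 0 from rfl, variance_zero] at hn
    simp at hn
  set W : ∀ n, Fin n → Ω n → ℝ := fun n i ω =>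
    (√(V n))⁻¹ * (X n i ω - ∫ ω', X n i ω' ∂P n) with hW
  -- Centring at most doubles the bound `a n`.
  set A : ℕ → ℝ := fun n => 2 * a n / √(V n) with hA
  have hXint : ∀ n i, Integrable (X n i) (P n) := fun n i => (hX2 n i).integrable (by simp)
  have hZint : ∀ n i, Integrable (Z n i) (P n) := fun n i => (hZ2 n i).integrable (by simp)
  have hAbd : ∀ᶠ n in atTop, 0 < A n ∧ ∀ i ω, |W n i ω| ≤ A n := by
    filter_upwards [hapos, hVpos] with n ha hv
    have hsv : 0 < √(V n) := Real.sqrt_pos.2 hv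
    refine ⟨by positivity, fun i ω => ?_⟩
    have h1 := abs_truncAt_le ha.le (Z n i ω)
    have h2 : |∫ ω', X n i ω' ∂P n| ≤ a n := by
      have := norm_integral_le_of_norm_le_const (μ := P n) (f := X n i) (C := a n)
        (ae_of_all _ fun ω => abs_truncAt_le ha.le _)
      simpa using this
    simp only [hW, hA]
    rw [abs_mul, abs_of_pos (inv_pos.2 hsv), inv_mul_eq_div]
    gcongr
    refine (abs_sub _ _).trans ?_
    linarith
  have hWsum : ∀ n ω, ∑ i, W n i ω =
      (√(V n))⁻¹ * (∑ i, X n i ω - ∫ ω', ∑ i, X n i ω' ∂P n) := by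
    intro n ω
    rw [integral_finsetSum _ fun i _ => hXint n i, ← Finset.sum_sub_distrib, Finset.mul_sum]
  -- Since `M ≤ n`, the factor `M = M ^ (1 / m) M ^ ((m - 1) / m)` is dominated by the one in the
  -- rate condition, so that condition also gives `M A → 0`.
  have hrate0 : ∀ n : ℕ, 1 ≤ n → 0 < a n → 0 < V n → (M n : ℝ) * A n ≤
      2 * ((n : ℝ) ^ ((1 : ℝ) / m) * (M n : ℝ) ^ (((m : ℝ) - 1) / m) * a n / √(V n)) := by
    intro n hn ha hv
    have hm0 : (m : ℝ) ≠ 0 := by exact_mod_cast (by omega : m ≠ 0)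
    have hMn : (M n : ℝ) ≤ n := by exact_mod_cast maxDeg_le hn (G n)
    have : (M n : ℝ) ≤ (n : ℝ) ^ ((1 : ℝ) / m) * (M n : ℝ) ^ (((m : ℝ) - 1) / m) := by
      calc (M n : ℝ) = (M n : ℝ) ^ ((1 : ℝ) / m) * (M n : ℝ) ^ (((m : ℝ) - 1) / m) := by
            rw [← Real.rpow_add (hM0 n)]
            rw [show (1 : ℝ) / m + ((m : ℝ) - 1) / m = 1 by field_simp; ring, Real.rpow_one]
        _ ≤ _ := by
            gcongr
    have hsv : 0 < √(V n) := Real.sqrt_pos.2 hv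
    calc (M n : ℝ) * A n = 2 * (M n * a n / √(V n)) := by simp only [hA]; ring
      _ ≤ _ := by gcongr
  have hclt := tendsto_charFun_of_bounded P W
    (fun n i => ((hXm n i).sub_const _).const_mul _) A M G hM1
    (fun n => ncard_neighborSet_le_maxDeg (G n))
    (fun n => (hG n).comp (g := fun i z => (√(V n))⁻¹ *
      (truncAt (a n) z - ∫ ω', X n i ω' ∂P n))
      fun i => ((measurable_truncAt _).sub_const _).const_mul _)
    (fun n i => by
      simp only [hW]
      rw [integral_const_mul, integral_sub (hXint n i) (integrable_const _)]
      simp)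
    hAbd
    (by
      have h2 := hrate.const_mul 2
      rw [mul_zero] at h2
      refine tendsto_of_tendsto_of_tendsto_of_le_of_le' tendsto_const_nhds h2 ?_ ?_
      · filter_upwards [hAbd] with n hn using mul_nonneg (hM0 n).le hn.1.le
      · filter_upwards [hapos, hVpos, eventually_ge_atTop 1] with n ha hv hn
        exact hrate0 n hn ha hv) m
    (by
      -- The `m`-th power of twice the rate is `n M ^ (m - 1) A ^ m`, that is, `(n / M) (M A) ^ m`.
      have h2 := (hrate.const_mul 2).pow m
      rw [mul_zero, zero_pow (by omega)] at h2
      refine h2.congr fun n => ?_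
      have hm0 : (m : ℝ) ≠ 0 := by exact_mod_cast (by omega : m ≠ 0)
      have e1 : ((n : ℝ) ^ ((1 : ℝ) / m)) ^ m = n := by
        rw [one_div, Real.rpow_inv_natCast_pow (by positivity) (by omega)]
      have e2 : ((M n : ℝ) ^ (((m : ℝ) - 1) / m)) ^ m = (M n : ℝ) ^ m / M n := by
        rw [← Real.rpow_natCast, ← Real.rpow_mul (hM0 n).le, div_mul_cancel₀ _ hm0,
          Real.rpow_sub_one (hM0 n).ne', Real.rpow_natCast]
      simp only [hA]
      rw [show 2 * ((n : ℝ) ^ ((1 : ℝ) / m) * (M n : ℝ) ^ (((m : ℝ) - 1) / m) * a n / √(V n)) =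
        (n : ℝ) ^ ((1 : ℝ) / m) * (M n : ℝ) ^ (((m : ℝ) - 1) / m) * (2 * a n / √(V n)) by ring,
        mul_pow, mul_pow, e1, e2, mul_pow]
      ring)
    (by
      refine hVXV.congr' ?_
      filter_upwards [hVpos] with n hn
      simp only [hWsum, mul_pow, hVX]
      rw [integral_const_mul, inv_pow, Real.sq_sqrt hn.le, inv_mul_eq_div,
        variance_eq_integral (hSX2 n).aemeasurable]) t
  have hSm : ∀ n, Measurable (fun ω => ∑ i, Z n i ω) := fun n => by have := hZ n; fun_prop
  have hSXm : ∀ n, Measurable (fun ω => ∑ i, X n i ω) := fun n => by have := hXm n; fun_prop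
  refine tendsto_charFun_of_isOpOne_sub (X := fun n ω => ∑ i, W n i ω) ?_ ?_ ?_ hclt
  · intro n
    simp only [hWsum]
    exact (((hSXm n).sub_const _).const_mul _).aemeasurable
  · intro n
    exact (((hSm n).sub_const _).const_mul _).aemeasurable
  · have hdiff : ∀ n ω, (√(V n))⁻¹ * (∑ i, Z n i ω - ∫ ω', ∑ i, Z n i ω' ∂P n) -
        ∑ i, W n i ω = (√(V n))⁻¹ * (∑ i, Y n i ω - ∫ ω', ∑ i, Y n i ω' ∂P n) := by
      intro n ω
      have e : (fun ω => ∑ i, Y n i ω) = fun ω => ∑ i, Z n i ω - ∑ i, X n i ω := by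
        ext ω; rw [← Finset.sum_sub_distrib]
      rw [hWsum, e, integral_sub ((hSZ2 n).integrable (by simp)) ((hSX2 n).integrable (by simp))]
      have e' : ∑ i, Y n i ω = ∑ i, Z n i ω - ∑ i, X n i ω := congrFun e ω
      rw [e']
      ring
    simp only [hdiff]
    have hsq : IsOpOne P (fun n ω =>
        ((√(V n))⁻¹ * (∑ i, Y n i ω - ∫ ω', ∑ i, Y n i ω' ∂P n)) ^ 2) := by
      refine isOpOne_of_integral_abs_le (b := fun n => VY n / V n) ?_ ?_ hw
      · refine Eventually.of_forall fun n => ?_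
        exact (((hSY2 n).sub (memLp_const _)).const_mul _).integrable_sq
      · filter_upwards [hVpos] with n hn
        refine le_of_eq ?_
        simp only [abs_sq]
        simp only [mul_pow]
        rw [integral_const_mul, inv_pow, Real.sq_sqrt hn.le, inv_mul_eq_div]
        simp only [hVY]
        rw [variance_eq_integral (hSY2 n).aemeasurable]
    refine hsq.sqrt.of_abs_le_mul 1 (Eventually.of_forall fun n => ae_of_all _ fun ω => ?_)
    rw [Real.sqrt_sq_eq_abs, abs_abs, one_mul]

end NetCausal
end

noncomputable section

namespace NetCausal

/-! ### Measurability of the objects of a study -/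

lemma measurable_sigma_mk {α : Type*} {β : α → Type*} [∀ a, MeasurableSpace (β a)] (a : α) :
    Measurable (Sigma.mk a : β a → Sigma β) := by
  refine measurable_iff_le_map.2 ?_
  exact iInf_le _ a

lemma measurable_tupleOver {α β γ : Type*} [MeasurableSpace β] [MeasurableSpace γ] (l : List α)
    {g : γ → α → β} (hg : ∀ a, Measurable fun c => g c a) :
    Measurable fun c => tupleOver l (g c) :=
  (measurable_sigma_mk (β := fun m : ℕ => Fin m → β) l.length).comp
    (measurable_pi_lambda _ fun k => hg (l.get k))

lemma measurable_localInfo_left {d n : ℕ} (D : Fin n → Fin n → Bool) (i : Fin n) (l : ℕ) :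
    Measurable fun x : Fin n → Fin d → ℝ => localInfo x D i l := by
  induction l with
  | zero => exact measurable_pi_apply i
  | succ l ih =>
    refine Measurable.prodMk (β := LocalInfo d l) (γ := Tuple (Tuple (Fin d → ℝ))) ih ?_
    exact measurable_tupleOver _ fun j => measurable_tupleOver _ fun k => measurable_pi_apply k

lemma measurable_logistic : Measurable logistic := by
  unfold logistic
  fun_prop

lemma OutcomeKind.measurable_link (kind : OutcomeKind) : Measurable kind.link := by
  cases kind
  · exact measurable_id
  · exact measurable_logistic

lemma abs_ind_le (a b : Bool) : |ind a b| ≤ 1 := by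
  unfold ind; split_ifs <;> simp

lemma ind_nonneg (a b : Bool) : 0 ≤ ind a b := by
  unfold ind; split_ifs <;> simp

/-- If `m` is not a sub-sigma-algebra, the conditional expectation is zero by convention, so
measurability needs no comparison of sigma-algebras. It is applied to those generated by the
embeddings. -/
lemma measurable_condExp_any {Ω : Type*} {m m0 : MeasurableSpace Ω} {P : Measure Ω} {f : Ω → ℝ} :
    Measurable (condExp m P f) := by
  by_cases hm : m ≤ m0
  · exact (stronglyMeasurable_condExp.mono hm).measurable
  · rw [condExp_of_not_le hm]; exact measurable_const

/-- A bounded factor known to `m` can be pulled out of the conditional expectation. All conditioning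
arguments on unconfoundedness, sufficiency and uncorrelated residuals pass through this identity. -/
lemma integral_mul_eq_of_condExp_ae_eq {m m0 : MeasurableSpace Ω} {P : Measure Ω}
    [IsProbabilityMeasure P] (hm : m ≤ m0) {W f g : Ω → ℝ} (hW : AEStronglyMeasurable[m] W P)
    {C : ℝ} (hC : ∀ᵐ ω ∂P, |W ω| ≤ C) (hf : Integrable f P) (hg : condExp m P f =ᵐ[P] g) :
    ∫ ω, W ω * f ω ∂P = ∫ ω, W ω * g ω ∂P := by
  have hWf : Integrable (W * f) P := hf.bdd_mul (hW.mono hm) hC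
  have h1 := condExp_mul_of_aestronglyMeasurable_left hW hWf hf
  calc ∫ ω, W ω * f ω ∂P = ∫ ω, (condExp m P (W * f)) ω ∂P := (integral_condExp hm).symm
    _ = ∫ ω, W ω * g ω ∂P := by
      refine integral_congr_ae ?_
      filter_upwards [h1, hg] with ω e1 e2
      rw [e1, Pi.mul_apply, e2]

namespace Study

variable {Ω : Type*} [MeasurableSpace Ω] {d K n : ℕ} {wOut : Bool → ℕ → ℕ} {wProp : ℕ → ℕ}
  (S : Study Ω d K n wOut wProp) {P : Measure Ω} {kind : OutcomeKind} {act : ℝ → ℝ}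
  {𝒳 : Set (Fin d → ℝ)} {zbar : ℝ} {s : LocalInfo d (K + 1) → Bool}

lemma measurable_ξ (i : Fin n) : Measurable (S.ξ i) := by
  have h : Measurable fun q : (Fin n → Fin d → ℝ) × (Fin n → Fin n → Bool) =>
      localInfo q.1 q.2 i (K + 1) :=
    -- There are only finitely many adjacency matrices, so joint measurability reduces to
    -- measurability in the covariates for a fixed network.
    measurable_from_prod_countable_left fun D => measurable_localInfo_left D i (K + 1)
  exact h.comp (S.measurable_x.prodMk S.measurable_adj)

lemma measurable_ind_treat (i : Fin n) (t : Bool) : Measurable fun ω => ind (S.treat i ω) t :=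
  (measurable_of_countable fun b : Bool => ind b t).comp (S.measurable_treat i)

lemma measurable_y (i : Fin n) : Measurable (S.y i) :=
  ((S.measurable_ind_treat i true).mul (S.measurable_pot true i)).add
    ((measurable_const.sub (S.measurable_ind_treat i true)).mul (S.measurable_pot false i))

lemma measurable_υ (i : Fin n) : Measurable (S.υ i) :=
  (S.measurable_y i).prodMk ((S.measurable_treat i).prodMk (S.measurable_ξ i))

lemma measurable_sw (hs : Measurable s) (t : Bool) (i : Fin n) : Measurable (S.sw s t i) :=
  (measurable_of_countable fun b : Bool => ind b t).comp (hs.comp (S.measurable_ξ i))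

lemma infoSigma_le (i : Fin n) : S.infoSigma i ≤ ‹MeasurableSpace Ω› :=
  (S.measurable_ξ i).comap_le

lemma infoTreatSigma_le (i : Fin n) : S.infoTreatSigma i ≤ ‹MeasurableSpace Ω› :=
  ((S.measurable_ξ i).prodMk (S.measurable_treat i)).comap_le

lemma designSigma_le : S.designSigma ≤ ‹MeasurableSpace Ω› :=
  (measurable_pi_lambda _ fun i => (S.measurable_ξ i).prodMk (S.measurable_treat i)).comap_le

lemma dataSigma_le : S.dataSigma ≤ ‹MeasurableSpace Ω› :=
  (measurable_pi_lambda _ fun i => S.measurable_υ i).comap_le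

lemma infoSigma_le_infoTreatSigma (i : Fin n) : S.infoSigma i ≤ S.infoTreatSigma i := by
  have : S.ξ i = Prod.fst ∘ fun ω => (S.ξ i ω, S.treat i ω) := rfl
  rw [infoSigma, this, ← MeasurableSpace.comap_comp]
  exact MeasurableSpace.comap_mono measurable_fst.comap_le

lemma infoTreatSigma_le_designSigma (i : Fin n) : S.infoTreatSigma i ≤ S.designSigma := by
  have : (fun ω => (S.ξ i ω, S.treat i ω)) =
      (fun v : Fin n → LocalInfo d (K + 1) × Bool => v i) ∘
        fun ω (i : Fin n) => (S.ξ i ω, S.treat i ω) := rfl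
  rw [infoTreatSigma, this, ← MeasurableSpace.comap_comp]
  exact MeasurableSpace.comap_mono (measurable_pi_apply i).comap_le

lemma measurable_sw_infoSigma (hs : Measurable s) (t : Bool) (i : Fin n) :
    Measurable[S.infoSigma i] (S.sw s t i) :=
  ((measurable_of_countable fun b : Bool => ind b t).comp hs).comp
    (comap_measurable (S.ξ i))

lemma measurable_ind_treat_infoTreatSigma (t : Bool) (i : Fin n) :
    Measurable[S.infoTreatSigma i] fun ω => ind (S.treat i ω) t :=
  ((measurable_of_countable fun b : Bool => ind b t).comp measurable_snd).comp
    (comap_measurable fun ω => (S.ξ i ω, S.treat i ω))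

lemma measurable_μ (t : Bool) (i : Fin n) : Measurable (S.μ P t i) := measurable_condExp_any

lemma measurable_p (t : Bool) (i : Fin n) : Measurable (S.p P t i) := by
  have h : Measurable (condExp (S.embSigmaProp i) P fun ω' => ind (S.treat i ω') true) :=
    measurable_condExp_any
  cases t
  · simpa [p] using! measurable_const.sub h
  · simpa [p] using! h

lemma measurable_φ (t : Bool) (i : Fin n) : Measurable (S.φ P t i) :=
  (((S.measurable_ind_treat i t).div (S.measurable_p t i)).mul
    ((S.measurable_y i).sub (S.measurable_μ t i))).add (S.measurable_μ t i)

lemma measurable_ζ (hs : Measurable s) (i : Fin n) : Measurable (S.ζ P s i) :=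
  ((S.measurable_sw hs true i).mul (S.measurable_φ true i)).add
    ((S.measurable_sw hs false i).mul (S.measurable_φ false i))

variable {S}

lemma Setup.measurable_μHat (h : S.Setup P kind act 𝒳 zbar) (t : Bool) (i : Fin n) :
    Measurable (S.μHat kind act t i) :=
  kind.measurable_link.comp ((h.measurable_fitOut t i).mono S.dataSigma_le le_rfl)

/-- The propensity fit does not look at outcomes. This is what later allows the weight errors to be
treated as constants given the design. -/
lemma Setup.measurable_pHat_designSigma (h : S.Setup P kind act 𝒳 zbar) (t : Bool) (i : Fin n) :
    Measurable[S.designSigma] (S.pHat act t i) := by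
  have h1 := measurable_logistic.comp (h.measurable_fitProp i)
  cases t
  · simpa [pHat] using! measurable_const.sub h1
  · simpa [pHat] using! h1

lemma Setup.measurable_pHat (h : S.Setup P kind act 𝒳 zbar) (t : Bool) (i : Fin n) :
    Measurable (S.pHat act t i) :=
  (h.measurable_pHat_designSigma t i).mono S.designSigma_le le_rfl

lemma Setup.measurable_ζHat (h : S.Setup P kind act 𝒳 zbar) (hs : Measurable s) (i : Fin n) :
    Measurable (S.ζHat kind act s i) := by
  have hφ : ∀ t, Measurable (S.φHat kind act t i) := fun t =>
    (((S.measurable_ind_treat i t).div (h.measurable_pHat t i)).mul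
      ((S.measurable_y i).sub (h.measurable_μHat t i))).add (h.measurable_μHat t i)
  exact ((S.measurable_sw hs true i).mul (hφ true)).add ((S.measurable_sw hs false i).mul (hφ false))

lemma Setup.measurable_piHat (h : S.Setup P kind act 𝒳 zbar) (hs : Measurable s) :
    Measurable (S.piHat kind act s) := by
  have := h.measurable_ζHat hs
  unfold piHat
  fun_prop

lemma Setup.measurable_sigmaHat (h : S.Setup P kind act 𝒳 zbar) (hs : Measurable s) {cbar : ℕ}
    (cl : Fin n → Fin cbar) : Measurable (S.sigmaHat kind act s cl) := by
  have := h.measurable_ζHat hs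
  unfold sigmaHat clusterMeanHat
  fun_prop

/-! ### Regularity conditions for one sample size -/

/-- The consequences of the identification conditions, for one sample size, that enter the
analysis of the estimator. -/
structure Regular (S : Study Ω d K n wOut wProp) (P : Measure Ω) (act : ℝ → ℝ) (pmin cy : ℝ) :
    Prop where
  pmin_pos : 0 < pmin
  pmin_le_one : pmin ≤ 1
  cy_pos : 0 < cy
  overlap : ∀ (i : Fin n), ∀ᵐ ω ∂P,
    (pmin ≤ S.p P true i ω ∧ S.p P true i ω ≤ 1 - pmin) ∧
    (pmin ≤ S.pHat act true i ω ∧ S.pHat act true i ω ≤ 1 - pmin)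
  unconfounded : ∀ (i : Fin n) t,
    condExp (S.infoTreatSigma i) P (S.pot t i) =ᵐ[P] condExp (S.infoSigma i) P (S.pot t i)
  sufficient_out : ∀ (i : Fin n) t,
    condExp (S.embSigma t i) P (S.pot t i) =ᵐ[P] condExp (S.infoSigma i) P (S.pot t i)
  sufficient_prop : ∀ (i : Fin n),
    condExp (S.embSigmaProp i) P (fun ω => ind (S.treat i ω) true) =ᵐ[P]
      condExp (S.infoSigma i) P (fun ω => ind (S.treat i ω) true)
  uncorrelated : ∀ (i j : Fin n), i ≠ j → ∀ t,
    condExp S.designSigma P (fun ω => S.u P t i ω * S.u P t j ω) =ᵐ[P] 0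
  square_integrable : ∀ t i, MemLp (S.pot t i) 2 P
  second_moment : ∀ t, ∀ᵐ ω ∂P, ∀ i,
    condExp S.designSigma P (fun ω' => |S.pot t i ω'| ^ 2) ω ≤ cy

variable {pmin cy : ℝ}

lemma Regular.p_bounds (h : S.Regular P act pmin cy) (t : Bool) (i : Fin n) :
    ∀ᵐ ω ∂P, (pmin ≤ S.p P t i ω ∧ S.p P t i ω ≤ 1) ∧
      (pmin ≤ S.pHat act t i ω ∧ S.pHat act t i ω ≤ 1) := by
  filter_upwards [h.overlap i] with ω hω
  obtain ⟨⟨h1, h2⟩, h3, h4⟩ := hω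
  have := h.pmin_pos
  cases t
  · simp only [p, pHat] at *
    simp only [if_true] at h1 h2 h3 h4
    simp only [Bool.false_eq_true, if_false]
    refine ⟨⟨?_, ?_⟩, ?_, ?_⟩ <;> linarith
  · exact ⟨⟨h1, by linarith⟩, h3, by linarith⟩

/-- By sufficiency the propensity agrees almost surely with a conditional expectation given `ξ_i`,
which is how it becomes a function of `ξ_i`. -/
lemma Regular.aestronglyMeasurable_p (h : S.Regular P act pmin cy) (t : Bool) (i : Fin n) :
    AEStronglyMeasurable[S.infoSigma i] (S.p P t i) P := by
  have h1 : AEStronglyMeasurable[S.infoSigma i]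
      (condExp (S.embSigmaProp i) P fun ω => ind (S.treat i ω) true) P :=
    ⟨_, stronglyMeasurable_condExp, h.sufficient_prop i⟩
  cases t
  · have := (aestronglyMeasurable_const (m := S.infoSigma i) (b := (1 : ℝ)) (μ := P)).sub h1
    simpa [p] using! this
  · simpa [p] using! h1

/-- The influence function depends on a node only through its observations. -/
lemma Regular.exists_ζ_eq_comp_υ (h : S.Regular P act pmin cy) (hs : Measurable s) (i : Fin n) :
    ∃ g : ℝ × Bool × LocalInfo d (K + 1) → ℝ, Measurable g ∧
      S.ζ P s i =ᵐ[P] fun ω => g (S.υ i ω) := by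
  have hμ : ∀ t, ∃ g : LocalInfo d (K + 1) → ℝ, StronglyMeasurable g ∧
      condExp (S.infoSigma i) P (S.pot t i) = g ∘ S.ξ i := fun t =>
    (stronglyMeasurable_condExp (m := S.infoSigma i)).exists_eq_measurable_comp
  obtain ⟨gp, hgp, ep⟩ := (stronglyMeasurable_condExp (m := S.infoSigma i) (μ := P)
    (f := fun ω => ind (S.treat i ω) true)).exists_eq_measurable_comp
  choose gμ hgμ eμ using hμ
  have hgμ' : ∀ t, Measurable (gμ t) := fun t => (hgμ t).measurable
  have hgp' : Measurable gp := hgp.measurable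
  have hi : ∀ t, Measurable fun b : Bool => ind b t := fun t => measurable_of_countable _
  let f : Bool → ℝ × Bool × LocalInfo d (K + 1) → ℝ := fun t v =>
    ind v.2.1 t / (if t then gp v.2.2 else 1 - gp v.2.2) * (v.1 - gμ t v.2.2) + gμ t v.2.2
  have hf : ∀ t, Measurable (f t) := by
    intro t
    have h1 := hgμ' t
    have h2 := hi t
    have e1 : Measurable fun v : ℝ × Bool × LocalInfo d (K + 1) => ind v.2.1 t :=
      h2.comp (measurable_fst.comp measurable_snd)
    cases t
    · simp only [f, Bool.false_eq_true, if_false]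
      fun_prop
    · simp only [f, if_true]
      fun_prop
  have hsw : ∀ t, Measurable fun v : ℝ × Bool × LocalInfo d (K + 1) => ind (s v.2.2) t := fun t =>
    (hi t).comp (hs.comp (measurable_snd.comp measurable_snd))
  refine ⟨fun v => ind (s v.2.2) true * f true v + ind (s v.2.2) false * f false v,
    ((hsw true).mul (hf true)).add ((hsw false).mul (hf false)), ?_⟩
  filter_upwards [h.sufficient_out i true, h.sufficient_out i false, h.sufficient_prop i]
    with ω e1 e2 e3
  rw [eμ] at e1 e2
  rw [ep] at e3
  simp only [ζ, φ, sw, μ, p, e1, e2, e3, υ, f, Function.comp]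

variable [IsProbabilityMeasure P]

namespace Regular

/-- Conditional variance is nonnegative, so `μ² ≤ E[y² | ξ_i]`; the tower property passes the bound
given the whole design down to `ξ_i`. -/
lemma sq_μ_le (h : S.Regular P act pmin cy) (t : Bool) (i : Fin n) :
    ∀ᵐ ω ∂P, S.μ P t i ω ^ 2 ≤ cy := by
  have hle := S.infoSigma_le i
  have hle' : S.infoSigma i ≤ S.designSigma :=
    (S.infoSigma_le_infoTreatSigma i).trans (S.infoTreatSigma_le_designSigma i)
  have hint : Integrable (S.pot t i ^ 2) P := (h.square_integrable t i).integrable_sq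
  have h1 := condVar_ae_eq_condExp_sq_sub_sq_condExp hle (h.square_integrable t i)
  have h2 : 0 ≤ᵐ[P] Var[S.pot t i; P | S.infoSigma i] :=
    condExp_nonneg (ae_of_all _ fun ω => sq_nonneg _)
  have h3 := condExp_condExp_of_le (μ := P) (f := S.pot t i ^ 2) hle' S.designSigma_le
  have h4 : condExp S.designSigma P (S.pot t i ^ 2) ≤ᵐ[P] fun _ => cy := by
    filter_upwards [h.second_moment t] with ω hω
    have := hω i
    simp only [sq_abs] at this
    exact this
  have h5 := condExp_mono (m := S.infoSigma i) (μ := P) integrable_condExp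
    (integrable_const cy) h4
  rw [condExp_const hle] at h5
  filter_upwards [h.sufficient_out i t, h1, h2, h3, h5] with ω e1 e2 e3 e4 e5
  rw [μ, e1]
  simp only [Pi.zero_apply, Pi.sub_apply, Pi.pow_apply] at *
  linarith

lemma abs_μ_le (h : S.Regular P act pmin cy) (t : Bool) (i : Fin n) :
    ∀ᵐ ω ∂P, |S.μ P t i ω| ≤ √cy := by
  filter_upwards [h.sq_μ_le t i] with ω hω using Real.abs_le_sqrt hω

end Regular

/-! ### Moments of the influence function -/

lemma ind_mul_y (S : Study Ω d K n wOut wProp) (t : Bool) (i : Fin n) (ω : Ω) :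
    ind (S.treat i ω) t * S.y i ω = ind (S.treat i ω) t * S.pot t i ω := by
  unfold y
  cases hT : S.treat i ω <;> cases t <;> simp [ind]

lemma ind_mul_y_sub_μ (S : Study Ω d K n wOut wProp) (P : Measure Ω) (t : Bool) (i : Fin n)
    (ω : Ω) : ind (S.treat i ω) t * (S.y i ω - S.μ P t i ω) = ind (S.treat i ω) t * S.u P t i ω := by
  rw [u, mul_sub, mul_sub, ind_mul_y]

/-- `φ_t` in terms of potential outcomes. -/
lemma φ_eq (S : Study Ω d K n wOut wProp) (P : Measure Ω) (t : Bool) (i : Fin n) (ω : Ω) :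
    S.φ P t i ω = ind (S.treat i ω) t / S.p P t i ω * S.u P t i ω + S.μ P t i ω := by
  rw [φ, div_mul_eq_mul_div, ind_mul_y_sub_μ, ← div_mul_eq_mul_div]

lemma abs_sw_combination_le {a b c x y : ℝ} {τ : Bool} (ha : a = ind τ true) (hb : b = ind τ false)
    (hx : |x| ≤ c) (hy : |y| ≤ c) : |a * x + b * y| ≤ c := by
  subst ha hb
  cases τ
  · simpa [ind] using hy
  · simpa [ind] using hx

/-- A bound of the influence function by the potential outcomes. -/
lemma Regular.abs_ζ_le (h : S.Regular P act pmin cy) (i : Fin n) :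
    ∀ᵐ ω ∂P, |S.ζ P s i ω| ≤
      2 / pmin * (1 + √cy) * (1 + |S.pot true i ω| + |S.pot false i ω|) := by
  have hpos := h.pmin_pos
  have key : ∀ t, ∀ᵐ ω ∂P, |S.φ P t i ω| ≤
      2 / pmin * (1 + √cy) * (1 + |S.pot true i ω| + |S.pot false i ω|) := by
    intro t
    filter_upwards [h.p_bounds t i, h.abs_μ_le t i] with ω hp hμ
    have hpp : 0 < S.p P t i ω := hpos.trans_le hp.1.1
    have h0 := Real.sqrt_nonneg cy
    have h1 : |ind (S.treat i ω) t / S.p P t i ω| ≤ 1 / pmin := by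
      rw [abs_div, abs_of_pos hpp]
      exact div_le_div₀ zero_le_one (abs_ind_le _ _) hpos hp.1.1
    have h2 : |S.pot t i ω| ≤ |S.pot true i ω| + |S.pot false i ω| := by
      cases t
      · linarith [abs_nonneg (S.pot true i ω)]
      · linarith [abs_nonneg (S.pot false i ω)]
    have h3 : |S.u P t i ω| ≤ |S.pot true i ω| + |S.pot false i ω| + √cy :=
      (abs_sub _ _).trans (by linarith)
    have h4 : (1 : ℝ) ≤ 1 / pmin := by rw [le_div_iff₀ hpos]; linarith [h.pmin_le_one]
    rw [φ_eq]
    set A := |S.pot true i ω| + |S.pot false i ω| with hA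
    have hA0 : 0 ≤ A := by positivity
    calc |ind (S.treat i ω) t / S.p P t i ω * S.u P t i ω + S.μ P t i ω|
        ≤ |ind (S.treat i ω) t / S.p P t i ω| * |S.u P t i ω| + |S.μ P t i ω| := by
          rw [← abs_mul]; exact abs_add_le _ _
      _ ≤ 1 / pmin * (A + √cy) + 1 / pmin * √cy := by
          refine add_le_add (mul_le_mul h1 h3 (abs_nonneg _) (by positivity)) ?_
          nlinarith
      _ = 1 / pmin * (A + 2 * √cy) := by ring
      _ ≤ 1 / pmin * (2 * ((1 + √cy) * (1 + A))) := by
          gcongr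
          nlinarith [mul_nonneg h0 hA0]
      _ = _ := by rw [hA]; ring
  filter_upwards [key true, key false] with ω h1 h2
  exact abs_sw_combination_le (τ := s (S.ξ i ω)) rfl rfl h1 h2

lemma Regular.memLp_ζ (h : S.Regular P act pmin cy) (hs : Measurable s) (i : Fin n) :
    MemLp (S.ζ P s i) 2 P := by
  have h1 : MemLp (fun ω => 2 / pmin * (1 + √cy) * (1 + |S.pot true i ω| + |S.pot false i ω|)) 2 P :=
    MemLp.const_mul (MemLp.add (f := fun ω => 1 + |S.pot true i ω|)
      (g := fun ω => |S.pot false i ω|) (MemLp.add (f := fun _ => 1)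
      (g := fun ω => |S.pot true i ω|) (memLp_const 1) (h.square_integrable true i).abs)
      (h.square_integrable false i).abs) _
  refine h1.mono (S.measurable_ζ hs i).aestronglyMeasurable ?_
  filter_upwards [h.abs_ζ_le i] with ω hω
  rw [Real.norm_eq_abs, Real.norm_eq_abs]
  exact hω.trans (le_abs_self _)

/-- The influence functions have mean `π(s)`. -/
lemma Regular.integral_ζ (h : S.Regular P act pmin cy) (hs : Measurable s) (i : Fin n) :
    ∫ ω, S.ζ P s i ω ∂P = S.policyValue P s i := by
  have hpos := h.pmin_pos
  have hpot : ∀ t, Integrable (S.pot t i) P := fun t =>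
    (h.square_integrable t i).integrable (by norm_num)
  have hμint : ∀ t, Integrable (S.μ P t i) P := fun t => integrable_condExp
  have hswb : ∀ t ω, |S.sw s t i ω| ≤ 1 := fun t ω => abs_ind_le _ _
  have hswm : ∀ t, AEStronglyMeasurable[S.infoSigma i] (S.sw s t i) P := fun t =>
    (S.measurable_sw_infoSigma hs t i).stronglyMeasurable.aestronglyMeasurable
  let W : Bool → Ω → ℝ := fun t ω => S.sw s t i ω * (ind (S.treat i ω) t / S.p P t i ω)
  have hWb : ∀ t, ∀ᵐ ω ∂P, |W t ω| ≤ 1 / pmin := by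
    intro t
    filter_upwards [h.p_bounds t i] with ω hp
    have hpp : 0 < S.p P t i ω := hpos.trans_le hp.1.1
    simp only [W]
    rw [abs_mul, abs_div, abs_of_pos hpp]
    calc |S.sw s t i ω| * (|ind (S.treat i ω) t| / S.p P t i ω) ≤ 1 * (1 / pmin) :=
          mul_le_mul (hswb t ω) (div_le_div₀ zero_le_one (abs_ind_le _ _) hpos hp.1.1)
            (by positivity) zero_le_one
      _ = _ := one_mul _
  have hWm : ∀ t, AEStronglyMeasurable[S.infoTreatSigma i] (W t) P := by
    intro t
    refine ((hswm t).mono (S.infoSigma_le_infoTreatSigma i)).mul ?_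
    obtain ⟨q, hq, hqe⟩ := (h.aestronglyMeasurable_p t i).mono (S.infoSigma_le_infoTreatSigma i)
    refine ⟨fun ω => ind (S.treat i ω) t / q ω,
      ((S.measurable_ind_treat_infoTreatSigma t i).div hq.measurable).stronglyMeasurable, ?_⟩
    filter_upwards [hqe] with ω e
    rw [e]
  -- The weight is known given `(ξ_i, t_i)`, and by unconfoundedness and sufficiency `μ` is the
  -- conditional mean of the potential outcome given that information; the weighted residual
  -- therefore integrates to zero.
  have e1 : ∀ t, ∫ ω, W t ω * S.pot t i ω ∂P = ∫ ω, W t ω * S.μ P t i ω ∂P := fun t =>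
    integral_mul_eq_of_condExp_ae_eq (S.infoTreatSigma_le i) (hWm t) (hWb t) (hpot t)
      ((h.unconfounded i t).trans (h.sufficient_out i t).symm)
  have e2 : ∀ t, ∫ ω, S.sw s t i ω * S.pot t i ω ∂P = ∫ ω, S.sw s t i ω * S.μ P t i ω ∂P :=
    fun t => integral_mul_eq_of_condExp_ae_eq (S.infoSigma_le i) (hswm t)
      (ae_of_all _ (hswb t)) (hpot t) (h.sufficient_out i t).symm
  have iW : ∀ t (f : Ω → ℝ), Integrable f P → Integrable (fun ω => W t ω * f ω) P :=
    fun t f hf => hf.bdd_mul ((hWm t).mono (S.infoTreatSigma_le i)) (hWb t)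
  have iS : ∀ t (f : Ω → ℝ), Integrable f P → Integrable (fun ω => S.sw s t i ω * f ω) P :=
    fun t f hf => hf.bdd_mul ((hswm t).mono (S.infoSigma_le i)) (ae_of_all _ (hswb t))
  have e3 : ∀ t, Integrable (fun ω => S.sw s t i ω * S.φ P t i ω) P ∧
      ∫ ω, S.sw s t i ω * S.φ P t i ω ∂P = ∫ ω, S.sw s t i ω * S.pot t i ω ∂P := by
    intro t
    have e : (fun ω => S.sw s t i ω * S.φ P t i ω) = fun ω =>
        (W t ω * S.pot t i ω - W t ω * S.μ P t i ω) + S.sw s t i ω * S.μ P t i ω := by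
      ext ω
      rw [φ_eq]
      simp only [W, u]
      ring
    have i1 : Integrable (fun ω => W t ω * S.pot t i ω - W t ω * S.μ P t i ω) P := (iW t _ (hpot t)).sub (iW t _ (hμint t))
    rw [e]
    refine ⟨i1.add (iS t _ (hμint t)), ?_⟩
    rw [integral_add i1 (iS t _ (hμint t)), integral_sub (iW t _ (hpot t)) (iW t _ (hμint t)),
      e1, e2, sub_self, zero_add]
  unfold ζ policyValue
  rw [integral_add (e3 true).1 (e3 false).1, integral_add (iS true _ (hpot true))
    (iS false _ (hpot false)), (e3 true).2, (e3 false).2]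

end Study

end NetCausal
end

noncomputable section

namespace NetCausal

namespace Study

/-! ### Expansion of the estimator around the influence functions -/

section Expansion

variable {Ω : Type*} [MeasurableSpace Ω] {d K n : ℕ} {wOut : Bool → ℕ → ℕ} {wProp : ℕ → ℕ}

/-- The error of the estimated inverse propensity weight of a treated unit. -/
def weightError (S : Study Ω d K n wOut wProp) (P : Measure Ω) (act : ℝ → ℝ)
    (s : LocalInfo d (K + 1) → Bool) (t : Bool) (i : Fin n) (ω : Ω) : ℝ :=
  S.sw s t i ω * ind (S.treat i ω) t * ((S.pHat act t i ω)⁻¹ - (S.p P t i ω)⁻¹)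

variable (S : Study Ω d K n wOut wProp) (P : Measure Ω) (kind : OutcomeKind) (act : ℝ → ℝ)
  (s : LocalInfo d (K + 1) → Bool)

/-- The expansion behind double robustness: an orthogonality term with the true weight, a term
linear in the residuals, and a product of the two estimation errors. -/
lemma sw_mul_φHat_sub (t : Bool) (i : Fin n) (ω : Ω) :
    S.sw s t i ω * (S.φHat kind act t i ω - S.φ P t i ω) =
      S.sw s t i ω * (S.μHat kind act t i ω - S.μ P t i ω) *
        (1 - ind (S.treat i ω) t / S.p P t i ω) +
      S.weightError P act s t i ω * S.u P t i ω -
      S.weightError P act s t i ω * (S.μHat kind act t i ω - S.μ P t i ω) := by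
  have h := ind_mul_y_sub_μ S P t i ω
  simp only [φHat, φ, weightError, div_eq_mul_inv]
  linear_combination
    S.sw s t i ω * ((S.pHat act t i ω)⁻¹ - (S.p P t i ω)⁻¹) * h

/-- A regrouping with the estimated weight, which overlap bounds; it is suited to mean squares,
where no cancellation is needed. -/
lemma sw_mul_φHat_sub' (t : Bool) (i : Fin n) (ω : Ω) :
    S.sw s t i ω * (S.φHat kind act t i ω - S.φ P t i ω) =
      S.sw s t i ω * (S.μHat kind act t i ω - S.μ P t i ω) *
        (1 - ind (S.treat i ω) t / S.pHat act t i ω) +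
      S.weightError P act s t i ω * S.u P t i ω := by
  rw [sw_mul_φHat_sub, weightError]
  simp only [div_eq_mul_inv]
  ring

lemma ζHat_sub_ζ (i : Fin n) (ω : Ω) : S.ζHat kind act s i ω - S.ζ P s i ω =
    S.sw s true i ω * (S.φHat kind act true i ω - S.φ P true i ω) +
    S.sw s false i ω * (S.φHat kind act false i ω - S.φ P false i ω) := by
  simp only [ζHat, ζ]
  ring

variable {S P kind act s} {pmin cy : ℝ} {𝒳 : Set (Fin d → ℝ)} {zbar : ℝ}

lemma abs_sw_le (t : Bool) (i : Fin n) (ω : Ω) : |S.sw s t i ω| ≤ 1 := abs_ind_le _ _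

/-- The difference of the inverses is the difference of the propensities over their product, and
overlap bounds that product below by `pmin ^ 2`. -/
lemma Regular.abs_weightError_le (h : S.Regular P act pmin cy) (t : Bool) (i : Fin n) :
    ∀ᵐ ω ∂P, |S.weightError P act s t i ω| ≤ |S.pHat act t i ω - S.p P t i ω| / pmin ^ 2 ∧
      |S.pHat act t i ω - S.p P t i ω| ≤ 1 := by
  have hpos := h.pmin_pos
  filter_upwards [h.p_bounds t i] with ω hp
  obtain ⟨⟨h1, h2⟩, h3, h4⟩ := hp
  have hp0 : 0 < S.p P t i ω := hpos.trans_le h1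
  have hq0 : 0 < S.pHat act t i ω := hpos.trans_le h3
  constructor
  · rw [weightError, abs_mul, abs_mul, inv_sub_inv hq0.ne' hp0.ne', abs_div,
      abs_of_pos (mul_pos hq0 hp0), abs_sub_comm]
    have hsi : |S.sw s t i ω| * |ind (S.treat i ω) t| ≤ 1 :=
      mul_le_one₀ (abs_sw_le t i ω) (abs_nonneg _) (abs_ind_le _ _)
    calc |S.sw s t i ω| * |ind (S.treat i ω) t| *
          (|S.pHat act t i ω - S.p P t i ω| / (S.pHat act t i ω * S.p P t i ω))
        ≤ 1 * (|S.pHat act t i ω - S.p P t i ω| / (S.pHat act t i ω * S.p P t i ω)) := by gcongr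
      _ ≤ |S.pHat act t i ω - S.p P t i ω| / pmin ^ 2 := by
          rw [one_mul, pow_two]; gcongr
  · rw [abs_le]; constructor <;> linarith

lemma Regular.sq_weightError_le (h : S.Regular P act pmin cy) (t : Bool) (i : Fin n) :
    ∀ᵐ ω ∂P, S.weightError P act s t i ω ^ 2 ≤
      (S.pHat act t i ω - S.p P t i ω) ^ 2 / pmin ^ 4 := by
  filter_upwards [h.abs_weightError_le (s := s) t i] with ω hω
  have := pow_le_pow_left₀ (abs_nonneg _) hω.1 2
  rw [sq_abs, div_pow, sq_abs, ← pow_mul] at this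
  exact this

lemma Regular.abs_weightError_le_const (h : S.Regular P act pmin cy) (t : Bool) (i : Fin n) :
    ∀ᵐ ω ∂P, |S.weightError P act s t i ω| ≤ 1 / pmin ^ 2 := by
  have := h.pmin_pos
  filter_upwards [h.abs_weightError_le (s := s) t i] with ω hω
  exact hω.1.trans (by gcongr; exact hω.2)

lemma Regular.aestronglyMeasurable_weightError (h : S.Regular P act pmin cy)
    (hset : S.Setup P kind act 𝒳 zbar) (hs : Measurable s) (t : Bool) (i : Fin n) :
    AEStronglyMeasurable[S.designSigma] (S.weightError P act s t i) P := by
  have hle := (S.infoSigma_le_infoTreatSigma i).trans (S.infoTreatSigma_le_designSigma i)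
  obtain ⟨q, hq, hqe⟩ := (h.aestronglyMeasurable_p t i).mono hle
  refine ⟨fun ω => S.sw s t i ω * ind (S.treat i ω) t * ((S.pHat act t i ω)⁻¹ - (q ω)⁻¹),
    Measurable.stronglyMeasurable ?_, ?_⟩
  · have h1 := (S.measurable_sw_infoSigma hs t i).mono hle le_rfl
    have h2 := (S.measurable_ind_treat_infoTreatSigma t i).mono
      (S.infoTreatSigma_le_designSigma i) le_rfl
    exact (h1.mul h2).mul ((hset.measurable_pHat_designSigma t i).inv.sub hq.measurable.inv)
  · filter_upwards [hqe] with ω e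
    rw [weightError, e]

lemma Regular.sq_ζHat_sub_ζ_le (h : S.Regular P act pmin cy) (i : Fin n) :
    ∀ᵐ ω ∂P, (S.ζHat kind act s i ω - S.ζ P s i ω) ^ 2 ≤
      4 * (1 / pmin ^ 2 * (S.μHat kind act true i ω - S.μ P true i ω) ^ 2 +
        1 / pmin ^ 2 * (S.μHat kind act false i ω - S.μ P false i ω) ^ 2 +
        (S.weightError P act s true i ω * S.u P true i ω) ^ 2 +
        (S.weightError P act s false i ω * S.u P false i ω) ^ 2) := by
  have hpos := h.pmin_pos
  have key : ∀ t, ∀ᵐ ω ∂P, (S.sw s t i ω * (S.μHat kind act t i ω - S.μ P t i ω) *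
      (1 - ind (S.treat i ω) t / S.pHat act t i ω)) ^ 2 ≤
      1 / pmin ^ 2 * (S.μHat kind act t i ω - S.μ P t i ω) ^ 2 := by
    intro t
    filter_upwards [h.p_bounds t i] with ω hp
    have hq0 : 0 < S.pHat act t i ω := hpos.trans_le hp.2.1
    have h1 : 0 ≤ ind (S.treat i ω) t / S.pHat act t i ω := div_nonneg (ind_nonneg _ _) hq0.le
    have h2 : ind (S.treat i ω) t / S.pHat act t i ω ≤ 1 / pmin :=
      div_le_div₀ zero_le_one ((le_abs_self _).trans (abs_ind_le _ _)) hpos hp.2.1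
    have h3 : (1 : ℝ) ≤ 1 / pmin := by rw [le_div_iff₀ hpos]; linarith [h.pmin_le_one]
    have h4 : |1 - ind (S.treat i ω) t / S.pHat act t i ω| ≤ 1 / pmin := by
      rw [abs_le]; constructor <;> linarith
    have h5 : |S.sw s t i ω * (1 - ind (S.treat i ω) t / S.pHat act t i ω)| ≤ 1 / pmin := by
      rw [abs_mul]
      calc _ ≤ 1 * (1 / pmin) := mul_le_mul (abs_sw_le t i ω) h4 (abs_nonneg _) zero_le_one
        _ = _ := one_mul _
    have h6 := pow_le_pow_left₀ (abs_nonneg _) h5 2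
    rw [sq_abs, div_pow, one_pow] at h6
    have := mul_le_mul_of_nonneg_right h6 (sq_nonneg (S.μHat kind act t i ω - S.μ P t i ω))
    refine le_trans (le_of_eq ?_) this
    ring
  filter_upwards [key true, key false] with ω h1 h2
  rw [ζHat_sub_ζ, sw_mul_φHat_sub', sw_mul_φHat_sub']
  set a := S.sw s true i ω * (S.μHat kind act true i ω - S.μ P true i ω) *
      (1 - ind (S.treat i ω) true / S.pHat act true i ω)
  set b := S.sw s false i ω * (S.μHat kind act false i ω - S.μ P false i ω) *
      (1 - ind (S.treat i ω) false / S.pHat act false i ω)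
  set c := S.weightError P act s true i ω * S.u P true i ω
  set e := S.weightError P act s false i ω * S.u P false i ω
  nlinarith [sq_nonneg (a - c), sq_nonneg (a - b), sq_nonneg (a - e), sq_nonneg (c - b),
    sq_nonneg (c - e), sq_nonneg (b - e)]

variable [IsProbabilityMeasure P]

lemma Regular.memLp_u (h : S.Regular P act pmin cy) (t : Bool) (i : Fin n) :
    MemLp (S.u P t i) 2 P := by
  refine (h.square_integrable t i).sub (MemLp.of_bound (S.measurable_μ t i).aestronglyMeasurable
    (√cy) ?_)
  exact h.abs_μ_le t i

lemma Regular.memLp_weightError_mul_u (h : S.Regular P act pmin cy)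
    (hset : S.Setup P kind act 𝒳 zbar) (hs : Measurable s) (t : Bool) (i : Fin n) :
    MemLp (fun ω => S.weightError P act s t i ω * S.u P t i ω) 2 P := by
  have hm := (h.aestronglyMeasurable_weightError hset hs t i).mono S.designSigma_le
  refine MemLp.of_le_mul (c := 1 / pmin ^ 2) (h.memLp_u t i)
    (hm.mul (h.memLp_u t i).aestronglyMeasurable) ?_
  filter_upwards [h.abs_weightError_le_const (s := s) t i] with ω hω
  rw [norm_mul]
  exact mul_le_mul_of_nonneg_right hω (norm_nonneg _)

lemma Setup.integrable_sq_pHat_sub (hset : S.Setup P kind act 𝒳 zbar)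
    (h : S.Regular P act pmin cy) (t : Bool) (i : Fin n) :
    Integrable (fun ω => (S.pHat act t i ω - S.p P t i ω) ^ 2) P := by
  refine Integrable.of_bound (C := 1)
    (((hset.measurable_pHat t i).sub (S.measurable_p t i)).pow_const 2).aestronglyMeasurable ?_
  -- The bound on the propensity difference does not involve the policy, so an arbitrary one is
  -- inserted.
  filter_upwards [h.abs_weightError_le (s := fun _ => true) t i] with ω hω
  rw [Real.norm_eq_abs, abs_pow]
  exact pow_le_one₀ (abs_nonneg _) hω.2

/-- Given the design the weight error is fixed, and `u² ≤ 2 y² + 2 μ²` has conditional mean at most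
`4 cy`; overlap then converts the squared weight error into the squared propensity error. -/
lemma Regular.integral_sq_weightError_mul_u_le (h : S.Regular P act pmin cy)
    (hset : S.Setup P kind act 𝒳 zbar) (hs : Measurable s) (t : Bool) (i : Fin n) :
    ∫ ω, (S.weightError P act s t i ω * S.u P t i ω) ^ 2 ∂P ≤
      4 * cy / pmin ^ 4 * ∫ ω, (S.pHat act t i ω - S.p P t i ω) ^ 2 ∂P := by
  have hpos := h.pmin_pos
  have hm := h.aestronglyMeasurable_weightError hset hs t i
  set W := S.weightError P act s t i with hW
  have hWsqm : AEStronglyMeasurable[S.designSigma] (fun ω => W ω ^ 2) P := hm.pow 2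
  have hWsqb : ∀ᵐ ω ∂P, |W ω ^ 2| ≤ (1 / pmin ^ 2) ^ 2 := by
    filter_upwards [h.abs_weightError_le_const (s := s) t i] with ω hω
    rw [abs_pow]
    exact pow_le_pow_left₀ (abs_nonneg _) hω 2
  have hWsqint : Integrable (fun ω => W ω ^ 2) P :=
    Integrable.of_bound (hWsqm.mono S.designSigma_le) _ hWsqb
  have hy2 : Integrable (fun ω => |S.pot t i ω| ^ 2) P := by
    simpa only [sq_abs] using (h.square_integrable t i).integrable_sq
  have hWy : Integrable (fun ω => W ω ^ 2 * |S.pot t i ω| ^ 2) P :=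
    hy2.bdd_mul (hWsqm.mono S.designSigma_le) hWsqb
  have h1 : ∫ ω, W ω ^ 2 * |S.pot t i ω| ^ 2 ∂P ≤ cy * ∫ ω, W ω ^ 2 ∂P := by
    rw [integral_mul_eq_of_condExp_ae_eq S.designSigma_le hWsqm hWsqb hy2
      (EventuallyEq.refl _ _), ← integral_const_mul]
    refine integral_mono_ae ?_ (hWsqint.const_mul _) ?_
    · exact integrable_condExp.bdd_mul (hWsqm.mono S.designSigma_le) hWsqb
    · filter_upwards [h.second_moment t] with ω hω
      have := mul_le_mul_of_nonneg_left (hω i) (sq_nonneg (W ω))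
      linarith
  calc ∫ ω, (W ω * S.u P t i ω) ^ 2 ∂P
      ≤ ∫ ω, (2 * (W ω ^ 2 * |S.pot t i ω| ^ 2) + 2 * cy * W ω ^ 2) ∂P := by
        refine integral_mono_ae (h.memLp_weightError_mul_u hset hs t i).integrable_sq
          ((hWy.const_mul 2).add (hWsqint.const_mul _)) ?_
        filter_upwards [h.sq_μ_le t i] with ω hω
        simp only [sq_abs]
        have h2 : (S.u P t i ω) ^ 2 ≤ 2 * S.pot t i ω ^ 2 + 2 * cy := by
          rw [u]; nlinarith [sq_nonneg (S.pot t i ω + S.μ P t i ω)]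
        have := mul_le_mul_of_nonneg_left h2 (sq_nonneg (W ω))
        rw [mul_pow]
        linarith
    _ = 2 * ∫ ω, W ω ^ 2 * |S.pot t i ω| ^ 2 ∂P + 2 * cy * ∫ ω, W ω ^ 2 ∂P := by
        rw [integral_add (hWy.const_mul 2) (hWsqint.const_mul _), integral_const_mul,
          integral_const_mul]
    _ ≤ 4 * cy * ∫ ω, W ω ^ 2 ∂P := by linarith
    _ ≤ 4 * cy * ∫ ω, (S.pHat act t i ω - S.p P t i ω) ^ 2 / pmin ^ 4 ∂P := by
        have := h.cy_pos
        gcongr 4 * cy * ?_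
        exact integral_mono_ae hWsqint ((hset.integrable_sq_pHat_sub h t i).div_const _)
          (h.sq_weightError_le t i)
    _ = _ := by rw [integral_div]; ring

/-- The weighted sum of residuals is an orthogonal sum given the design. -/
lemma Regular.integral_sq_sum_weightError_mul_u_le (h : S.Regular P act pmin cy)
    (hset : S.Setup P kind act 𝒳 zbar) (hs : Measurable s) (t : Bool) :
    ∫ ω, (∑ i, S.weightError P act s t i ω * S.u P t i ω) ^ 2 ∂P ≤
      4 * cy / pmin ^ 4 * ∑ i, ∫ ω, (S.pHat act t i ω - S.p P t i ω) ^ 2 ∂P := by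
  classical
  have hL := h.memLp_weightError_mul_u hset hs t
  have hint : ∀ i j, Integrable (fun ω => (S.weightError P act s t i ω * S.u P t i ω) *
      (S.weightError P act s t j ω * S.u P t j ω)) P := fun i j => (hL i).integrable_mul (hL j)
  -- The product of the two weight errors is known given the design, so it factors out and leaves
  -- the conditional covariance of the residuals, which is zero.
  have hcross : ∀ i j, i ≠ j → ∫ ω, (S.weightError P act s t i ω * S.u P t i ω) *
      (S.weightError P act s t j ω * S.u P t j ω) ∂P = 0 := by
    intro i j hij
    have hm : AEStronglyMeasurable[S.designSigma]
        (fun ω => S.weightError P act s t i ω * S.weightError P act s t j ω) P :=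
      (h.aestronglyMeasurable_weightError hset hs t i).mul
        (h.aestronglyMeasurable_weightError hset hs t j)
    have hb : ∀ᵐ ω ∂P, |S.weightError P act s t i ω * S.weightError P act s t j ω| ≤
        1 / pmin ^ 2 * (1 / pmin ^ 2) := by
      filter_upwards [h.abs_weightError_le_const (s := s) t i,
        h.abs_weightError_le_const (s := s) t j] with ω h1 h2
      rw [abs_mul]
      exact mul_le_mul h1 h2 (abs_nonneg _) (by positivity)
    have h0 := integral_mul_eq_of_condExp_ae_eq S.designSigma_le hm hb
      ((h.memLp_u t i).integrable_mul (h.memLp_u t j)) (h.uncorrelated i j hij t)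
    simp only [Pi.zero_apply, mul_zero, integral_zero, Pi.mul_apply] at h0
    rw [← h0]
    refine integral_congr_ae (ae_of_all _ fun ω => ?_)
    simp only
    ring
  calc ∫ ω, (∑ i, S.weightError P act s t i ω * S.u P t i ω) ^ 2 ∂P
      = ∫ ω, ∑ i, ∑ j, (S.weightError P act s t i ω * S.u P t i ω) *
        (S.weightError P act s t j ω * S.u P t j ω) ∂P := by
        simp only [pow_two, Finset.sum_mul_sum]
    _ = ∑ i, ∑ j, ∫ ω, (S.weightError P act s t i ω * S.u P t i ω) *
        (S.weightError P act s t j ω * S.u P t j ω) ∂P := by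
        rw [integral_finsetSum _ fun i _ => integrable_finsetSum _ fun j _ => hint i j]
        refine Finset.sum_congr rfl fun i _ => ?_
        rw [integral_finsetSum _ fun j _ => hint i j]
    _ = ∑ i, ∫ ω, (S.weightError P act s t i ω * S.u P t i ω) ^ 2 ∂P := by
        refine Finset.sum_congr rfl fun i _ => ?_
        rw [Finset.sum_eq_single i (fun j _ hj => hcross i j (Ne.symm hj)) (by simp)]
        simp only [pow_two]
    _ ≤ _ := by
        rw [Finset.mul_sum]
        exact Finset.sum_le_sum fun i _ => h.integral_sq_weightError_mul_u_le hset hs t i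

end Expansion

end Study

/-! ### Asymptotic linearity -/

section Asymptotics

variable {Ω : ℕ → Type*} [∀ n, MeasurableSpace (Ω n)] {P : ∀ n, Measure (Ω n)}
  {d K : ℕ} {wOut : Bool → ℕ → ℕ} {wProp : ℕ → ℕ}
  {S : ∀ n, Study (Ω n) d K n wOut wProp} {kind : OutcomeKind} {act : ℝ → ℝ}
  {𝒳 : Set (Fin d → ℝ)} {zbar : ℝ} {s : LocalInfo d (K + 1) → Bool} {pmin cy : ℝ}

lemma AssumptionII.exists_regular (h : AssumptionII P S kind act s) :
    ∃ pmin cy : ℝ, ∀ n, (S n).Regular (P n) act pmin cy := by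
  obtain ⟨pmin, hp0, hp1, hp⟩ := h.overlap
  obtain ⟨cy, hcy0, hcy⟩ := h.second_moment
  exact ⟨pmin, cy, fun n => ⟨hp0, by linarith, hcy0, hp n, h.unconfounded n, h.sufficient_out n,
    h.sufficient_prop n, h.uncorrelated n, h.square_integrable n, hcy n⟩⟩

/-- Cauchy–Schwarz bounds the sum by the product of the root mean squared errors, which is where the
product rate is used. -/
lemma isOpOne_sum_weightError_mul_μHat_sub (h : AssumptionII P S kind act s)
    (hreg : ∀ n, (S n).Regular (P n) act pmin cy) (t : Bool) :
    IsOpOne P fun n ω => √(n : ℝ) * ((n : ℝ)⁻¹ * ∑ i, (S n).weightError (P n) act s t i ω *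
      ((S n).μHat kind act t i ω - (S n).μ (P n) t i ω)) := by
  refine (h.product_rate t).of_abs_le_mul (1 / pmin ^ 2) (Eventually.of_forall fun n => ?_)
  have hpos := (hreg n).pmin_pos
  have : ∀ᵐ ω ∂P n, ∀ i, |(S n).weightError (P n) act s t i ω| ≤
      |(S n).pHat act t i ω - (S n).p (P n) t i ω| / pmin ^ 2 :=
    ae_all_iff.2 fun i => ((hreg n).abs_weightError_le (s := s) t i).mono fun ω hω => hω.1
  filter_upwards [this] with ω hω
  set a := fun i => (S n).μHat kind act t i ω - (S n).μ (P n) t i ω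
  set b := fun i => (S n).pHat act t i ω - (S n).p (P n) t i ω
  have h1 : |∑ i, (S n).weightError (P n) act s t i ω * a i| ≤
      1 / pmin ^ 2 * (√(∑ i, a i ^ 2) * √(∑ i, b i ^ 2)) := by
    calc |∑ i, (S n).weightError (P n) act s t i ω * a i|
        ≤ ∑ i, |(S n).weightError (P n) act s t i ω * a i| := Finset.abs_sum_le_sum_abs _ _
      _ ≤ ∑ i, 1 / pmin ^ 2 * (|a i| * |b i|) := by
          refine Finset.sum_le_sum fun i _ => ?_
          rw [abs_mul]
          calc _ ≤ |b i| / pmin ^ 2 * |a i| := by gcongr; exact hω i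
            _ = _ := by ring
      _ = 1 / pmin ^ 2 * ∑ i, |a i| * |b i| := by rw [Finset.mul_sum]
      _ ≤ 1 / pmin ^ 2 * (√(∑ i, |a i| ^ 2) * √(∑ i, |b i| ^ 2)) := by
          gcongr
          exact Real.sum_mul_le_sqrt_mul_sqrt _ _ _
      _ = _ := by simp only [sq_abs]
  have h2 : (n : ℝ)⁻¹ * (√(∑ i, a i ^ 2) * √(∑ i, b i ^ 2)) =
      √((n : ℝ)⁻¹ * ∑ i, a i ^ 2) * √((n : ℝ)⁻¹ * ∑ i, b i ^ 2) := by
    rw [Real.sqrt_mul (by positivity), Real.sqrt_mul (by positivity)]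
    have := Real.mul_self_sqrt (show (0 : ℝ) ≤ (n : ℝ)⁻¹ by positivity)
    linear_combination -(√(∑ i, a i ^ 2) * √(∑ i, b i ^ 2)) * this
  rw [abs_mul, abs_mul, abs_of_nonneg (Real.sqrt_nonneg _),
    abs_of_nonneg (show (0 : ℝ) ≤ (n : ℝ)⁻¹ by positivity), ← h2]
  have h3 : (0 : ℝ) ≤ √(n : ℝ) * ((n : ℝ)⁻¹ * (√(∑ i, a i ^ 2) * √(∑ i, b i ^ 2))) := by
    positivity
  rw [abs_of_nonneg h3]
  calc _ ≤ √(n : ℝ) * ((n : ℝ)⁻¹ * (1 / pmin ^ 2 * (√(∑ i, a i ^ 2) * √(∑ i, b i ^ 2)))) := by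
        gcongr
    _ = _ := by ring

variable [∀ n, IsProbabilityMeasure (P n)]

lemma tendsto_integral_mean_sq_pHat_sub (h : AssumptionII P S kind act s)
    (hset : ∀ n, (S n).Setup (P n) kind act 𝒳 zbar)
    (hreg : ∀ n, (S n).Regular (P n) act pmin cy) (t : Bool) :
    Tendsto (fun n : ℕ => (n : ℝ)⁻¹ *
      ∑ i, ∫ ω, ((S n).pHat act t i ω - (S n).p (P n) t i ω) ^ 2 ∂P n) atTop (𝓝 0) := by
  have hm : ∀ n : ℕ, AEMeasurable (fun ω => (n : ℝ)⁻¹ *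
      ∑ i, ((S n).pHat act t i ω - (S n).p (P n) t i ω) ^ 2) (P n) := by
    intro n
    have h1 := (hset n).measurable_pHat t
    have h2 := (S n).measurable_p (P := P n) t
    exact Measurable.aemeasurable (by fun_prop)
  have hb : ∀ n : ℕ, ∀ᵐ ω ∂P n, |(n : ℝ)⁻¹ *
      ∑ i, ((S n).pHat act t i ω - (S n).p (P n) t i ω) ^ 2| ≤ 1 := by
    intro n
    have : ∀ᵐ ω ∂P n, ∀ i, |(S n).pHat act t i ω - (S n).p (P n) t i ω| ≤ 1 :=
      ae_all_iff.2 fun i => ((hreg n).abs_weightError_le (s := s) t i).mono fun ω hω => hω.2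
    filter_upwards [this] with ω hω
    rw [abs_of_nonneg (by positivity)]
    have h1 : ∑ i, ((S n).pHat act t i ω - (S n).p (P n) t i ω) ^ 2 ≤ n := by
      calc _ ≤ ∑ _i : Fin n, (1 : ℝ) := Finset.sum_le_sum fun i _ => by
            rw [← sq_abs]; exact pow_le_one₀ (abs_nonneg _) (hω i)
        _ = n := by simp
    calc _ ≤ (n : ℝ)⁻¹ * n := by gcongr
      _ ≤ 1 := inv_mul_le_one
  refine ((h.consistent_p t).tendsto_integral_abs hm hb).congr fun n => ?_
  have e : ∀ ω, |(n : ℝ)⁻¹ * ∑ i, ((S n).pHat act t i ω - (S n).p (P n) t i ω) ^ 2| =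
      (n : ℝ)⁻¹ * ∑ i, ((S n).pHat act t i ω - (S n).p (P n) t i ω) ^ 2 := fun ω =>
    abs_of_nonneg (by positivity)
  simp only [e]
  rw [integral_const_mul, integral_finsetSum _ fun i _ =>
    (hset n).integrable_sq_pHat_sub (hreg n) t i]

/-- The second moment is at most a constant times the expected mean squared error of the propensity
score. Consistency alone suffices, without a rate, because the cross terms vanish. -/
lemma isOpOne_sum_weightError_mul_u (h : AssumptionII P S kind act s)
    (hset : ∀ n, (S n).Setup (P n) kind act 𝒳 zbar) (hs : Measurable s)
    (hreg : ∀ n, (S n).Regular (P n) act pmin cy) (t : Bool) :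
    IsOpOne P fun n ω => √(n : ℝ) *
      ((n : ℝ)⁻¹ * ∑ i, (S n).weightError (P n) act s t i ω * (S n).u (P n) t i ω) := by
  have hsq : IsOpOne P fun n ω => (√(n : ℝ) *
      ((n : ℝ)⁻¹ * ∑ i, (S n).weightError (P n) act s t i ω * (S n).u (P n) t i ω)) ^ 2 := by
    have hlim := (tendsto_integral_mean_sq_pHat_sub h hset hreg t).const_mul (4 * cy / pmin ^ 4)
    rw [mul_zero] at hlim
    refine isOpOne_of_integral_abs_le (Eventually.of_forall fun n => ?_) ?_ hlim
    · have : MemLp (fun ω => ∑ i, (S n).weightError (P n) act s t i ω * (S n).u (P n) t i ω) 2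
          (P n) := memLp_finsetSum _ fun i _ => (hreg n).memLp_weightError_mul_u (hset n) hs t i
      exact ((this.const_mul _).const_mul _).integrable_sq
    · filter_upwards [eventually_ge_atTop 1] with n hn
      have hn0 : (0 : ℝ) < n := by exact_mod_cast hn
      have e : ∀ ω, |(√(n : ℝ) * ((n : ℝ)⁻¹ *
          ∑ i, (S n).weightError (P n) act s t i ω * (S n).u (P n) t i ω)) ^ 2| =
          (n : ℝ)⁻¹ *
            (∑ i, (S n).weightError (P n) act s t i ω * (S n).u (P n) t i ω) ^ 2 := by
        intro ω
        rw [abs_sq, mul_pow, mul_pow, Real.sq_sqrt hn0.le]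
        field_simp
      simp only [e]
      rw [integral_const_mul]
      have := (hreg n).integral_sq_sum_weightError_mul_u_le (hset n) hs t
      calc _ ≤ (n : ℝ)⁻¹ * (4 * cy / pmin ^ 4 *
            ∑ i, ∫ ω, ((S n).pHat act t i ω - (S n).p (P n) t i ω) ^ 2 ∂P n) := by gcongr
        _ = _ := by ring
  refine hsq.sqrt.of_abs_le_mul 1 (Eventually.of_forall fun n => ae_of_all _ fun ω => ?_)
  rw [Real.sqrt_sq_eq_abs, abs_abs, one_mul]

lemma isOpOne_mean_sq_weightError_mul_u (h : AssumptionII P S kind act s)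
    (hset : ∀ n, (S n).Setup (P n) kind act 𝒳 zbar) (hs : Measurable s)
    (hreg : ∀ n, (S n).Regular (P n) act pmin cy) (t : Bool) :
    IsOpOne P fun n ω =>
      (n : ℝ)⁻¹ * ∑ i, ((S n).weightError (P n) act s t i ω * (S n).u (P n) t i ω) ^ 2 := by
  have hlim := (tendsto_integral_mean_sq_pHat_sub h hset hreg t).const_mul (4 * cy / pmin ^ 4)
  rw [mul_zero] at hlim
  have hint : ∀ n i, Integrable
      (fun ω => ((S n).weightError (P n) act s t i ω * (S n).u (P n) t i ω) ^ 2) (P n) := fun n i =>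
    ((hreg n).memLp_weightError_mul_u (hset n) hs t i).integrable_sq
  refine isOpOne_of_integral_abs_le (Eventually.of_forall fun n => ?_)
    (Eventually.of_forall fun n => ?_) hlim
  · exact (integrable_finsetSum _ fun i _ => hint n i).const_mul _
  · have e : ∀ ω, |(n : ℝ)⁻¹ *
        ∑ i, ((S n).weightError (P n) act s t i ω * (S n).u (P n) t i ω) ^ 2| =
        (n : ℝ)⁻¹ * ∑ i, ((S n).weightError (P n) act s t i ω * (S n).u (P n) t i ω) ^ 2 :=
      fun ω => abs_of_nonneg (by positivity)
    simp only [e]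
    rw [integral_const_mul, integral_finsetSum _ fun i _ => hint n i]
    calc _ ≤ (n : ℝ)⁻¹ * ∑ i, 4 * cy / pmin ^ 4 *
          ∫ ω, ((S n).pHat act t i ω - (S n).p (P n) t i ω) ^ 2 ∂P n := by
          gcongr with i
          exact (hreg n).integral_sq_weightError_mul_u_le (hset n) hs t i
      _ = _ := by rw [← Finset.mul_sum]; ring

/-- The estimator is asymptotically equivalent to the mean of the influence functions. -/
theorem isOpOne_piHat_sub (h : AssumptionII P S kind act s)
    (hset : ∀ n, (S n).Setup (P n) kind act 𝒳 zbar) (hs : Measurable s)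
    (hreg : ∀ n, (S n).Regular (P n) act pmin cy) :
    IsOpOne P fun n ω => √(n : ℝ) *
      ((S n).piHat kind act s ω - (n : ℝ)⁻¹ * ∑ i, (S n).ζ (P n) s i ω) := by
  have ht : ∀ t, IsOpOne P fun n ω => √(n : ℝ) * ((n : ℝ)⁻¹ * ∑ i, (S n).sw s t i ω *
      ((S n).φHat kind act t i ω - (S n).φ (P n) t i ω)) := by
    intro t
    have := ((h.orthogonality t).add (isOpOne_sum_weightError_mul_u h hset hs hreg t)).sub
      (isOpOne_sum_weightError_mul_μHat_sub h hreg t)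
    convert this using 3 with n ω
    simp only [Study.sw_mul_φHat_sub, Finset.sum_add_distrib, Finset.sum_sub_distrib]
    ring
  convert (ht true).add (ht false) using 3 with n ω
  rw [← mul_add, ← mul_add, ← Finset.sum_add_distrib]
  simp only [← Study.ζHat_sub_ζ, Study.piHat, Finset.sum_sub_distrib]
  ring

lemma isOpOne_mean_sq_ζHat_sub (h : AssumptionII P S kind act s)
    (hset : ∀ n, (S n).Setup (P n) kind act 𝒳 zbar) (hs : Measurable s)
    (hreg : ∀ n, (S n).Regular (P n) act pmin cy) :
    IsOpOne P fun n ω => (n : ℝ)⁻¹ *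
      ∑ i, ((S n).ζHat kind act s i ω - (S n).ζ (P n) s i ω) ^ 2 := by
  have hc : ∀ t, IsOpOne P fun n ω => 1 / pmin ^ 2 * ((n : ℝ)⁻¹ *
      ∑ i, ((S n).μHat kind act t i ω - (S n).μ (P n) t i ω) ^ 2) := fun t =>
    (h.consistent_μ t).of_abs_le_mul |1 / pmin ^ 2| (Eventually.of_forall fun n =>
      ae_of_all _ fun ω => by rw [abs_mul])
  have hall := (((hc true).add (hc false)).add
    (isOpOne_mean_sq_weightError_mul_u h hset hs hreg true)).add
    (isOpOne_mean_sq_weightError_mul_u h hset hs hreg false)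
  refine hall.of_abs_le_mul 4 (Eventually.of_forall fun n => ?_)
  have := ae_all_iff.2 fun i => (hreg n).sq_ζHat_sub_ζ_le (kind := kind) (s := s) i
  filter_upwards [this] with ω hω
  rw [abs_of_nonneg (by positivity)]
  calc _ ≤ (n : ℝ)⁻¹ * ∑ i, 4 * _ := by gcongr with i; exact hω i
    _ = 4 * _ := by
      rw [← Finset.mul_sum, Finset.sum_add_distrib, Finset.sum_add_distrib,
        Finset.sum_add_distrib, ← Finset.mul_sum, ← Finset.mul_sum]
      rw [show ∀ a b c e : ℝ, (n : ℝ)⁻¹ * (4 * (1 / pmin ^ 2 * a + 1 / pmin ^ 2 * b + c + e)) =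
        4 * (1 / pmin ^ 2 * ((n : ℝ)⁻¹ * a) + 1 / pmin ^ 2 * ((n : ℝ)⁻¹ * b) + (n : ℝ)⁻¹ * c +
          (n : ℝ)⁻¹ * e) from fun a b c e => by ring]
    _ ≤ _ := by gcongr; exact le_abs_self _

end Asymptotics

end NetCausal
end

noncomputable section

namespace NetCausal

/-! ### Asymptotic normality with the true variance -/

section Normality

variable {Ω : ℕ → Type*} [∀ n, MeasurableSpace (Ω n)] {P : ∀ n, Measure (Ω n)}
  {d K : ℕ} {wOut : Bool → ℕ → ℕ} {wProp : ℕ → ℕ}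
  {S : ∀ n, Study (Ω n) d K n wOut wProp} {kind : OutcomeKind} {act : ℝ → ℝ}
  {𝒳 : Set (Fin d → ℝ)} {zbar : ℝ} {s : LocalInfo d (K + 1) → Bool} {pmin cy : ℝ} {π : ℕ → ℝ}

lemma eventually_lt_of_ofReal_lt_liminf {x : ℕ → ℝ} {c : ℝ} (hc : 0 < c)
    (h : ENNReal.ofReal c < liminf (fun n => ENNReal.ofReal (x n)) atTop) :
    ∀ᶠ n in atTop, c < x n := by
  filter_upwards [eventually_lt_of_lt_liminf h] with n hn
  exact (ENNReal.ofReal_lt_ofReal_iff_of_nonneg hc.le).1 hn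

lemma AssumptionII.exists_sigmaN_gt (h : AssumptionII P S kind act s) :
    ∃ c : ℝ, 0 < c ∧ ∀ᶠ n in atTop, c < (S n).sigmaN (P n) s := by
  obtain ⟨c, hc, hl⟩ := h.nondegenerate
  exact ⟨c, hc, eventually_lt_of_ofReal_lt_liminf hc hl⟩

lemma Study.mul_sigmaN {Ω : Type*} [MeasurableSpace Ω] {n : ℕ}
    (S : Study Ω d K n wOut wProp) (P : Measure Ω) :
    (n : ℝ) * S.sigmaN P s = Var[fun ω => ∑ i, S.ζ P s i ω; P] := by
  rw [Study.sigmaN, variance_const_mul, inv_pow, Real.sq_sqrt (by positivity)]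
  rcases Nat.eq_zero_or_pos n with rfl | hn
  · simp only [Finset.univ_eq_empty, Finset.sum_empty]
    rw [show (fun _ : Ω => (0 : ℝ)) = 0 from rfl, variance_zero, mul_zero, mul_zero]
  · have : (n : ℝ) ≠ 0 := by exact_mod_cast hn.ne'
    field_simp

variable [∀ n, IsProbabilityMeasure (P n)]

lemma integral_sum_ζ (hreg : ∀ n, (S n).Regular (P n) act pmin cy) (hs : Measurable s)
    (hπ : ∀ n (i : Fin n), π n = (S n).policyValue (P n) s i) (n : ℕ) :
    ∫ ω, ∑ i, (S n).ζ (P n) s i ω ∂P n = n * π n := by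
  rw [integral_finsetSum _ fun i _ => ((hreg n).memLp_ζ hs i).integrable (by norm_num)]
  rw [Finset.sum_congr rfl fun i _ => ((hreg n).integral_ζ hs i).trans (hπ n i).symm]
  simp

/-- The standardized mean of the influence functions. -/
def standardizedMean {Ω : Type*} [MeasurableSpace Ω] {d K n : ℕ} {wOut : Bool → ℕ → ℕ}
    {wProp : ℕ → ℕ} (S : Study Ω d K n wOut wProp) (P : Measure Ω)
    (s : LocalInfo d (K + 1) → Bool) (ω : Ω) : ℝ :=
  (√((n : ℝ) * S.sigmaN P s))⁻¹ * (∑ i, S.ζ P s i ω - ∫ ω', ∑ i, S.ζ P s i ω' ∂P)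

lemma measurable_standardizedMean {Ω : Type*} [MeasurableSpace Ω] {n : ℕ}
    (S : Study Ω d K n wOut wProp) (P : Measure Ω) (hs : Measurable s) :
    Measurable (standardizedMean S P s) := by
  have := S.measurable_ζ (P := P) hs
  unfold standardizedMean
  fun_prop

/-- The dependency graph is given for the observations, and the influence function is only almost
surely a function of its own observation. The limit theorem is applied to the versions `g n i ∘ υ`,
which changes neither variances, tails nor laws. -/
lemma tendsto_charFun_standardizedMean (h : AssumptionII P S kind act s) (hs : Measurable s)
    (hreg : ∀ n, (S n).Regular (P n) act pmin cy) (t : ℝ) :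
    Tendsto (fun n => charFun ((P n).map (standardizedMean (S n) (P n) s)) t) atTop
      (𝓝 (Complex.exp (-t ^ 2 / 2))) := by
  obtain ⟨G, hG, a, m, hm, htail, hrate⟩ := h.dependency
  choose g hg hge using fun n i => (hreg n).exists_ζ_eq_comp_υ hs i
  obtain ⟨c, hc, hσ⟩ := h.exists_sigmaN_gt
  have hall : ∀ n, ∀ᵐ ω ∂P n, ∀ i, (S n).ζ (P n) s i ω = g n i ((S n).υ i ω) := fun n =>
    ae_all_iff.2 fun i => hge n i
  have hsum : ∀ n, (fun ω => ∑ i, (S n).ζ (P n) s i ω) =ᵐ[P n]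
      fun ω => ∑ i, g n i ((S n).υ i ω) := fun n => by
    filter_upwards [hall n] with ω hω
    exact Finset.sum_congr rfl fun i _ => hω i
  have key := tendsto_charFun_of_isDependencyGraph P (fun n i ω => g n i ((S n).υ i ω))
    (fun n i => (hg n i).comp ((S n).measurable_υ i))
    (fun n i => ((hreg n).memLp_ζ hs i).ae_eq (hge n i)) G (fun n => (hG n).comp (hg n))
    (fun n => (n : ℝ) * (S n).sigmaN (P n) s)
    (fun n => by rw [Study.mul_sigmaN]; exact variance_congr (hsum n))
    (by
      filter_upwards [hσ, eventually_ge_atTop 1] with n hn h1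
      have : (0 : ℝ) < n := by exact_mod_cast h1
      exact mul_pos this (hc.trans hn)) a m hm
    (by
      refine htail.congr fun n => ?_
      congr 2
      refine Finset.sum_congr rfl fun i _ => integral_congr_ae ?_
      filter_upwards [hge n i] with ω hω
      simp only [Set.indicator_apply, Set.mem_ofPred_eq, hω]) hrate t
  refine key.congr fun n => ?_
  congr 1
  refine Measure.map_congr ?_
  filter_upwards [hsum n] with ω hω
  rw [standardizedMean, hω, integral_congr_ae (hsum n)]

/-- The studentized error of the estimator, with the true variance. -/
lemma isOpOne_sub_standardizedMean (h : AssumptionII P S kind act s)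
    (hset : ∀ n, (S n).Setup (P n) kind act 𝒳 zbar) (hs : Measurable s)
    (hreg : ∀ n, (S n).Regular (P n) act pmin cy)
    (hπ : ∀ n (i : Fin n), π n = (S n).policyValue (P n) s i) :
    IsOpOne P fun n ω => (√((S n).sigmaN (P n) s))⁻¹ *
      (√(n : ℝ) * ((S n).piHat kind act s ω - π n)) - standardizedMean (S n) (P n) s ω := by
  obtain ⟨c, hc, hσ⟩ := h.exists_sigmaN_gt
  refine (isOpOne_piHat_sub h hset hs hreg).of_abs_le_mul (√c)⁻¹ ?_
  filter_upwards [hσ, eventually_ge_atTop 1] with n hn h1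
  refine ae_of_all _ fun ω => ?_
  have hn0 : (0 : ℝ) < n := by exact_mod_cast h1
  have e : (√((S n).sigmaN (P n) s))⁻¹ * (√(n : ℝ) * ((S n).piHat kind act s ω - π n)) -
      standardizedMean (S n) (P n) s ω = (√((S n).sigmaN (P n) s))⁻¹ * (√(n : ℝ) *
        ((S n).piHat kind act s ω - (n : ℝ)⁻¹ * ∑ i, (S n).ζ (P n) s i ω)) := by
    rw [standardizedMean, integral_sum_ζ hreg hs hπ, Real.sqrt_mul hn0.le, mul_inv]
    have hsq : √(n : ℝ) ≠ 0 := (Real.sqrt_pos.2 hn0).ne'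
    have hsq2 : (√(n : ℝ))⁻¹ = √(n : ℝ) * (n : ℝ)⁻¹ := by
      rw [eq_mul_inv_iff_mul_eq₀ hn0.ne', inv_mul_eq_iff_eq_mul₀ hsq, Real.mul_self_sqrt hn0.le]
    rw [hsq2]
    field_simp
    ring
  rw [e, abs_mul, abs_of_nonneg (inv_nonneg.2 (Real.sqrt_nonneg _))]
  gcongr

/-- By standardization the second moment is `1`, so the first absolute moment is at most `2`. -/
lemma isBigOpOne_standardizedMean (h : AssumptionII P S kind act s) (hs : Measurable s)
    (hreg : ∀ n, (S n).Regular (P n) act pmin cy) :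
    IsBigOpOne P fun n ω => standardizedMean (S n) (P n) s ω := by
  obtain ⟨c, hc, hσ⟩ := h.exists_sigmaN_gt
  have hL : ∀ n, MemLp (fun ω => ∑ i, (S n).ζ (P n) s i ω) 2 (P n) := fun n =>
    memLp_finsetSum _ fun i _ => (hreg n).memLp_ζ hs i
  have hL2 : ∀ n, MemLp (standardizedMean (S n) (P n) s) 2 (P n) := fun n =>
    ((hL n).sub (memLp_const _)).const_mul _
  refine isBigOpOne_of_integral_abs_le (B := 1 + 1)
    (Eventually.of_forall fun n => (hL2 n).integrable (by norm_num)) ?_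
  filter_upwards [hσ, eventually_ge_atTop 1] with n hn h1
  have hn0 : (0 : ℝ) < n := by exact_mod_cast h1
  have hpos : 0 < (n : ℝ) * (S n).sigmaN (P n) s := mul_pos hn0 (hc.trans hn)
  have hone : ∫ ω, standardizedMean (S n) (P n) s ω ^ 2 ∂P n = 1 := by
    simp only [standardizedMean, mul_pow]
    rw [integral_const_mul, inv_pow, Real.sq_sqrt hpos.le,
      ← variance_eq_integral (hL n).aemeasurable, ← Study.mul_sigmaN, inv_mul_cancel₀ hpos.ne']
  calc ∫ ω, |standardizedMean (S n) (P n) s ω| ∂P n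
      ≤ ∫ ω, (1 + standardizedMean (S n) (P n) s ω ^ 2) ∂P n := by
        refine integral_mono ((hL2 n).integrable (by norm_num)).abs
          ((integrable_const _).add (hL2 n).integrable_sq) fun ω => ?_
        simp only
        rw [← sq_abs]
        nlinarith [sq_nonneg (|standardizedMean (S n) (P n) s ω| - 1)]
    _ = 1 + 1 := by
        rw [integral_add (integrable_const _) (hL2 n).integrable_sq, hone]
        simp

/-- Slutsky's theorem for a ratio-consistent variance estimator. -/
theorem tendstoInDistribution_of_ratio (h : AssumptionII P S kind act s)
    (hset : ∀ n, (S n).Setup (P n) kind act 𝒳 zbar) (hs : Measurable s)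
    (hreg : ∀ n, (S n).Regular (P n) act pmin cy)
    (hπ : ∀ n (i : Fin n), π n = (S n).policyValue (P n) s i) (V : ∀ n, Ω n → ℝ)
    (hV : ∀ n, Measurable (V n))
    (hratio : IsOpOne P fun n ω => V n ω / (S n).sigmaN (P n) s - 1) :
    TendstoInDistribution (fun n ω => (√(V n ω))⁻¹ *
      (√(n : ℝ) * ((S n).piHat kind act s ω - π n))) atTop id P (gaussianReal 0 1) := by
  obtain ⟨c, hc, hσ⟩ := h.exists_sigmaN_gt
  have hpi := fun n => (hset n).measurable_piHat hs
  have hYm : ∀ n, AEMeasurable (fun ω => (√(V n ω))⁻¹ *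
      (√(n : ℝ) * ((S n).piHat kind act s ω - π n))) (P n) := fun n => by
    have h1 := hpi n
    have h2 := hV n
    exact Measurable.aemeasurable (by fun_prop)
  refine tendstoInDistribution_gaussian_of_charFun hYm fun t => ?_
  have h1 := isOpOne_sub_standardizedMean h hset hs hreg hπ
  have hbig : IsBigOpOne P fun n ω => (√((S n).sigmaN (P n) s))⁻¹ *
      (√(n : ℝ) * ((S n).piHat kind act s ω - π n)) := by
    have := h1.isBigOpOne.add (isBigOpOne_standardizedMean h hs hreg)
    simpa only [sub_add_cancel] using this
  have hr : IsOpOne P fun n ω => √((S n).sigmaN (P n) s) * (√(V n ω))⁻¹ - 1 := by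
    -- With `x = V / Σ_n`, closeness within `1 / 2` gives `√x ≥ 1 / 2`, hence `|(√x)⁻¹ - 1| = |1 -
    -- x| / (√x (1 + √x)) ≤ 2 |1 - x|`; this explains `ε / 2`.
    refine hratio.of_imp fun ε hε => ⟨min (1 / 2) (ε / 2), by positivity, ?_⟩
    filter_upwards [hσ] with n hn
    refine ae_of_all _ fun ω hω => ?_
    have hσ0 : 0 < (S n).sigmaN (P n) s := hc.trans hn
    set x := V n ω / (S n).sigmaN (P n) s with hx
    have hx1 := hω.trans_le (min_le_left _ _)
    have hx2 := hω.trans_le (min_le_right _ _)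
    rw [abs_lt] at hx1
    have hsx : (1 : ℝ) / 2 ≤ √x := Real.le_sqrt_of_sq_le (by linarith)
    have e : √((S n).sigmaN (P n) s) * (√(V n ω))⁻¹ = (√x)⁻¹ := by
      rw [hx, Real.sqrt_div' _ hσ0.le, inv_div, div_eq_mul_inv]
    rw [e]
    have h3 : (√x)⁻¹ - 1 = (1 - x) / (√x * (1 + √x)) := by
      have h4 := Real.sq_sqrt (show 0 ≤ x by linarith)
      have : √x ≠ 0 := by positivity
      field_simp
      nlinarith
    rw [h3, abs_div, abs_of_pos (show 0 < √x * (1 + √x) by positivity), abs_sub_comm,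
      div_lt_iff₀ (by positivity)]
    have h4 : (1 : ℝ) / 2 ≤ √x * (1 + √x) := by nlinarith
    nlinarith
  have hdiff : IsOpOne P fun n ω => (√(V n ω))⁻¹ *
      (√(n : ℝ) * ((S n).piHat kind act s ω - π n)) - standardizedMean (S n) (P n) s ω := by
    have h2 := (hr.mul_isBigOpOne hbig).add h1
    refine h2.of_abs_le_mul 1 ?_
    filter_upwards [hσ] with n hn
    refine ae_of_all _ fun ω => le_of_eq ?_
    have hσ0 : √((S n).sigmaN (P n) s) ≠ 0 := (Real.sqrt_pos.2 (hc.trans hn)).ne'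
    rw [one_mul]
    congr 1
    field_simp
    ring
  exact tendsto_charFun_of_isOpOne_sub
    (fun n => (measurable_standardizedMean (S n) (P n) hs).aemeasurable) hYm hdiff
    (tendsto_charFun_standardizedMean h hs hreg t)

end Normality

/-! ### A weak law of large numbers for independent uniformly integrable arrays -/

lemma integral_abs_le_sqrt_integral_sq {Ω : Type*} [MeasurableSpace Ω] {P : Measure Ω}
    [IsProbabilityMeasure P] {X : Ω → ℝ} (hX : MemLp X 2 P) :
    ∫ ω, |X ω| ∂P ≤ √(∫ ω, X ω ^ 2 ∂P) := by
  refine Real.le_sqrt_of_sq_le ?_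
  have h := variance_nonneg (fun ω => |X ω|) P
  rw [variance_eq_sub (show MemLp (fun ω => |X ω|) 2 P from hX.abs)] at h
  simp only [Pi.pow_apply, sq_abs] at h
  linarith

/-- Capping at `B` splits the mean. The capped part is treated by independence, with variance at
most `B²` for each term; the excess is bounded in mean by `ε`, and its centring doubles this. -/
lemma integral_abs_mean_sub_le {Ω ι : Type*} [MeasurableSpace Ω] {P : Measure Ω}
    [IsProbabilityMeasure P] [Fintype ι] {Q : ι → Ω → ℝ} (hQ0 : ∀ c ω, 0 ≤ Q c ω)
    (hQ : ∀ c, Integrable (Q c) P) (hind : iIndepFun Q P) {B ε : ℝ} (hB : 0 ≤ B)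
    (htail : ∀ c, ∫ ω, (Q c ω - min (Q c ω) B) ∂P ≤ ε) (hcard : 0 < Fintype.card ι) :
    ∫ ω, |(Fintype.card ι : ℝ)⁻¹ * ∑ c, (Q c ω - ∫ ω', Q c ω' ∂P)| ∂P ≤
      B / √(Fintype.card ι) + 2 * ε := by
  set N : ℝ := ((Fintype.card ι : ℕ) : ℝ) with hN
  have hN0 : 0 < N := Nat.cast_pos.2 hcard
  set R : ι → Ω → ℝ := fun c ω => min (Q c ω) B with hR
  have hRb : ∀ c ω, |R c ω| ≤ B := fun c ω => by
    rw [abs_of_nonneg (le_min (hQ0 c ω) hB)]; exact min_le_right _ _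
  have hRm : ∀ c, AEStronglyMeasurable (R c) P := fun c =>
    ((hQ c).aemeasurable.min aemeasurable_const).aestronglyMeasurable
  have hR2 : ∀ c, MemLp (R c) 2 P := fun c => MemLp.of_bound (hRm c) B (ae_of_all _ (hRb c))
  have hRi : ∀ c, Integrable (R c) P := fun c => (hR2 c).integrable (by norm_num)
  have hRind : iIndepFun R P := hind.comp (fun _ x => min x B) fun _ => by fun_prop
  have hvar : ∫ ω, (∑ c, (R c ω - ∫ ω', R c ω' ∂P)) ^ 2 ∂P ≤ N * B ^ 2 := by
    have e : ∫ ω, (∑ c, (R c ω - ∫ ω', R c ω' ∂P)) ^ 2 ∂P = Var[∑ c, R c; P] := by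
      rw [variance_eq_integral (by
        have := hRm; exact (Finset.aestronglyMeasurable_sum _ fun c _ => hRm c).aemeasurable)]
      simp only [Finset.sum_apply]
      rw [integral_finsetSum _ fun c _ => hRi c]
      simp only [Finset.sum_sub_distrib]
    rw [e, IndepFun.variance_sum (fun c _ => hR2 c) fun c _ c' _ hcc => hRind.indepFun hcc]
    calc _ ≤ ∑ _c : ι, B ^ 2 := by
          refine Finset.sum_le_sum fun c _ => ?_
          refine (variance_le_expectation_sq (hRm c)).trans ?_
          have : ∫ ω, (R c ^ 2) ω ∂P ≤ ∫ _ω, B ^ 2 ∂P := by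
            refine integral_mono (hR2 c).integrable_sq (integrable_const _) fun ω => ?_
            simp only [Pi.pow_apply]
            rw [← sq_abs]
            exact pow_le_pow_left₀ (abs_nonneg _) (hRb c ω) 2
          simpa using this
      _ = N * B ^ 2 := by simp [hN]
  have hL1 : ∫ ω, |∑ c, (R c ω - ∫ ω', R c ω' ∂P)| ∂P ≤ √N * B := by
    refine (integral_abs_le_sqrt_integral_sq
      (memLp_finsetSum _ fun c _ => (hR2 c).sub (memLp_const _))).trans ?_
    calc _ ≤ √(N * B ^ 2) := Real.sqrt_le_sqrt hvar
      _ = √N * B := by rw [Real.sqrt_mul hN0.le, Real.sqrt_sq hB]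
  have hDi : ∀ c, Integrable (fun ω => Q c ω - R c ω) P := fun c => (hQ c).sub (hRi c)
  have hD0 : ∀ c ω, 0 ≤ Q c ω - R c ω := fun c ω => sub_nonneg.2 (min_le_left _ _)
  have hpt : ∀ ω, |N⁻¹ * ∑ c, (Q c ω - ∫ ω', Q c ω' ∂P)| ≤
      N⁻¹ * |∑ c, (R c ω - ∫ ω', R c ω' ∂P)| +
        N⁻¹ * ∑ c, ((Q c ω - R c ω) + ∫ ω', (Q c ω' - R c ω') ∂P) := by
    intro ω
    have e : ∑ c, (Q c ω - ∫ ω', Q c ω' ∂P) = ∑ c, (R c ω - ∫ ω', R c ω' ∂P) +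
        ∑ c, ((Q c ω - R c ω) - ∫ ω', (Q c ω' - R c ω') ∂P) := by
      rw [← Finset.sum_add_distrib]
      refine Finset.sum_congr rfl fun c _ => ?_
      rw [integral_sub (hQ c) (hRi c)]
      ring
    rw [e, abs_mul, abs_of_pos (inv_pos.2 hN0), ← mul_add]
    gcongr
    refine (abs_add_le _ _).trans ?_
    gcongr
    refine (Finset.abs_sum_le_sum_abs _ _).trans (Finset.sum_le_sum fun c _ => ?_)
    refine (abs_sub _ _).trans (le_of_eq ?_)
    rw [abs_of_nonneg (hD0 c ω), abs_of_nonneg (integral_nonneg fun ω' => hD0 c ω')]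
  have hi1 : Integrable (fun ω => N⁻¹ * |∑ c, (R c ω - ∫ ω', R c ω' ∂P)|) P :=
    (integrable_finsetSum _ fun c _ => (hRi c).sub (integrable_const _)).abs.const_mul _
  have hi2' : ∀ c, Integrable
      (fun ω => (Q c ω - R c ω) + ∫ ω', (Q c ω' - R c ω') ∂P) P := fun c =>
    (hDi c).add (integrable_const _)
  have hi2 : Integrable (fun ω => N⁻¹ *
      ∑ c, ((Q c ω - R c ω) + ∫ ω', (Q c ω' - R c ω') ∂P)) P :=
    (integrable_finsetSum _ fun c _ => hi2' c).const_mul _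
  calc _ ≤ ∫ ω, (N⁻¹ * |∑ c, (R c ω - ∫ ω', R c ω' ∂P)| +
        N⁻¹ * ∑ c, ((Q c ω - R c ω) + ∫ ω', (Q c ω' - R c ω') ∂P)) ∂P :=
        integral_mono ((integrable_finsetSum _ fun c _ =>
          (hQ c).sub (integrable_const _)).const_mul _).abs (hi1.add hi2) hpt
    _ = N⁻¹ * ∫ ω, |∑ c, (R c ω - ∫ ω', R c ω' ∂P)| ∂P +
        N⁻¹ * ∑ c, 2 * ∫ ω', (Q c ω' - R c ω') ∂P := by
        rw [integral_add hi1 hi2, integral_const_mul, integral_const_mul,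
          integral_finsetSum _ fun c _ => hi2' c]
        congr 2
        refine Finset.sum_congr rfl fun c _ => ?_
        rw [integral_add (hDi c) (integrable_const _), integral_const]
        simp
        ring
    _ ≤ N⁻¹ * (√N * B) + N⁻¹ * ∑ _c : ι, 2 * ε := by
        gcongr with c
        exact htail c
    _ = B / √N + 2 * ε := by
        have e1 : N⁻¹ * (√N * B) = B / √N := by
          have := Real.mul_self_sqrt hN0.le
          have h0 : √N ≠ 0 := (Real.sqrt_pos.2 hN0).ne'
          field_simp
          nlinarith
        rw [e1, Finset.sum_const, Finset.card_univ, nsmul_eq_mul, ← hN]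
        congr 1
        field_simp

/-- A weak law of large numbers for row-wise independent, uniformly integrable arrays. -/
theorem isOpOne_mean_sub_of_tail {Ω : ℕ → Type*} [∀ n, MeasurableSpace (Ω n)]
    {P : ∀ n, Measure (Ω n)} [∀ n, IsProbabilityMeasure (P n)] {k : ℕ → ℕ}
    (hk : Tendsto k atTop atTop) {Q : ∀ n, Fin (k n) → Ω n → ℝ} (hQ0 : ∀ n c ω, 0 ≤ Q n c ω)
    (hQ : ∀ n c, Integrable (Q n c) (P n)) (hind : ∀ n, iIndepFun (Q n) (P n))
    (htail : ∀ ε : ℝ, 0 < ε → ∃ B : ℝ, 0 ≤ B ∧ ∀ᶠ n in atTop, ∀ c,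
      ∫ ω, (Q n c ω - min (Q n c ω) B) ∂P n ≤ ε) :
    IsOpOne P fun n ω => (k n : ℝ)⁻¹ * ∑ c, (Q n c ω - ∫ ω', Q n c ω' ∂P n) := by
  have hint : ∀ n, Integrable
      (fun ω => (k n : ℝ)⁻¹ * ∑ c, (Q n c ω - ∫ ω', Q n c ω' ∂P n)) (P n) := fun n =>
    (integrable_finsetSum _ fun c _ => (hQ n c).sub (integrable_const _)).const_mul _
  refine isOpOne_of_integral_abs_le (Eventually.of_forall hint)
    (Eventually.of_forall fun n => le_rfl) ?_
  refine tendsto_order.2 ⟨fun a ha => Eventually.of_forall fun n =>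
    ha.trans_le (integral_nonneg fun ω => abs_nonneg _), fun a ha => ?_⟩
  obtain ⟨B, hB, hev⟩ := htail (a / 4) (by positivity)
  have hlim : Tendsto (fun n => B / √(k n : ℝ) + 2 * (a / 4)) atTop (𝓝 (0 + 2 * (a / 4))) := by
    refine Tendsto.add ?_ tendsto_const_nhds
    exact tendsto_const_nhds.div_atTop
      (Real.tendsto_sqrt_atTop.comp (tendsto_natCast_atTop_atTop.comp hk))
  filter_upwards [hev, hk.eventually_ge_atTop 1, hlim.eventually_lt_const (u := a) (by linarith)]
    with n h1 h2 h3
  have := integral_abs_mean_sub_le (hQ0 n) (hQ n) (hind n) hB h1 (by rw [Fintype.card_fin]; omega)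
  rw [Fintype.card_fin] at this
  exact this.trans_lt h3

end NetCausal
end

noncomputable section

namespace NetCausal

/-! ### Moments of the cluster sums -/

section Moments

variable {Ω : Type*} [MeasurableSpace Ω] {P : Measure Ω}

lemma integral_abs_rpow_le_of_eLpNorm_le {X : Ω → ℝ} {q M : ℝ} (hq : 0 < q) (hM : 0 ≤ M)
    (hX : AEStronglyMeasurable X P)
    (h : eLpNorm X (ENNReal.ofReal q) P ≤ ENNReal.ofReal M) :
    Integrable (fun ω => |X ω| ^ q) P ∧ ∫ ω, |X ω| ^ q ∂P ≤ M ^ q := by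
  have hL : MemLp X (ENNReal.ofReal q) P := ⟨hX, h.trans_lt ENNReal.ofReal_lt_top⟩
  have h0 : ENNReal.ofReal q ≠ 0 := (ENNReal.ofReal_pos.2 hq).ne'
  have hi := hL.integrable_norm_rpow h0 ENNReal.ofReal_ne_top
  rw [hL.eLpNorm_eq_integral_rpow_norm h0 ENNReal.ofReal_ne_top] at h
  rw [ENNReal.toReal_ofReal hq.le] at hi h
  simp only [Real.norm_eq_abs] at hi h
  refine ⟨hi, ?_⟩
  rwa [ENNReal.ofReal_le_ofReal_iff hM, Real.rpow_inv_le_iff_of_pos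
    (integral_nonneg fun ω => by positivity) hM hq] at h

lemma integral_sq_le_of_eLpNorm_le [IsProbabilityMeasure P] {X : Ω → ℝ} {δ M : ℝ} (hδ : 0 < δ)
    (hM : 0 ≤ M) (hX : AEStronglyMeasurable X P)
    (h : eLpNorm X (ENNReal.ofReal (2 + δ)) P ≤ ENNReal.ofReal M) :
    ∫ ω, X ω ^ 2 ∂P ≤ M ^ 2 := by
  have h2 : eLpNorm X (ENNReal.ofReal 2) P ≤ ENNReal.ofReal M :=
    (eLpNorm_le_eLpNorm_of_exponent_le (ENNReal.ofReal_le_ofReal (by linarith)) hX).trans h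
  simpa only [Real.rpow_two, sq_abs] using
    (integral_abs_rpow_le_of_eLpNorm_le two_pos hM hX h2).2

/-- Where `X² > B`, one has `X² ≤ |X| ^ (2 + δ) / B ^ (δ / 2)`. This is the uniform integrability
required for squared cluster sums. -/
lemma integral_sq_sub_min_le {X : Ω → ℝ} {δ M B : ℝ} (hδ : 0 < δ)
    (hM : 0 ≤ M) (hB : 0 < B) (hX : AEStronglyMeasurable X P)
    (h : eLpNorm X (ENNReal.ofReal (2 + δ)) P ≤ ENNReal.ofReal M) :
    ∫ ω, (X ω ^ 2 - min (X ω ^ 2) B) ∂P ≤ M ^ (2 + δ) / B ^ (δ / 2) := by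
  obtain ⟨hi, hle⟩ := integral_abs_rpow_le_of_eLpNorm_le (by linarith) hM hX h
  have hBp : 0 < B ^ (δ / 2) := Real.rpow_pos_of_pos hB _
  calc ∫ ω, (X ω ^ 2 - min (X ω ^ 2) B) ∂P ≤ ∫ ω, |X ω| ^ (2 + δ) / B ^ (δ / 2) ∂P := by
        refine integral_mono_of_nonneg (ae_of_all _ fun ω => sub_nonneg.2 (min_le_left _ _))
          (hi.div_const _) (ae_of_all _ fun ω => ?_)
        simp only
        rcases le_or_gt (X ω ^ 2) B with h1 | h1
        · rw [min_eq_left h1, sub_self]; positivity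
        · have hx : 0 < |X ω| := abs_pos.2 fun h0 => by rw [h0] at h1; norm_num at h1; linarith
          rw [le_div_iff₀ hBp]
          calc (X ω ^ 2 - min (X ω ^ 2) B) * B ^ (δ / 2)
              ≤ X ω ^ 2 * (X ω ^ 2) ^ (δ / 2) := by
                gcongr
                rw [min_eq_right h1.le]
                linarith
            _ = |X ω| ^ (2 + δ) := by
                rw [← sq_abs, ← Real.rpow_two, ← Real.rpow_mul hx.le, ← Real.rpow_add hx]
                congr 1
                ring
    _ ≤ M ^ (2 + δ) / B ^ (δ / 2) := by
        rw [integral_div]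
        gcongr

lemma eLpNorm_le_of_lintegral_rpow_le {X : Ω → ℝ} {q c : ℝ} (hq : 0 < q) (hc : 0 ≤ c)
    (h : ∫⁻ ω, ENNReal.ofReal (|X ω| ^ q) ∂P ≤ ENNReal.ofReal c) :
    eLpNorm X (ENNReal.ofReal q) P ≤ ENNReal.ofReal (c ^ (1 / q)) := by
  rw [eLpNorm_eq_lintegral_rpow_enorm_toReal (ENNReal.ofReal_pos.2 hq).ne' ENNReal.ofReal_ne_top,
    ENNReal.toReal_ofReal hq.le, ← ENNReal.ofReal_rpow_of_nonneg hc (by positivity)]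
  refine ENNReal.rpow_le_rpow ?_ (by positivity)
  refine le_trans (le_of_eq (lintegral_congr fun ω => ?_)) h
  rw [Real.enorm_eq_ofReal_abs, ENNReal.ofReal_rpow_of_nonneg (abs_nonneg _) hq.le]

lemma eLpNorm_sub_integral_le [IsProbabilityMeasure P] {X : Ω → ℝ} {q : ENNReal} (hq : 1 ≤ q)
    (hX : AEStronglyMeasurable X P) :
    eLpNorm (fun ω => X ω - ∫ ω', X ω' ∂P) q P ≤ 2 * eLpNorm X q P := by
  refine (eLpNorm_sub_le hX aestronglyMeasurable_const hq).trans ?_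
  rw [two_mul]
  gcongr
  rw [eLpNorm_const _ (by positivity) (IsProbabilityMeasure.ne_zero P), measure_univ,
    ENNReal.one_rpow, mul_one]
  refine (enorm_integral_le_lintegral_enorm _).trans ?_
  rw [← eLpNorm_one_eq_lintegral_enorm]
  exact eLpNorm_le_eLpNorm_of_exponent_le hq hX

variable {d K n : ℕ} {wOut : Bool → ℕ → ℕ} {wProp : ℕ → ℕ}
  {S : Study Ω d K n wOut wProp} {act : ℝ → ℝ} {s : LocalInfo d (K + 1) → Bool} {pmin cy : ℝ}

lemma Study.Regular.eLpNorm_ζ_sub_le [IsProbabilityMeasure P] (h : S.Regular P act pmin cy)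
    (hs : Measurable s) {δ c : ℝ} (hδ : 0 < δ) (hc : 0 ≤ c) (i : Fin n)
    (hm : ∀ t, ∫⁻ ω, ENNReal.ofReal (|S.pot t i ω| ^ (2 + δ)) ∂P ≤ ENNReal.ofReal c) :
    eLpNorm (fun ω => S.ζ P s i ω - S.policyValue P s i) (ENNReal.ofReal (2 + δ)) P ≤
      ENNReal.ofReal (2 * (2 / pmin * (1 + √cy) * (1 + 2 * c ^ (1 / (2 + δ))))) := by
  have hpos := h.pmin_pos
  have hq1 : 1 ≤ ENNReal.ofReal (2 + δ) := ENNReal.one_le_ofReal.2 (by linarith)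
  have hpot : ∀ t, eLpNorm (fun ω => |S.pot t i ω|) (ENNReal.ofReal (2 + δ)) P ≤
      ENNReal.ofReal (c ^ (1 / (2 + δ))) := fun t =>
    (eLpNorm_norm (S.pot t i)).le.trans
      (eLpNorm_le_of_lintegral_rpow_le (by linarith) hc (hm t))
  have hmeas : ∀ t, AEStronglyMeasurable (fun ω => |S.pot t i ω|) P := fun t =>
    (continuous_abs.measurable.comp (S.measurable_pot t i)).aestronglyMeasurable
  have hdom : eLpNorm (S.ζ P s i) (ENNReal.ofReal (2 + δ)) P ≤
      ENNReal.ofReal (2 / pmin * (1 + √cy) * (1 + 2 * c ^ (1 / (2 + δ)))) := by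
    calc _ ≤ eLpNorm ((2 / pmin * (1 + √cy)) •
          ((fun _ => (1 : ℝ)) + (fun ω => |S.pot true i ω|) + fun ω => |S.pot false i ω|))
          (ENNReal.ofReal (2 + δ)) P := eLpNorm_mono_ae_real (h.abs_ζ_le i)
      _ ≤ ENNReal.ofReal (2 / pmin * (1 + √cy)) * (1 + ENNReal.ofReal (c ^ (1 / (2 + δ))) +
          ENNReal.ofReal (c ^ (1 / (2 + δ)))) := by
        rw [eLpNorm_const_smul, Real.enorm_eq_ofReal_abs, abs_of_nonneg (by positivity)]
        gcongr
        refine (eLpNorm_add_le (aestronglyMeasurable_const.add (hmeas true)) (hmeas false)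
          hq1).trans (add_le_add ?_ (hpot false))
        refine (eLpNorm_add_le aestronglyMeasurable_const (hmeas true) hq1).trans
          (add_le_add (le_of_eq ?_) (hpot true))
        rw [eLpNorm_const _ (by positivity) (IsProbabilityMeasure.ne_zero P), measure_univ]
        simp
      _ = _ := by
        rw [← ENNReal.ofReal_one, ← ENNReal.ofReal_add (by positivity) (by positivity),
          ← ENNReal.ofReal_add (by positivity) (by positivity),
          ← ENNReal.ofReal_mul (by positivity)]
        congr 1
        ring
  rw [← h.integral_ζ hs i, ENNReal.ofReal_mul zero_le_two, ENNReal.ofReal_ofNat]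
  exact (eLpNorm_sub_integral_le hq1 (S.measurable_ζ hs i).aestronglyMeasurable).trans (by gcongr)

end Moments

end NetCausal
end

noncomputable section

namespace NetCausal

/-! ### Cluster sums -/

/-- The sum of `v` over cluster `c`, normalized by the average cluster size. -/
def clusterSum {n k : ℕ} (cl : Fin n → Fin k) (v : Fin n → ℝ) (c : Fin k) : ℝ :=
  ((n : ℝ) / k)⁻¹ * ∑ i ∈ Finset.univ.filter (fun i => cl i = c), v i

section Deterministic

variable {n k : ℕ} {cl : Fin n → Fin k}

lemma clusterSum_add (v w : Fin n → ℝ) (c : Fin k) :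
    clusterSum cl (fun i => v i + w i) c = clusterSum cl v c + clusterSum cl w c := by
  simp only [clusterSum, Finset.sum_add_distrib, mul_add]

/-- Cauchy–Schwarz inside a cluster costs its size, at most `C n / k`, and the normalization by the
average size absorbs this factor. -/
lemma mean_sq_clusterSum_le {C : ℝ} (hn : 0 < n) (hk : 0 < k)
    (hC : ∀ c, (Study.clusterSize cl c : ℝ) ≤ C * ((n : ℝ) / k)) (v : Fin n → ℝ) :
    (k : ℝ)⁻¹ * ∑ c, clusterSum cl v c ^ 2 ≤ C * ((n : ℝ)⁻¹ * ∑ i, v i ^ 2) := by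
  have hn' : (0 : ℝ) < n := by exact_mod_cast hn
  have hk' : (0 : ℝ) < k := by exact_mod_cast hk
  have h1 : ∀ c, clusterSum cl v c ^ 2 ≤ ((n : ℝ) / k)⁻¹ ^ 2 * (C * ((n : ℝ) / k) *
      ∑ i ∈ Finset.univ.filter (fun i => cl i = c), v i ^ 2) := fun c => by
    rw [clusterSum, mul_pow]
    refine mul_le_mul_of_nonneg_left (sq_sum_le_card_mul_sum_sq.trans ?_) (by positivity)
    exact mul_le_mul_of_nonneg_right (hC c) (Finset.sum_nonneg fun i _ => sq_nonneg _)
  calc _ ≤ (k : ℝ)⁻¹ * ∑ c, ((n : ℝ) / k)⁻¹ ^ 2 * (C * ((n : ℝ) / k) *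
      ∑ i ∈ Finset.univ.filter (fun i => cl i = c), v i ^ 2) := by
        gcongr with c
        exact h1 c
    _ = C * ((n : ℝ)⁻¹ * ∑ i, v i ^ 2) := by
        rw [← Finset.mul_sum, ← Finset.mul_sum, Finset.sum_fiberwise]
        field_simp

/-- Expands the square and applies Cauchy–Schwarz to the cross term: a perturbation `w` that is
small in mean square is harmless when `z` is bounded in mean square. -/
lemma abs_mean_sq_add_sub_le (z w : Fin k → ℝ) :
    |(k : ℝ)⁻¹ * ∑ c, (z c + w c) ^ 2 - (k : ℝ)⁻¹ * ∑ c, z c ^ 2| ≤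
      2 * √(((k : ℝ)⁻¹ * ∑ c, w c ^ 2) * ((k : ℝ)⁻¹ * ∑ c, z c ^ 2)) +
        (k : ℝ)⁻¹ * ∑ c, w c ^ 2 := by
  have e : (k : ℝ)⁻¹ * ∑ c, (z c + w c) ^ 2 - (k : ℝ)⁻¹ * ∑ c, z c ^ 2 =
      2 * ((k : ℝ)⁻¹ * ∑ c, w c * z c) + (k : ℝ)⁻¹ * ∑ c, w c ^ 2 := by
    have : ∑ c, (z c + w c) ^ 2 = ∑ c, z c ^ 2 + 2 * ∑ c, w c * z c + ∑ c, w c ^ 2 := by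
      rw [Finset.mul_sum, ← Finset.sum_add_distrib, ← Finset.sum_add_distrib]
      exact Finset.sum_congr rfl fun c _ => by ring
    rw [this]
    ring
  have h0 : 0 ≤ (k : ℝ)⁻¹ * ∑ c, w c ^ 2 :=
    mul_nonneg (by positivity) (Finset.sum_nonneg fun c _ => sq_nonneg _)
  have h1 : |(k : ℝ)⁻¹ * ∑ c, w c * z c| ≤
      √(((k : ℝ)⁻¹ * ∑ c, w c ^ 2) * ((k : ℝ)⁻¹ * ∑ c, z c ^ 2)) := by
    refine Real.abs_le_sqrt ?_
    have := Finset.sum_mul_sq_le_sq_mul_sq Finset.univ w z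
    calc ((k : ℝ)⁻¹ * ∑ c, w c * z c) ^ 2 = (k : ℝ)⁻¹ ^ 2 * (∑ c, w c * z c) ^ 2 := by ring
      _ ≤ (k : ℝ)⁻¹ ^ 2 * ((∑ c, w c ^ 2) * ∑ c, z c ^ 2) := by gcongr
      _ = _ := by ring
  rw [e]
  refine (abs_add_le _ _).trans ?_
  rw [abs_mul, abs_two, abs_of_nonneg h0]
  gcongr

end Deterministic

section Random

variable {Ω : Type*} [MeasurableSpace Ω] {P : Measure Ω} {d K n : ℕ} {wOut : Bool → ℕ → ℕ}
  {wProp : ℕ → ℕ} {S : Study Ω d K n wOut wProp} {kind : OutcomeKind} {act : ℝ → ℝ}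
  {s : LocalInfo d (K + 1) → Bool} {pmin cy π : ℝ} {k : ℕ} {cl : Fin n → Fin k}

/-- The weight `n_c² k / n` turns deviations of cluster means into squares of normalized cluster
sums. Clusters must be nonempty for a mean times its size to recover the sum. -/
lemma sigmaHat_eq_mean_sq_clusterSum (hn : 0 < n) (hk : 0 < k) (hcl : Function.Surjective cl)
    (ω : Ω) :
    ((n : ℝ) / k)⁻¹ * S.sigmaHat kind act s cl ω =
      (k : ℝ)⁻¹ * ∑ c, clusterSum cl (fun i => S.ζHat kind act s i ω - S.piHat kind act s ω) c ^ 2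
      := by
  have hn' : (n : ℝ) ≠ 0 := by exact_mod_cast hn.ne'
  have hk' : (k : ℝ) ≠ 0 := by exact_mod_cast hk.ne'
  have hsize : ∀ c, (Study.clusterSize cl c : ℝ) ≠ 0 := fun c => by
    obtain ⟨i, hi⟩ := hcl c
    have : 0 < Study.clusterSize cl c :=
      Finset.card_pos.2 ⟨i, Finset.mem_filter.2 ⟨Finset.mem_univ _, hi⟩⟩
    exact_mod_cast this.ne'
  have key : ∀ c, ((Study.clusterSize cl c : ℝ) ^ 2 * ((k : ℝ) / n)) *
      (S.clusterMeanHat kind act s cl c ω - (n : ℝ)⁻¹ * ∑ i, S.ζHat kind act s i ω) ^ 2 =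
      ((n : ℝ) / k) *
        clusterSum cl (fun i => S.ζHat kind act s i ω - S.piHat kind act s ω) c ^ 2 := fun c => by
    have e : ∑ i ∈ Finset.univ.filter (fun i => cl i = c),
        (S.ζHat kind act s i ω - S.piHat kind act s ω) = Study.clusterSize cl c *
          (S.clusterMeanHat kind act s cl c ω - S.piHat kind act s ω) := by
      rw [Finset.sum_sub_distrib, Finset.sum_const, nsmul_eq_mul, mul_sub, Study.clusterMeanHat,
        mul_inv_cancel_left₀ (hsize c)]
      rfl
    rw [clusterSum, e, Study.piHat]
    field_simp
  rw [Study.sigmaHat, Finset.sum_congr rfl fun c _ => key c, ← Finset.mul_sum]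
  field_simp

/-- The centred, normalized cluster sums of the influence functions. -/
def clusterDev (S : Study Ω d K n wOut wProp) (P : Measure Ω) (s : LocalInfo d (K + 1) → Bool)
    (π : ℝ) (cl : Fin n → Fin k) (c : Fin k) (ω : Ω) : ℝ :=
  clusterSum cl (fun i => S.ζ P s i ω - π) c

lemma iIndepFun_clusterDev (h : iIndepFun
      (fun (c : Fin k) ω (i : {i : Fin n // cl i = c}) => S.ζ P s i ω) P) :
    iIndepFun (clusterDev S P s π cl) P := by
  have := h.comp (fun c (v : {i : Fin n // cl i = c} → ℝ) => ((n : ℝ) / k)⁻¹ * ∑ i, (v i - π))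
    fun c => by fun_prop
  convert this using 2 with c
  ext ω
  rw [clusterDev, clusterSum, Finset.sum_subtype (p := fun i => cl i = c) _ (by simp)]
  rfl

lemma measurable_clusterDev (hs : Measurable s) (c : Fin k) :
    Measurable (clusterDev S P s π cl c) := by
  have := S.measurable_ζ (P := P) hs
  unfold clusterDev clusterSum
  fun_prop

/-- Minkowski's inequality: at most `C n / k` summands, divided by `n / k`. -/
lemma eLpNorm_clusterDev_le {q : ENNReal} (hq : 1 ≤ q) (hs : Measurable s) {M C : ℝ}
    (hn : 0 < n) (hk : 0 < k)
    (hC : ∀ c, (Study.clusterSize cl c : ℝ) ≤ C * ((n : ℝ) / k))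
    (hM : ∀ i, eLpNorm (fun ω => S.ζ P s i ω - π) q P ≤ ENNReal.ofReal M) (c : Fin k) :
    eLpNorm (clusterDev S P s π cl c) q P ≤ ENNReal.ofReal (C * M) := by
  have hl : 0 < (n : ℝ) / k := div_pos (by exact_mod_cast hn) (by exact_mod_cast hk)
  have hC0 : 0 ≤ C := by
    have := (Nat.cast_nonneg _).trans (hC c)
    exact nonneg_of_mul_nonneg_left this hl
  have e : clusterDev S P s π cl c = ((n : ℝ) / k)⁻¹ •
      ∑ i ∈ Finset.univ.filter (fun i => cl i = c), fun ω => S.ζ P s i ω - π := by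
    ext ω
    simp [clusterDev, clusterSum]
  have hmeas : ∀ i, AEStronglyMeasurable (fun ω => S.ζ P s i ω - π) P := fun i =>
    ((S.measurable_ζ hs i).sub_const π).aestronglyMeasurable
  rw [e, eLpNorm_const_smul, Real.enorm_eq_ofReal_abs, abs_of_pos (inv_pos.2 hl)]
  calc _ ≤ ENNReal.ofReal ((n : ℝ) / k)⁻¹ *
      ∑ i ∈ Finset.univ.filter (fun i => cl i = c), ENNReal.ofReal M := by
        gcongr
        exact (eLpNorm_sum_le (fun i _ => hmeas i) hq).trans (Finset.sum_le_sum fun i _ => hM i)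
    _ = ENNReal.ofReal ((n : ℝ) / k)⁻¹ * (ENNReal.ofReal (Study.clusterSize cl c) *
          ENNReal.ofReal M) := by
        rw [Finset.sum_const, nsmul_eq_mul, ENNReal.ofReal_natCast]
        rfl
    _ ≤ ENNReal.ofReal ((n : ℝ) / k)⁻¹ * (ENNReal.ofReal (C * ((n : ℝ) / k)) *
          ENNReal.ofReal M) := by
        gcongr
        exact hC c
    _ = ENNReal.ofReal (C * M) := by
        rw [← mul_assoc, ← ENNReal.ofReal_mul (by positivity), ENNReal.ofReal_mul hC0]
        congr 2
        field_simp

variable [IsProbabilityMeasure P]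

lemma memLp_clusterDev (h : S.Regular P act pmin cy) (hs : Measurable s) (c : Fin k) :
    MemLp (clusterDev S P s π cl c) 2 P :=
  MemLp.const_mul (memLp_finsetSum (f := fun i ω => S.ζ P s i ω - π)
    (Finset.univ.filter fun i => cl i = c)
    fun i _ => (h.memLp_ζ hs i).sub (memLp_const π)) ((n : ℝ) / k)⁻¹

lemma integral_clusterDev (h : S.Regular P act pmin cy) (hs : Measurable s)
    (hπ : ∀ i, π = S.policyValue P s i) (c : Fin k) : ∫ ω, clusterDev S P s π cl c ω ∂P = 0 := by
  have hi : ∀ i, Integrable (S.ζ P s i) P := fun i => (h.memLp_ζ hs i).integrable (by norm_num)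
  simp only [clusterDev, clusterSum]
  rw [integral_const_mul, integral_finsetSum (f := fun i ω => S.ζ P s i ω - π) _
    fun i _ => (hi i).sub (integrable_const π)]
  rw [Finset.sum_eq_zero, mul_zero]
  intro i _
  rw [integral_sub (hi i) (integrable_const _), h.integral_ζ hs i, integral_const, hπ i]
  simp

/-- Independence across clusters makes the variance of the total the sum of the variances of the
cluster sums. -/
lemma sigmaN_eq_mean_integral_sq (h : S.Regular P act pmin cy) (hs : Measurable s)
    (hπ : ∀ i, π = S.policyValue P s i) (hind : iIndepFun
      (fun (c : Fin k) ω (i : {i : Fin n // cl i = c}) => S.ζ P s i ω) P)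
    (hn : 0 < n) (hk : 0 < k) :
    ((n : ℝ) / k)⁻¹ * S.sigmaN P s = (k : ℝ)⁻¹ * ∑ c, ∫ ω, clusterDev S P s π cl c ω ^ 2 ∂P := by
  have hn' : (n : ℝ) ≠ 0 := by exact_mod_cast hn.ne'
  have hk' : (k : ℝ) ≠ 0 := by exact_mod_cast hk.ne'
  have hsum : ∀ ω, ∑ c, clusterDev S P s π cl c ω =
      ((n : ℝ) / k)⁻¹ * (∑ i, S.ζ P s i ω - n * π) := fun ω => by
    simp only [clusterDev, clusterSum]
    rw [← Finset.mul_sum, Finset.sum_fiberwise]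
    simp
  have hvar : Var[∑ c, clusterDev S P s π cl c; P] =
      ((n : ℝ) / k)⁻¹ ^ 2 * (n * S.sigmaN P s) := by
    have : ∑ c, clusterDev S P s π cl c =
        fun ω => ((n : ℝ) / k)⁻¹ * (∑ i, S.ζ P s i ω - n * π) := by
      ext ω; rw [Finset.sum_apply, hsum]
    rw [this, variance_const_mul, variance_sub_const, Study.mul_sigmaN]
    exact (memLp_finsetSum _ fun i _ => h.memLp_ζ hs i).aestronglyMeasurable
  rw [IndepFun.variance_sum (fun c _ => memLp_clusterDev h hs c)
    fun c _ c' _ hcc => (iIndepFun_clusterDev hind).indepFun hcc] at hvar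
  have hsq : ∀ c, Var[clusterDev S P s π cl c; P] = ∫ ω, clusterDev S P s π cl c ω ^ 2 ∂P :=
    fun c => variance_of_integral_eq_zero (measurable_clusterDev hs c).aemeasurable
      (integral_clusterDev h hs hπ c)
  simp only [hsq] at hvar
  rw [hvar]
  field_simp

end Random

end NetCausal
end

noncomputable section

namespace NetCausal

/-! ### Consistency of the cluster variance estimator -/

lemma isOpOne_of_tendsto_zero {Ω : ℕ → Type*} [∀ n, MeasurableSpace (Ω n)]
    {P : ∀ n, Measure (Ω n)} [∀ n, IsProbabilityMeasure (P n)] {x : ℕ → ℝ}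
    (hx : Tendsto x atTop (𝓝 0)) : IsOpOne P fun n _ => x n :=
  isOpOne_of_integral_abs_le (b := fun n => |x n|) (Eventually.of_forall fun n => integrable_const _)
    (Eventually.of_forall fun n => by simp) (by simpa using hx.abs)

section Consistency

variable {Ω : ℕ → Type*} [∀ n, MeasurableSpace (Ω n)] {P : ∀ n, Measure (Ω n)}
  [∀ n, IsProbabilityMeasure (P n)] {d K : ℕ} {wOut : Bool → ℕ → ℕ} {wProp : ℕ → ℕ}
  {S : ∀ n, Study (Ω n) d K n wOut wProp} {kind : OutcomeKind} {act : ℝ → ℝ}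
  {𝒳 : Set (Fin d → ℝ)} {zbar : ℝ} {s : LocalInfo d (K + 1) → Bool} {pmin cy : ℝ} {π : ℕ → ℝ}
  {cbar : ℕ → ℕ} {cl : ∀ n, Fin n → Fin (cbar n)}

/-- One uniform bound of order above two yields both the boundedness of the normalized variance and
the uniform integrability of the squared cluster sums. -/
lemma AssumptionIII.exists_eLpNorm_clusterDev_le (h3 : AssumptionIII P S s cbar cl)
    (hs : Measurable s) (hreg : ∀ n, (S n).Regular (P n) act pmin cy)
    (hπ : ∀ n (i : Fin n), π n = (S n).policyValue (P n) s i) :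
    ∃ δ M : ℝ, 0 < δ ∧ 0 ≤ M ∧ ∀ᶠ n in atTop, ∀ c,
      eLpNorm (clusterDev (S n) (P n) s (π n) (cl n) c) (ENNReal.ofReal (2 + δ)) (P n) ≤
        ENNReal.ofReal M := by
  obtain ⟨C, hC⟩ := h3.balanced_sizes
  obtain ⟨δ, c0, hδ, hc0, hm⟩ := h3.higher_moment
  set M : ℝ := 2 * (2 / pmin * (1 + √cy) * (1 + 2 * c0 ^ (1 / (2 + δ))))
  have hM : 0 ≤ M := by
    have := (hreg 0).pmin_pos
    positivity
  refine ⟨δ, |C| * M, hδ, by positivity, ?_⟩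
  filter_upwards [hC, eventually_ge_atTop 1, h3.many_clusters.eventually_ge_atTop 1]
    with n hn h1 hk c
  refine eLpNorm_clusterDev_le (ENNReal.one_le_ofReal.2 (by linarith)) hs h1 hk
    (fun c => (hn c).trans ?_) (fun i => ?_) c
  · exact mul_le_mul_of_nonneg_right (le_abs_self C) (by positivity)
  · rw [hπ n i]
    exact (hreg n).eLpNorm_ζ_sub_le hs hδ hc0.le i fun t => hm n t i

/-- The variance of the estimator is of the order of the average cluster size. -/
lemma AssumptionIII.exists_sigmaN_le (h3 : AssumptionIII P S s cbar cl)
    (hs : Measurable s) (hreg : ∀ n, (S n).Regular (P n) act pmin cy)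
    (hπ : ∀ n (i : Fin n), π n = (S n).policyValue (P n) s i) :
    ∃ V : ℝ, ∀ᶠ n : ℕ in atTop, ((n : ℝ) / cbar n)⁻¹ * (S n).sigmaN (P n) s ≤ V := by
  obtain ⟨δ, M, hδ, hM, hle⟩ := h3.exists_eLpNorm_clusterDev_le hs hreg hπ
  refine ⟨M ^ 2, ?_⟩
  filter_upwards [hle, eventually_ge_atTop 1, h3.many_clusters.eventually_ge_atTop 1]
    with n hn h1 hk
  have hk' : (0 : ℝ) < cbar n := by exact_mod_cast hk
  rw [sigmaN_eq_mean_integral_sq (hreg n) hs (hπ n) (h3.independent_clusters n) h1 hk,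
    inv_mul_le_iff₀ hk']
  refine (Finset.sum_le_sum fun c _ => integral_sq_le_of_eLpNorm_le hδ hM
    (measurable_clusterDev hs c).aestronglyMeasurable (hn c)).trans ?_
  simp

lemma isOpOne_mean_sq_clusterDev_sub (h3 : AssumptionIII P S s cbar cl)
    (hs : Measurable s) (hreg : ∀ n, (S n).Regular (P n) act pmin cy)
    (hπ : ∀ n (i : Fin n), π n = (S n).policyValue (P n) s i) :
    IsOpOne P fun n ω =>
      (cbar n : ℝ)⁻¹ * ∑ c, clusterDev (S n) (P n) s (π n) (cl n) c ω ^ 2 -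
        ((n : ℝ) / cbar n)⁻¹ * (S n).sigmaN (P n) s := by
  obtain ⟨δ, M, hδ, hM, hle⟩ := h3.exists_eLpNorm_clusterDev_le hs hreg hπ
  have key : IsOpOne P fun n ω => (cbar n : ℝ)⁻¹ *
      ∑ c, (clusterDev (S n) (P n) s (π n) (cl n) c ω ^ 2 -
        ∫ ω', clusterDev (S n) (P n) s (π n) (cl n) c ω' ^ 2 ∂P n) := by
    refine isOpOne_mean_sub_of_tail h3.many_clusters
      (Q := fun n c ω => clusterDev (S n) (P n) s (π n) (cl n) c ω ^ 2)
      (fun n c ω => sq_nonneg _) (fun n c => (memLp_clusterDev (hreg n) hs c).integrable_sq)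
      (fun n => (iIndepFun_clusterDev (h3.independent_clusters n)).comp (fun _ x => x ^ 2)
        fun _ => by fun_prop) fun ε hε => ?_
    have hlim : Tendsto (fun B : ℝ => M ^ (2 + δ) / B ^ (δ / 2)) atTop (𝓝 0) :=
      tendsto_const_nhds.div_atTop (tendsto_rpow_atTop (by positivity))
    obtain ⟨B, hB, hB0⟩ := ((hlim.eventually_le_const hε).and (eventually_gt_atTop 0)).exists
    refine ⟨B, hB0.le, ?_⟩
    filter_upwards [hle] with n hn c
    exact (integral_sq_sub_min_le hδ hM hB0 (measurable_clusterDev hs c).aestronglyMeasurable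
      (hn c)).trans hB
  refine key.of_abs_le_mul 1 ?_
  filter_upwards [eventually_ge_atTop 1, h3.many_clusters.eventually_ge_atTop 1] with n h1 hk
  refine ae_of_all _ fun ω => ?_
  rw [sigmaN_eq_mean_integral_sq (hreg n) hs (hπ n) (h3.independent_clusters n) h1 hk,
    Finset.sum_sub_distrib, mul_sub, one_mul]

lemma isBigOpOne_mean_sq_clusterDev (h3 : AssumptionIII P S s cbar cl)
    (hs : Measurable s) (hreg : ∀ n, (S n).Regular (P n) act pmin cy)
    (hπ : ∀ n (i : Fin n), π n = (S n).policyValue (P n) s i) :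
    IsBigOpOne P fun n ω =>
      (cbar n : ℝ)⁻¹ * ∑ c, clusterDev (S n) (P n) s (π n) (cl n) c ω ^ 2 := by
  obtain ⟨V, hV⟩ := h3.exists_sigmaN_le hs hreg hπ
  have hi : ∀ n c, Integrable (fun ω => clusterDev (S n) (P n) s (π n) (cl n) c ω ^ 2) (P n) :=
    fun n c => (memLp_clusterDev (hreg n) hs c).integrable_sq
  refine isBigOpOne_of_integral_abs_le (B := V)
    (Eventually.of_forall fun n => (integrable_finsetSum _ fun c _ => hi n c).const_mul _) ?_
  filter_upwards [hV, eventually_ge_atTop 1, h3.many_clusters.eventually_ge_atTop 1]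
    with n hn h1 hk
  rw [sigmaN_eq_mean_integral_sq (hreg n) hs (hπ n) (h3.independent_clusters n) h1 hk] at hn
  refine le_trans (le_of_eq ?_) hn
  rw [← integral_finsetSum _ fun c _ => hi n c, ← integral_const_mul]
  exact integral_congr_ae (ae_of_all _ fun ω =>
    abs_of_nonneg (mul_nonneg (by positivity) (Finset.sum_nonneg fun c _ => sq_nonneg _)))

/-- The variance may grow with the cluster sizes, but `Σ_n / n` is `O(1 / cbar)`, so the
standardized error, which is `O_p(1)`, is multiplied by a vanishing factor. -/
lemma isOpOne_piHat_sub_policyValue (h : AssumptionII P S kind act s)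
    (h3 : AssumptionIII P S s cbar cl) (hset : ∀ n, (S n).Setup (P n) kind act 𝒳 zbar)
    (hs : Measurable s) (hreg : ∀ n, (S n).Regular (P n) act pmin cy)
    (hπ : ∀ n (i : Fin n), π n = (S n).policyValue (P n) s i) :
    IsOpOne P fun n ω => (S n).piHat kind act s ω - π n := by
  obtain ⟨V, hV⟩ := h3.exists_sigmaN_le hs hreg hπ
  obtain ⟨c, hc, hσ⟩ := h.exists_sigmaN_gt
  have hbig : IsBigOpOne P fun n ω => (√((S n).sigmaN (P n) s))⁻¹ *
      (√(n : ℝ) * ((S n).piHat kind act s ω - π n)) := by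
    have := (isOpOne_sub_standardizedMean h hset hs hreg hπ).isBigOpOne.add
      (isBigOpOne_standardizedMean h hs hreg)
    simpa only [sub_add_cancel] using this
  have hlim : Tendsto (fun n : ℕ => √((S n).sigmaN (P n) s / n)) atTop (𝓝 0) := by
    rw [← Real.sqrt_zero]
    refine (Real.continuous_sqrt.tendsto 0).comp ?_
    have hz : Tendsto (fun n => V / (cbar n : ℝ)) atTop (𝓝 0) :=
      tendsto_const_nhds.div_atTop (tendsto_natCast_atTop_atTop.comp h3.many_clusters)
    refine squeeze_zero' ?_ ?_ hz
    · filter_upwards [hσ] with n hn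
      exact div_nonneg (hc.trans hn).le (Nat.cast_nonneg n)
    · filter_upwards [hV, eventually_ge_atTop 1, h3.many_clusters.eventually_ge_atTop 1]
        with n hn h1 hk
      have hn' : (0 : ℝ) < n := by exact_mod_cast h1
      have hk' : (0 : ℝ) < cbar n := by exact_mod_cast hk
      rw [inv_mul_le_iff₀ (by positivity)] at hn
      rw [div_le_iff₀ hn']
      calc _ ≤ (n : ℝ) / cbar n * V := hn
        _ = V / cbar n * n := by ring
  refine ((isOpOne_of_tendsto_zero hlim).mul_isBigOpOne hbig).of_abs_le_mul 1 ?_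
  filter_upwards [hσ, eventually_ge_atTop 1] with n hn h1
  refine ae_of_all _ fun ω => le_of_eq ?_
  have hσ0 : √((S n).sigmaN (P n) s) ≠ 0 := (Real.sqrt_pos.2 (hc.trans hn)).ne'
  have hn0 : √(n : ℝ) ≠ 0 := (Real.sqrt_pos.2 (by exact_mod_cast h1)).ne'
  rw [one_mul, Real.sqrt_div (hc.trans hn).le]
  congr 1
  field_simp

/-- Ratio consistency of the feasible cluster variance estimator. -/
theorem isOpOne_sigmaHat_div_sigmaN_sub_one (h : AssumptionII P S kind act s)
    (h3 : AssumptionIII P S s cbar cl) (hset : ∀ n, (S n).Setup (P n) kind act 𝒳 zbar)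
    (hs : Measurable s) (hreg : ∀ n, (S n).Regular (P n) act pmin cy)
    (hπ : ∀ n (i : Fin n), π n = (S n).policyValue (P n) s i) :
    IsOpOne P fun n ω => (S n).sigmaHat kind act s (cl n) ω / (S n).sigmaN (P n) s - 1 := by
  obtain ⟨C, hC⟩ := h3.balanced_sizes
  obtain ⟨cσ, hcσ, hl⟩ := h3.nondegenerate
  have hσ := eventually_lt_of_ofReal_lt_liminf hcσ hl
  set A : ∀ n, Ω n → ℝ := fun n ω =>
    (cbar n : ℝ)⁻¹ * ∑ c, clusterDev (S n) (P n) s (π n) (cl n) c ω ^ 2 with hA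
  -- The perturbation collects both the error of the estimated scores and that of the estimated
  -- centre, so that `ζHat - piHat = (ζ - π) + e`.
  set e : ∀ n, Ω n → Fin n → ℝ := fun n ω i =>
    (S n).ζHat kind act s i ω - (S n).ζ (P n) s i ω - ((S n).piHat kind act s ω - π n) with he
  set E : ∀ n, Ω n → ℝ := fun n ω =>
    (cbar n : ℝ)⁻¹ * ∑ c, clusterSum (cl n) (e n ω) c ^ 2 with hE
  have hd := isOpOne_piHat_sub_policyValue h h3 hset hs hreg hπ
  have hEop : IsOpOne P E := by
    refine ((isOpOne_mean_sq_ζHat_sub h hset hs hreg).add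
      (hd.mul_isBigOpOne hd.isBigOpOne)).of_abs_le_mul (2 * |C|) ?_
    filter_upwards [hC, eventually_ge_atTop 1, h3.many_clusters.eventually_ge_atTop 1]
      with n hn h1 hk
    refine ae_of_all _ fun ω => ?_
    have hn' : (0 : ℝ) < n := by exact_mod_cast h1
    have hE0 : 0 ≤ E n ω := mul_nonneg (by positivity) (Finset.sum_nonneg fun c _ => sq_nonneg _)
    rw [abs_of_nonneg hE0]
    refine (mean_sq_clusterSum_le (C := |C|) h1 hk (fun c => (hn c).trans
      (mul_le_mul_of_nonneg_right (le_abs_self C) (by positivity))) (e n ω)).trans ?_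
    rw [mul_comm 2, mul_assoc]
    refine mul_le_mul_of_nonneg_left ?_ (abs_nonneg C)
    refine le_trans ?_ (mul_le_mul_of_nonneg_left (le_abs_self _) zero_le_two)
    calc (n : ℝ)⁻¹ * ∑ i, e n ω i ^ 2
        ≤ (n : ℝ)⁻¹ * ∑ i, (2 * ((S n).ζHat kind act s i ω - (S n).ζ (P n) s i ω) ^ 2 +
            2 * ((S n).piHat kind act s ω - π n) ^ 2) := by
          gcongr with i
          simp only [he]
          nlinarith [sq_nonneg ((S n).ζHat kind act s i ω - (S n).ζ (P n) s i ω +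
            ((S n).piHat kind act s ω - π n))]
      _ = _ := by
          rw [Finset.sum_add_distrib, ← Finset.mul_sum, Finset.sum_const, Finset.card_univ,
            Fintype.card_fin, nsmul_eq_mul]
          field_simp
  have hsqrt := (hEop.mul_isBigOpOne (isBigOpOne_mean_sq_clusterDev h3 hs hreg hπ)).sqrt
  have hdiff : IsOpOne P fun n ω =>
      ((n : ℝ) / cbar n)⁻¹ * (S n).sigmaHat kind act s (cl n) ω - A n ω := by
    refine ((hsqrt.add hsqrt).add hEop).of_abs_le_mul 1 ?_
    filter_upwards [eventually_ge_atTop 1, h3.many_clusters.eventually_ge_atTop 1] with n h1 hk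
    refine ae_of_all _ fun ω => ?_
    have hsplit : ∀ c, clusterSum (cl n)
        (fun i => (S n).ζHat kind act s i ω - (S n).piHat kind act s ω) c =
        clusterDev (S n) (P n) s (π n) (cl n) c ω + clusterSum (cl n) (e n ω) c := fun c => by
      rw [clusterDev, ← clusterSum_add]
      congr 1
      ext i
      simp only [he]
      ring
    rw [sigmaHat_eq_mean_sq_clusterSum h1 hk (h3.nonempty_clusters n)]
    simp only [hsplit]
    refine (abs_mean_sq_add_sub_le _ _).trans ?_
    rw [one_mul, two_mul]
    exact le_abs_self _
  -- Both variances are compared after division by `n / cbar`. On that scale the true one is bounded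
  -- below by `cσ`, so a vanishing difference becomes a vanishing relative error.
  refine (hdiff.add (isOpOne_mean_sq_clusterDev_sub h3 hs hreg hπ)).of_abs_le_mul cσ⁻¹ ?_
  filter_upwards [hσ, eventually_ge_atTop 1, h3.many_clusters.eventually_ge_atTop 1]
    with n hn h1 hk
  refine ae_of_all _ fun ω => ?_
  have hn' : (0 : ℝ) < n := by exact_mod_cast h1
  have hk' : (0 : ℝ) < cbar n := by exact_mod_cast hk
  have hl0 : 0 < ((n : ℝ) / cbar n)⁻¹ := by positivity
  have hpos : 0 < (S n).sigmaN (P n) s := pos_of_mul_pos_right (hcσ.trans hn) hl0.le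
  rw [sub_add_sub_cancel, ← mul_sub, div_sub_one hpos.ne', abs_div, abs_mul, abs_of_pos hpos,
    abs_of_pos hl0, div_le_iff₀ hpos]
  have : 1 ≤ cσ⁻¹ * (((n : ℝ) / cbar n)⁻¹ * (S n).sigmaN (P n) s) := by
    rw [← div_eq_inv_mul, one_le_div hcσ]
    exact hn.le
  calc _ = 1 * |(S n).sigmaHat kind act s (cl n) ω - (S n).sigmaN (P n) s| := (one_mul _).symm
    _ ≤ _ * |(S n).sigmaHat kind act s (cl n) ω - (S n).sigmaN (P n) s| :=
        mul_le_mul_of_nonneg_right this (abs_nonneg _)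
    _ = _ := by ring

end Consistency

end NetCausal
end

/-! ### Both distributional limits -/

theorem corollary1 {Ω : ℕ → Type*} [∀ n, MeasurableSpace (Ω n)]
    (P : ∀ n, Measure (Ω n)) [∀ n, IsProbabilityMeasure (P n)]
    {d K : ℕ} {wOut : Bool → ℕ → ℕ} {wProp : ℕ → ℕ}
    (S : ∀ n, Study (Ω n) d K n wOut wProp)
    (kind : OutcomeKind) (act : ℝ → ℝ) (𝒳 : Set (Fin d → ℝ)) (zbar : ℝ)
    (s : LocalInfo d (K + 1) → Bool) (hs : Measurable s)
    (hsetup : ∀ n, (S n).Setup (P n) kind act 𝒳 zbar)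
    (π : ℕ → ℝ) (hπ : ∀ n (i : Fin n), π n = (S n).policyValue (P n) s i)
    (hII : AssumptionII P S kind act s) :
    TendstoInDistribution
        (fun n ω => (√((S n).sigmaN (P n) s))⁻¹ * (√(n : ℝ) * ((S n).piHat kind act s ω - π n)))
        atTop id P (gaussianReal 0 1) ∧
    ∀ (cbar : ℕ → ℕ) (cl : ∀ n, Fin n → Fin (cbar n)), AssumptionIII P S s cbar cl →
      TendstoInDistribution
        (fun n ω => (√((S n).sigmaHat kind act s (cl n) ω))⁻¹ *
          (√(n : ℝ) * ((S n).piHat kind act s ω - π n)))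
        atTop id P (gaussianReal 0 1) := by
  obtain ⟨pmin, cy, hreg⟩ := hII.exists_regular
  refine ⟨?_, fun cbar cl hIII => ?_⟩
  · refine tendstoInDistribution_of_ratio hII hsetup hs hreg hπ
      (fun n _ => (S n).sigmaN (P n) s) (fun n => measurable_const) ?_
    obtain ⟨c, hc, hσ⟩ := hII.exists_sigmaN_gt
    -- The true variance is trivially ratio-consistent once it is positive, which holds for all
    -- large `n`.
    refine isOpOne_of_tendsto_zero (tendsto_const_nhds.congr' ?_)
    filter_upwards [hσ] with n hn
    rw [div_self (hc.trans hn).ne', sub_self]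
  · exact tendstoInDistribution_of_ratio hII hsetup hs hreg hπ
      (fun n => (S n).sigmaHat kind act s (cl n)) (fun n => (hsetup n).measurable_sigmaHat hs (cl n))
      (isOpOne_sigmaHat_div_sigmaN_sub_one hII hIII hsetup hs hreg hπ)
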